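/- Let $\omega(x)=e^{-x^2}$, $H_n(x)=\frac{(-1)^n}{\omega(x)}\frac{d^n\omega}{dx^n}(x)$, $\gamma_n=2^n n!\sqrt{\pi}$ and $\psi_n(x)=e^{-x^2/2}H_n(x)/\sqrt{\gamma_n}$ for $n\ge 0$. For suitable $f:\mathbb{R}\to\mathbb{C}$ put $$\Pi_n^{P}f=\sum_{k=0}^n a_kH_k,\quad a_k=\frac1{\gamma_k}\int_{\mathbb R} fH_k\,\omega\,dx,\qquad \Pi_n^{F}f=\sum_{k=0}^n c_k\psi_k,\quad c_k=\int_{\mathbb R} f\psi_k\,dx,$$ and let $\|g\|_{L^2_\omega}=(\int_{\mathbb R}|g|^2\omega\,dx)^{1/2}$ and $\|g\|_{L^\infty}=\sup_{x\in\mathbb R}|g(x)|$. Let $\rho>0$, let $\mathcal S_\rho=\{z\in\mathbb C:\ -\rho\le \operatorname{Im} z\le\rho\}$, let $f$ be analytic on a neighbourhood of $\mathcal S_\rho$, and let $m\ge 0$ be an integer. Derivatives and projections below are those of the restriction of $f$ to $\mathbb R$. (i) Suppose that for some $\sigma\in\mathbb R$ one has $|f(z)|=O(|z|^\sigma)$ as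 $|z|\to\infty$ within $\mathcal S_\rho$, and let $V=\int_{\partial\mathcal S_\rho}|e^{-z^2/2}f(z)|\,|dz|$. Then there are real numbers $\mathcal K_n$ with $\lim_{n\to\infty}\mathcal K_n=2^{m/2-1}V/\sqrt{\pi\rho}$ such that, for all sufficiently large $n$, $$\|(f-\Pi_n^{P}f)^{(m)}\|_{L^2_\omega}\le \mathcal K_n\,n^{m/2}e^{-\rho\sqrt{2n}}.$$ (ii) Suppose that for some $\sigma\in\mathbb R$ one has $|e^{z^2/2}f(z)|=O(|z|^\sigma)$ as $|z|\to\infty$ within $\mathcal S_\rho$, and let $\widehat V=\int_{\partial\mathcal S_\rho}|f(z)|\,|dz|$. Then there are real numbers $\mathcal K_n$ with $\lim_{n\to\infty}\mathcal K_n=2^{m/2-1/4}\widehat V/\pi^{3/4}$ such that, for all sufficiently large $n$, $$\|(f-\Pi_n^{F}f)^{(m)}\|_{L^\infty}\le \mathcal K_n\,n^{m/2+1/4}e^{-\rho\sqrt{2n}};$$ and there are also real numbers $\mathcal K_n$ with $\lim_{n\to\infty}\mathcal K_n=2^{m/2-1/4}\widehat V/(\pi^{3/4}\rho)$ for which the same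 bound holds for all sufficiently large $n$. -/

import Mathlib

open MeasureTheory Filter Asymptotics Topology

noncomputable section

/-- The Hermite weight `ω(x) = e^{-x²}`. -/
def hermiteWeight (x : ℝ) : ℝ := Real.exp (-x ^ 2)

/-- The (physicists') Hermite polynomial `H_n(x) = (-1)^n / ω(x) * (dⁿω/dxⁿ)(x)`. -/
def hermiteH (n : ℕ) (x : ℝ) : ℝ :=
  (-1) ^ n / hermiteWeight x * iteratedDeriv n hermiteWeight x

/-- `γ_n = 2^n n! √π`, the squared norm of `H_n` for the weight `ω`. -/
def hermiteGamma (n : ℕ) : ℝ := 2 ^ n * (n.factorial : ℝ) * Real.sqrt Real.pi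

/-- The Hermite function `ψ_n(x) = e^{-x²/2} H_n(x) / √γ_n`. -/
def hermitePsi (n : ℕ) (x : ℝ) : ℝ :=
  Real.exp (-x ^ 2 / 2) * hermiteH n x / Real.sqrt (hermiteGamma n)

/-- The coefficient `a_k = ⟨g, H_k⟩_ω / γ_k`. -/
def hermiteCoeffP (g : ℝ → ℂ) (k : ℕ) : ℂ :=
  (∫ x : ℝ, g x * (hermiteH k x : ℂ) * (hermiteWeight x : ℂ)) / (hermiteGamma k : ℂ)

/-- The projection `Π_n^P g = ∑_{k ≤ n} a_k H_k`. -/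
def hermiteProjP (n : ℕ) (g : ℝ → ℂ) (x : ℝ) : ℂ :=
  ∑ k ∈ Finset.range (n + 1), hermiteCoeffP g k * (hermiteH k x : ℂ)

/-- The coefficient `c_k = ∫ g ψ_k`. -/
def hermiteCoeffF (g : ℝ → ℂ) (k : ℕ) : ℂ :=
  ∫ x : ℝ, g x * (hermitePsi k x : ℂ)

/-- The projection `Π_n^F g = ∑_{k ≤ n} c_k ψ_k`. -/
def hermiteProjF (n : ℕ) (g : ℝ → ℂ) (x : ℝ) : ℂ :=
  ∑ k ∈ Finset.range (n + 1), hermiteCoeffF g k * (hermitePsi k x : ℂ)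

/-- The norm of `L²_ω(ℝ)`, that is `(∫ |g|² ω)^{1/2}`, with values in `[0, ∞]`. -/
def weightedL2Norm (g : ℝ → ℂ) : ENNReal :=
  eLpNorm g 2 (volume.withDensity fun x : ℝ => ENNReal.ofReal (hermiteWeight x))

/-- The maximum norm over `ℝ`, with values in `[0, ∞]`. -/
def maxNorm (g : ℝ → ℂ) : ENNReal := ⨆ x : ℝ, ‖g x‖ₑ

/-- The closed infinite strip `S_ρ = {z : -ρ ≤ Im z ≤ ρ}`. -/
def strip (ρ : ℝ) : Set ℂ := {z : ℂ | z.im ∈ Set.Icc (-ρ) ρ}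

/-- The arclength integral `∫_{∂S_ρ} |g|` over the two lines `Im z = ρ` and `Im z = -ρ`. -/
def stripBoundaryIntegral (ρ : ℝ) (g : ℂ → ℂ) : ℝ :=
  (∫ x : ℝ, ‖g ((x : ℂ) + (ρ : ℂ) * Complex.I)‖) +
    ∫ x : ℝ, ‖g ((x : ℂ) - (ρ : ℂ) * Complex.I)‖

/-- `V = ∫_{∂S_ρ} |e^{-z²/2} f(z)| |dz|`. -/
def hermiteV (ρ : ℝ) (f : ℂ → ℂ) : ℝ :=
  stripBoundaryIntegral ρ fun z => Complex.exp (-z ^ 2 / 2) * f z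

/-- `V̂ = ∫_{∂S_ρ} |f(z)| |dz|`. -/
def hermiteVHat (ρ : ℝ) (f : ℂ → ℂ) : ℝ := stripBoundaryIntegral ρ f

/-- `|g(z)| ≤ C |z|^σ` for some constants `C` and `σ`, as `|z| → ∞` within the strip `S_ρ`. -/
def AlgebraicGrowthInStrip (ρ : ℝ) (g : ℂ → ℂ) : Prop :=
  ∃ σ : ℝ, g =O[Bornology.cobounded ℂ ⊓ 𝓟 (strip ρ)] fun z : ℂ => ‖z‖ ^ σ

end

/-!
Both parts rest on one sharp estimate for Hermite coefficients. Let `F` be analytic with algebraic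
growth in the strip (`F = f` in the polynomial case, `F = e^{z²/2} f` in the case of Hermite
functions), and let `c_n` be the coefficient of `e^{-x²/2} F` with respect to `ψ_n`.

* By Cauchy's formula the Gaussian is the difference of integrals over the lines `Im u = ∓τ`, and
  `n` differentiations put the kernel `(u - x)^{-n-1}` into them (`gaussianLineIntegral_sub`). In
  each integral the line on which `F` is integrated can be moved to the opposite edge `Im x = ±ρ` of
  the strip, at distance `τ + ρ` from `u` (`norm_integral_mul_hermiteH_le`). With
  `τ = (√(2n) - ρ) / 2`, dominated convergence for the double integral and Stirling's formula for
  the prefactor give `|c_n| ≤ A_n n^{-1/4} e^{-ρ√(2n)}` where `A_n` tends to an explicit multiple of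
  `∫ |e^{-z²/2} F(z)| |dz|` over the boundary of the strip (`exists_tendsto_coeff_bound`).
* Since the Hermite system is complete, the remainder is the tail of the Hermite series, and it can
  be differentiated term by term (`eq_tsum_hermiteCoeffF_mul`,
  `iteratedDeriv_tsum_of_locally_bounded`).
* Tails of series whose terms behave like `k^{p-1/2} e^{-c√(2k)}` are compared with a telescoping
  series, with a sharp constant (`eventually_tsum_tail_le`).

In the weighted `L²` norm the derivatives of the Hermite polynomials are again orthogonal, so the
squared norm of the remainder is such a tail, and its constant is the one claimed
(`exists_weightedL2Norm_bound`). In the maximum norm, the Hermite functions tend to zero uniformly,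
like `n^{-1/12}`, and each derivative costs a factor `√n`
(`exists_abs_iteratedDeriv_hermitePsi_le`). The triangle inequality then bounds
the remainder by `o(1) n^{m/2+1/4} e^{-ρ√(2n)}`, so that any nonnegative constant is admissible as
the limit, in particular the two in question (`exists_maxNorm_bound`). The uniform decay is proved
from Cauchy's formula for the generating function: up to an exact derivative, which integrates to
zero over the circle, its integrand is small in mean (`norm_integral_hermiteKernel_le`).
-/

noncomputable section

/-! ### Hermite polynomials and Hermite functions -/

/-- The Hermite polynomial `H_n` as an element of `ℝ[X]`, given by `H_{n+1} = 2 X H_n - H_n'`. -/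
def hermitePoly : ℕ → Polynomial ℝ
  | 0 => 1
  | n + 1 => 2 * Polynomial.X * hermitePoly n - (hermitePoly n).derivative

lemma hasDerivAt_hermiteWeight (x : ℝ) :
    HasDerivAt hermiteWeight (-2 * x * hermiteWeight x) x := by
  unfold hermiteWeight
  have h := ((hasDerivAt_pow 2 x).neg).exp
  convert! h using 1
  simp; ring

lemma hermiteWeight_pos (x : ℝ) : 0 < hermiteWeight x := Real.exp_pos _

lemma iteratedDeriv_hermiteWeight (n : ℕ) :
    iteratedDeriv n hermiteWeight =
      fun x => (-1) ^ n * (hermitePoly n).eval x * hermiteWeight x := by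
  induction n with
  | zero => ext x; simp [hermitePoly]
  | succ n ih =>
    rw [iteratedDeriv_succ, ih]
    ext x
    have h := (((hermitePoly n).hasDerivAt x).const_mul ((-1 : ℝ) ^ n)).mul
      (hasDerivAt_hermiteWeight x)
    refine h.deriv.trans ?_
    simp only [hermitePoly, Polynomial.eval_sub, Polynomial.eval_mul, Polynomial.eval_X,
      Polynomial.eval_ofNat]
    ring

lemma hermiteH_eq_eval (n : ℕ) (x : ℝ) : hermiteH n x = (hermitePoly n).eval x := by
  have h := (hermiteWeight_pos x).ne'
  rw [hermiteH, iteratedDeriv_hermiteWeight]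
  field_simp
  rw [← pow_mul, mul_comm n 2, pow_mul]
  simp

lemma derivative_hermitePoly_succ (n : ℕ) :
    (hermitePoly (n + 1)).derivative = 2 * ((n : Polynomial ℝ) + 1) * hermitePoly n := by
  induction n with
  | zero => simp [hermitePoly]
  | succ n ih =>
    rw [hermitePoly, Polynomial.derivative_sub, ih, Polynomial.derivative_mul, ih]
    have h2 : Polynomial.derivative (2 * ((n : Polynomial ℝ) + 1) * hermitePoly n) =
        2 * ((n : Polynomial ℝ) + 1) * (hermitePoly n).derivative := by
      simp [Polynomial.derivative_mul]
    have h3 : Polynomial.derivative (2 * Polynomial.X : Polynomial ℝ) = 2 := by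
      simp [Polynomial.derivative_mul]
    rw [h2, h3]
    push_cast
    rw [show hermitePoly (n + 1) = 2 * Polynomial.X * hermitePoly n -
      (hermitePoly n).derivative from rfl]
    ring

lemma hermiteH_zero (x : ℝ) : hermiteH 0 x = 1 := by
  rw [hermiteH_eq_eval]; simp [hermitePoly]

lemma continuous_hermiteH (n : ℕ) : Continuous (hermiteH n) := by
  rw [show hermiteH n = fun x => (hermitePoly n).eval x from funext (hermiteH_eq_eval n)]
  exact (hermitePoly n).continuous

lemma hasDerivAt_hermiteH_succ (n : ℕ) (x : ℝ) :
    HasDerivAt (hermiteH (n + 1)) (2 * (n + 1) * hermiteH n x) x := by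
  rw [show hermiteH (n + 1) = fun x => (hermitePoly (n + 1)).eval x from
    funext (hermiteH_eq_eval _), hermiteH_eq_eval]
  have h := (hermitePoly (n + 1)).hasDerivAt x
  rw [derivative_hermitePoly_succ] at h
  simpa using h

lemma hasDerivAt_hermiteH (n : ℕ) (x : ℝ) :
    HasDerivAt (hermiteH n) (2 * n * hermiteH (n - 1) x) x := by
  cases n with
  | zero =>
    rw [show hermiteH 0 = fun _ => 1 from funext hermiteH_zero]
    simpa using hasDerivAt_const x (1 : ℝ)
  | succ n => simpa using hasDerivAt_hermiteH_succ n x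

lemma hermiteH_succ (n : ℕ) (x : ℝ) :
    hermiteH (n + 1) x = 2 * x * hermiteH n x - 2 * n * hermiteH (n - 1) x := by
  have h := (hasDerivAt_hermiteH n x).deriv
  rw [show hermiteH n = fun x => (hermitePoly n).eval x from funext (hermiteH_eq_eval n),
    Polynomial.deriv] at h
  rw [hermiteH_eq_eval, hermiteH_eq_eval n, ← h]
  simp [hermitePoly]

/-- The raising relation `(H_n ω)' = -H_{n+1} ω`. -/
lemma hasDerivAt_hermiteH_mul_weight (n : ℕ) (x : ℝ) :
    HasDerivAt (fun t => hermiteH n t * hermiteWeight t)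
      (-(hermiteH (n + 1) x * hermiteWeight x)) x := by
  convert! (hasDerivAt_hermiteH n x).mul (hasDerivAt_hermiteWeight x) using 1
  rw [hermiteH_succ]; ring

lemma hermiteGamma_pos (n : ℕ) : 0 < hermiteGamma n := by
  unfold hermiteGamma; positivity

lemma hermiteGamma_succ (n : ℕ) : hermiteGamma (n + 1) = 2 * (n + 1) * hermiteGamma n := by
  unfold hermiteGamma
  rw [Nat.factorial_succ]; push_cast; ring

lemma continuous_hermitePsi (n : ℕ) : Continuous (hermitePsi n) := by
  have := continuous_hermiteH n
  unfold hermitePsi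
  fun_prop

lemma hasDerivAt_hermitePsi (n : ℕ) (x : ℝ) :
    HasDerivAt (hermitePsi n) (√(n / 2) * hermitePsi (n - 1) x -
      √((n + 1) / 2) * hermitePsi (n + 1) x) x := by
  have hE : HasDerivAt (fun x : ℝ => Real.exp (-x ^ 2 / 2)) (-x * Real.exp (-x ^ 2 / 2)) x := by
    convert! (((hasDerivAt_pow 2 x).neg).div_const 2).exp using 1
    simp; ring
  have h := (hE.mul (hasDerivAt_hermiteH n x)).div_const √(hermiteGamma n)
  have hg := Real.sqrt_pos.2 (hermiteGamma_pos n)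
  have e2 : √((n + 1) / 2) * hermitePsi (n + 1) x =
      Real.exp (-x ^ 2 / 2) * hermiteH (n + 1) x / (2 * √(hermiteGamma n)) := by
    unfold hermitePsi
    have : √(hermiteGamma (n + 1)) = 2 * √((n + 1) / 2) * √(hermiteGamma n) := by
      rw [hermiteGamma_succ, show (2 : ℝ) * (n + 1) * hermiteGamma n =
        2 ^ 2 * ((n + 1) / 2) * hermiteGamma n by ring, Real.sqrt_mul (by positivity),
        Real.sqrt_mul (by positivity), Real.sqrt_sq (by norm_num)]
    rw [this]
    have h1 : 0 < √(((n : ℝ) + 1) / 2) := Real.sqrt_pos.2 (by positivity)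
    field_simp
  have e1 : √(n / 2) * hermitePsi (n - 1) x =
      Real.exp (-x ^ 2 / 2) * (n * hermiteH (n - 1) x) / √(hermiteGamma n) := by
    cases n with
    | zero => simp
    | succ k =>
      have h1 := Real.sqrt_pos.2 (hermiteGamma_pos k)
      have h3 : 0 < √(((k : ℝ) + 1) / 2) := Real.sqrt_pos.2 (by positivity)
      have h2 : √(hermiteGamma (k + 1)) * √((k + 1) / 2) = (k + 1) * √(hermiteGamma k) := by
        rw [hermiteGamma_succ, ← Real.sqrt_mul (by have := hermiteGamma_pos k; positivity),
          show (2 : ℝ) * (k + 1) * hermiteGamma k * ((k + 1) / 2) = (k + 1) ^ 2 * hermiteGamma k by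
          ring, Real.sqrt_mul (by positivity), Real.sqrt_sq (by positivity)]
      simp only [hermitePsi, Nat.add_sub_cancel]
      push_cast
      have : √((k + 1) / 2) / √(hermiteGamma k) = (k + 1) / √(hermiteGamma (k + 1)) := by
        rw [div_eq_div_iff h1.ne' hg.ne', mul_comm, h2]
      calc √((k + 1) / 2) * (Real.exp (-x ^ 2 / 2) * hermiteH k x / √(hermiteGamma k))
          = (√((k + 1) / 2) / √(hermiteGamma k)) * (Real.exp (-x ^ 2 / 2) * hermiteH k x) := by
            ring
        _ = _ := by rw [this]; ring
  convert! h using 1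
  rw [e1, e2, hermiteH_succ]
  field_simp
  ring

/-! ### Orthonormality -/

lemma integrable_pow_mul_gaussian (k : ℕ) {b : ℝ} (hb : 0 < b) :
    Integrable fun x : ℝ => x ^ k * Real.exp (-b * x ^ 2) := by
  have h := integrable_rpow_mul_exp_neg_mul_sq hb (s := k)
    (by have : (0 : ℝ) ≤ k := k.cast_nonneg
        linarith)
  simpa using h

lemma integrable_polynomial_mul_gaussian (p : Polynomial ℝ) {b : ℝ} (hb : 0 < b) :
    Integrable fun x : ℝ => p.eval x * Real.exp (-b * x ^ 2) := by
  simp_rw [Polynomial.eval_eq_sum_range, Finset.sum_mul, mul_assoc]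
  exact integrable_finsetSum _ fun i _ => (integrable_pow_mul_gaussian i hb).const_mul _

lemma integrable_hermiteH_mul_weight (j k : ℕ) :
    Integrable fun x : ℝ => hermiteH j x * (hermiteH k x * hermiteWeight x) := by
  have h := integrable_polynomial_mul_gaussian (hermitePoly j * hermitePoly k) one_pos
  refine h.congr (ae_of_all _ fun x => ?_)
  simp only [hermiteH_eq_eval, hermiteWeight, Polynomial.eval_mul]
  ring_nf

lemma integral_hermiteH_mul_succ (j k : ℕ) :
    ∫ x : ℝ, hermiteH j x * (hermiteH (k + 1) x * hermiteWeight x) =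
      2 * j * ∫ x : ℝ, hermiteH (j - 1) x * (hermiteH k x * hermiteWeight x) := by
  have h := integral_mul_deriv_eq_deriv_mul_of_integrable
    (u := hermiteH j) (u' := fun x => 2 * j * hermiteH (j - 1) x)
    (v := fun t => hermiteH k t * hermiteWeight t)
    (v' := fun x => -(hermiteH (k + 1) x * hermiteWeight x))
    (fun x _ => hasDerivAt_hermiteH j x) (fun x _ => hasDerivAt_hermiteH_mul_weight k x)
    ?_ ?_ ?_
  · rw [← integral_const_mul]
    simp only [mul_neg, integral_neg, neg_inj] at h
    rw [h]
    simp only [mul_assoc]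
  · convert! (integrable_hermiteH_mul_weight j (k + 1)).neg using 1
    ext x; simp
  · convert! (integrable_hermiteH_mul_weight (j - 1) k).const_mul (2 * j : ℝ) using 1
    ext x; simp; ring
  · exact integrable_hermiteH_mul_weight j k

lemma integral_hermiteH_mul_hermiteH (j k : ℕ) :
    ∫ x : ℝ, hermiteH j x * (hermiteH k x * hermiteWeight x) =
      if j = k then hermiteGamma k else 0 := by
  induction k generalizing j with
  | zero =>
    cases j with
    | zero =>
      simp only [hermiteH_zero, one_mul, hermiteWeight, hermiteGamma]
      have := integral_gaussian 1
      simpa using this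
    | succ j =>
      have h := integral_hermiteH_mul_succ 0 j
      simp only [Nat.cast_zero, mul_zero, zero_mul] at h
      rw [if_neg (Nat.succ_ne_zero j), ← h]
      congr 1; ext x; ring
  | succ k ih =>
    rw [integral_hermiteH_mul_succ, ih]
    cases j with
    | zero => simp
    | succ j =>
      by_cases hjk : j = k
      · subst hjk; simp [hermiteGamma_succ]
      · simp [hjk]

lemma hermitePsi_mul_hermitePsi (j k : ℕ) (x : ℝ) :
    hermitePsi j x * hermitePsi k x = hermiteH j x * (hermiteH k x * hermiteWeight x) /
      (√(hermiteGamma j) * √(hermiteGamma k)) := by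
  unfold hermitePsi hermiteWeight
  rw [show -x ^ 2 = -x ^ 2 / 2 + -x ^ 2 / 2 by ring, Real.exp_add]
  ring_nf

lemma integrable_hermitePsi_mul (j k : ℕ) :
    Integrable fun x : ℝ => hermitePsi j x * hermitePsi k x := by
  simp_rw [hermitePsi_mul_hermitePsi]
  exact (integrable_hermiteH_mul_weight j k).div_const _

lemma integral_hermitePsi_mul (j k : ℕ) :
    ∫ x : ℝ, hermitePsi j x * hermitePsi k x = if j = k then 1 else 0 := by
  simp_rw [hermitePsi_mul_hermitePsi]
  rw [integral_div, integral_hermiteH_mul_hermiteH]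
  by_cases h : j = k
  · subst h
    have := hermiteGamma_pos j
    simp only [if_true]
    rw [Real.mul_self_sqrt this.le, div_self this.ne']
  · simp [h]

/-! ### Completeness -/

/-- A continuous function with exponential moments is determined by its moments: if they all
vanish, so does its Fourier transform, which is the sum of its Taylor series. -/
lemma eq_zero_of_forall_moment_eq_zero {h : ℝ → ℂ} (hc : Continuous h)
    (hint : ∀ c : ℝ, Integrable fun x : ℝ => Real.exp (c * |x|) * ‖h x‖)
    (hmom : ∀ k : ℕ, ∫ x : ℝ, (x : ℂ) ^ k * h x = 0) : h = 0 := by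
  have hi : Integrable h := by
    have h0 := hint 0
    simp only [zero_mul, Real.exp_zero, one_mul] at h0
    exact (integrable_norm_iff hc.aestronglyMeasurable).1 h0
  have hF : FourierTransform.fourier h = 0 := by
    ext w
    rw [Real.fourier_eq']
    set a : ℂ := -2 * Real.pi * w * Complex.I with ha
    have hs := hasSum_integral_of_dominated_convergence (μ := volume)
      (F := fun (k : ℕ) (x : ℝ) => (k.factorial : ℂ)⁻¹ * a ^ k * ((x : ℂ) ^ k * h x))
      (f := fun x => Complex.exp (a * x) * h x)
      (fun k x => (k.factorial : ℝ)⁻¹ * (‖a‖ * |x|) ^ k * ‖h x‖)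
      (fun k => by
        have : Continuous fun x : ℝ => (k.factorial : ℂ)⁻¹ * a ^ k * ((x : ℂ) ^ k * h x) := by
          fun_prop
        exact this.aestronglyMeasurable)
      (fun k => ae_of_all _ fun x => by
        simp [mul_pow, mul_assoc])
      (ae_of_all _ fun x => by
        have := (NormedSpace.expSeries_div_summable (𝔸 := ℝ) (‖a‖ * |x|)).mul_right ‖h x‖
        refine this.congr fun k => ?_
        simp only [div_eq_mul_inv]; ring)
      (by
        refine (hint ‖a‖).congr (ae_of_all _ fun x => ?_)
        simp only
        rw [tsum_mul_right, Real.exp_eq_exp_ℝ, NormedSpace.exp_eq_tsum_div]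
        simp only [div_eq_mul_inv, mul_comm])
      (ae_of_all _ fun x => by
        have := (NormedSpace.expSeries_div_hasSum_exp (𝔸 := ℂ) (a * x)).mul_right (h x)
        rw [← Complex.exp_eq_exp_ℂ] at this
        convert! this using 2 with k
        simp only [div_eq_mul_inv, mul_pow]; ring)
    simp_rw [integral_const_mul, hmom, mul_zero] at hs
    have h0 := hs.unique hasSum_zero
    refine Eq.trans ?_ h0
    congr 1; ext x
    rw [smul_eq_mul]
    congr 2
    simp [ha]; ring
  have hF' : Integrable (FourierTransform.fourier h) := by rw [hF]; exact integrable_zero _ _ _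
  have := hc.fourierInv_fourier_eq hi hF'
  rw [hF] at this
  rw [← this]
  ext w
  simp [Real.fourierInv_eq']

/-- Completeness of the Hermite polynomials, for continuous functions with exponential moments. -/
lemma eq_zero_of_forall_integral_hermiteH_eq_zero {h : ℝ → ℂ} (hc : Continuous h)
    (hint : ∀ c : ℝ, Integrable fun x : ℝ => Real.exp (c * |x|) * ‖h x‖)
    (hmom : ∀ k : ℕ, ∫ x : ℝ, (hermiteH k x : ℂ) * h x = 0) : h = 0 := by
  have hip : ∀ p : Polynomial ℝ, Integrable fun x : ℝ => ((p.eval x : ℝ) : ℂ) * h x := by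
    intro p
    have hm : ∀ k : ℕ, Integrable fun x : ℝ => (x : ℂ) ^ k * h x := by
      intro k
      refine ((hint 1).const_mul (k.factorial : ℝ)).mono'
        (by fun_prop) (ae_of_all _ fun x => ?_)
      have h1 := Real.pow_div_factorial_le_exp |x| (abs_nonneg x) k
      rw [div_le_iff₀ (by positivity)] at h1
      simp only [norm_mul, norm_pow, Complex.norm_real, Real.norm_eq_abs, one_mul]
      rw [← mul_assoc, mul_comm _ (Real.exp _)]
      gcongr
    simp_rw [Polynomial.eval_eq_sum_range, Complex.ofReal_sum, Finset.sum_mul]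
    refine integrable_finsetSum _ fun i _ => ?_
    convert! (hm i).const_mul ((p.coeff i : ℝ) : ℂ) using 1
    ext x; push_cast; ring
  have key : ∀ k j : ℕ, ∫ x : ℝ, (x : ℂ) ^ k * ((hermiteH j x : ℂ) * h x) = 0 := by
    intro k
    induction k with
    | zero => intro j; simpa using hmom j
    | succ k ih =>
      intro j
      have hint' : ∀ i, Integrable fun x : ℝ => (x : ℂ) ^ k * ((hermiteH i x : ℂ) * h x) := by
        intro i
        refine (hip (Polynomial.X ^ k * hermitePoly i)).congr (ae_of_all _ fun x => ?_)
        simp [hermiteH_eq_eval, mul_assoc]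
      have e : ∀ x : ℝ, (x : ℂ) ^ (k + 1) * ((hermiteH j x : ℂ) * h x) =
          (1 / 2) * ((x : ℂ) ^ k * ((hermiteH (j + 1) x : ℂ) * h x)) +
          j * ((x : ℂ) ^ k * ((hermiteH (j - 1) x : ℂ) * h x)) := by
        intro x
        rw [hermiteH_succ]; push_cast; ring
      simp_rw [e]
      rw [integral_add ((hint' _).const_mul _) ((hint' _).const_mul _), integral_const_mul,
        integral_const_mul, ih, ih]
      simp
  refine eq_zero_of_forall_moment_eq_zero hc hint fun k => ?_
  simpa [hermiteH_zero] using key k 0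

/-! ### The uniform bound for Hermite functions -/

/-- The derivatives of the generating function `exp (2xz - z²)` of the Hermite polynomials. -/
lemma iteratedDeriv_hermite_generating (x : ℂ) (n : ℕ) :
    iteratedDeriv n (fun z : ℂ => Complex.exp (2 * x * z - z ^ 2)) =
      fun z => ((hermitePoly n).map Complex.ofRealHom).eval (x - z) *
        Complex.exp (2 * x * z - z ^ 2) := by
  induction n with
  | zero => ext z; simp [hermitePoly]
  | succ n ih =>
    rw [iteratedDeriv_succ, ih]
    ext z
    have h1 : HasDerivAt (fun z : ℂ => x - z) (-1) z := by
      simpa using (hasDerivAt_id z).const_sub x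
    have h2 := (((hermitePoly n).map Complex.ofRealHom).hasDerivAt (x - z)).comp z h1
    have h3 : HasDerivAt (fun z : ℂ => Complex.exp (2 * x * z - z ^ 2))
        (Complex.exp (2 * x * z - z ^ 2) * (2 * x - 2 * z)) z := by
      refine HasDerivAt.cexp ?_
      exact (((hasDerivAt_id z).const_mul (2 * x)).sub (hasDerivAt_pow 2 z)).congr_deriv (by simp)
    refine (h2.mul h3).deriv.trans ?_
    simp only [hermitePoly, Polynomial.map_sub, Polynomial.map_mul, Polynomial.eval_sub,
      Polynomial.eval_mul, Polynomial.map_X, Polynomial.eval_X, Polynomial.derivative_map,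
      Function.comp, Polynomial.map_ofNat, Polynomial.eval_ofNat]
    ring

/-- The normalised integrand of the Cauchy integral for `H_n` over the circle of radius `√(n/2)`,
in the variable `y = x / √(2n)`. -/
def hermiteKernel (n : ℕ) (y θ : ℝ) : ℂ :=
  Complex.exp (n * (2 * y * Complex.exp (θ * Complex.I) - Complex.exp (θ * Complex.I) ^ 2 / 2 -
    θ * Complex.I - 1 / 2 - y ^ 2))

/-- Cauchy's formula for the Taylor coefficients at `0` of the generating function. The substitution
`x = 2 √(n/2) y` makes the size of the kernel depend on `n (cos θ - y)²` only. -/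
lemma hermiteH_eq_integral_hermiteKernel {n : ℕ} (hn : n ≠ 0) (y : ℝ) :
    ((Real.exp (-(2 * √(n / 2) * y) ^ 2 / 2) * hermiteH n (2 * √(n / 2) * y) : ℝ) : ℂ) =
      ((n.factorial * Real.exp (n / 2) / (2 * Real.pi * √(n / 2) ^ n) : ℝ) : ℂ) *
        ∫ θ in (0 : ℝ)..2 * Real.pi, hermiteKernel n y θ := by
  set r : ℝ := √(n / 2) with hr
  have hn' : (0 : ℝ) < n := by positivity
  have hr0 : 0 < r := Real.sqrt_pos.2 (by positivity)
  have hr2 : (r : ℂ) ^ 2 = n / 2 := by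
    rw [hr, ← Complex.ofReal_pow, Real.sq_sqrt (by positivity)]; simp
  have hr2' : r ^ 2 = n / 2 := Real.sq_sqrt (by positivity)
  set x : ℝ := 2 * r * y with hx
  have h := DifferentiableOn.circleIntegral_one_div_sub_center_pow_smul (c := 0) hr0 n
    (f := fun z : ℂ => Complex.exp (2 * x * z - z ^ 2)) (by fun_prop)
  rw [iteratedDeriv_hermite_generating] at h
  simp only [circleIntegral, deriv_circleMap, sub_zero, smul_eq_mul] at h
  have he : ((hermitePoly n).map Complex.ofRealHom).eval (x : ℂ) = (hermiteH n x : ℂ) := by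
    rw [hermiteH_eq_eval, ← Complex.ofRealHom_eq_coe x, Polynomial.eval_map,
      Polynomial.eval₂_at_apply]
    simp
  simp only [he, mul_zero, ne_eq, OfNat.ofNat_ne_zero, not_false_eq_true, zero_pow, sub_self,
    Complex.exp_zero, mul_one] at h
  have hk : ∀ θ : ℝ, circleMap 0 r θ * Complex.I * (1 / circleMap 0 r θ ^ (n + 1) *
      Complex.exp (2 * x * circleMap 0 r θ - circleMap 0 r θ ^ 2)) =
      (Complex.I * Real.exp (n / 2 + n * y ^ 2) / r ^ n) * hermiteKernel n y θ := by
    intro θ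
    have hc : circleMap 0 r θ ≠ 0 := circleMap_ne_center hr0.ne'
    have h1 : circleMap 0 r θ = r * Complex.exp (θ * Complex.I) := by simp [circleMap]
    have h2 : hermiteKernel n y θ = Complex.exp (2 * x * circleMap 0 r θ - circleMap 0 r θ ^ 2) *
        Complex.exp (-(n / 2 + n * y ^ 2)) / Complex.exp (θ * Complex.I) ^ n := by
      have h6 : Complex.exp (θ * Complex.I) ^ n = Complex.exp (n * (θ * Complex.I)) := by
        rw [Complex.exp_nat_mul]
      rw [hermiteKernel, h6, ← Complex.exp_add, ← Complex.exp_sub, h1, hx, mul_pow, hr2]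
      congr 1
      push_cast
      linear_combination (-4 * Complex.exp (θ * Complex.I) * y) * hr2
    have h3 : Complex.exp (n / 2 + n * y ^ 2) * Complex.exp (-(n / 2 + n * y ^ 2)) = 1 := by
      rw [← Complex.exp_add]; simp
    rw [h2, Complex.ofReal_exp]
    push_cast
    have h4 : circleMap 0 r θ ^ n = r ^ n * Complex.exp (θ * Complex.I) ^ n := by
      rw [h1, mul_pow]
    have h5 : (r : ℂ) ^ n ≠ 0 := by
      exact_mod_cast (pow_pos hr0 n).ne'
    have h6 := pow_ne_zero n (Complex.exp_ne_zero (θ * Complex.I))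
    rw [pow_succ, h4]
    generalize Complex.exp (n / 2 + n * (y : ℂ) ^ 2) = A at h3 ⊢
    generalize Complex.exp (-(n / 2 + n * (y : ℂ) ^ 2)) = B at h3 ⊢
    field_simp
    linear_combination -h3
  simp_rw [hk] at h
  rw [intervalIntegral.integral_const_mul] at h
  have hexp : Real.exp (-x ^ 2 / 2) * Real.exp (n / 2 + n * y ^ 2) = Real.exp (n / 2) := by
    rw [← Real.exp_add, hx]
    congr 1
    linear_combination (-2 * y ^ 2) * hr2'
  have hfac : (n.factorial : ℂ) ≠ 0 := by exact_mod_cast n.factorial_ne_zero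
  have hpi : (Real.pi : ℂ) ≠ 0 := by exact_mod_cast Real.pi_ne_zero
  have h5 : (r : ℂ) ^ n ≠ 0 := by exact_mod_cast (pow_pos hr0 n).ne'
  rw [← hexp]
  push_cast at h ⊢
  field_simp at h ⊢
  rw [h]

lemma norm_hermiteKernel (n : ℕ) (y θ : ℝ) :
    ‖hermiteKernel n y θ‖ = Real.exp (-(n * (Real.cos θ - y) ^ 2)) := by
  rw [hermiteKernel, Complex.norm_exp]
  congr 1
  rw [Complex.exp_mul_I, ← Complex.ofReal_cos, ← Complex.ofReal_sin]
  simp [pow_two]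
  simp only [Complex.cos_ofReal_re, Complex.sin_ofReal_re]
  have := Real.sin_sq_add_cos_sq θ
  linear_combination (n / 2 : ℝ) * this

lemma hasDerivAt_hermiteKernel (n : ℕ) (y θ : ℝ) :
    HasDerivAt (hermiteKernel n y) (-2 * Complex.I * n * Complex.exp (θ * Complex.I) *
      ((Real.cos θ - y : ℝ) : ℂ) * hermiteKernel n y θ) θ := by
  have h1 : HasDerivAt (fun θ : ℝ => (θ : ℂ) * Complex.I) Complex.I θ := by
    simpa using (Complex.ofRealCLM.hasDerivAt (x := θ)).mul_const Complex.I
  have h2 := h1.cexp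
  have h3 := (((((h2.const_mul (2 * (y : ℂ))).sub ((h2.pow 2).div_const 2)).sub h1).sub_const
    (1 / 2 : ℂ)).sub_const ((y : ℂ) ^ 2)).const_mul (n : ℂ)
  have h4 := h3.cexp
  refine h4.congr_deriv ?_
  unfold hermiteKernel
  simp only [Pi.pow_apply]
  set e := Complex.exp (θ * Complex.I) with he
  have h5 : e * Complex.exp (-(θ * Complex.I)) = 1 := by
    rw [he, ← Complex.exp_add]; simp
  have hcos : 2 * ((Real.cos θ : ℝ) : ℂ) = e + Complex.exp (-(θ * Complex.I)) := by
    rw [Complex.ofReal_cos, Complex.two_cos, he, neg_mul]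
  push_cast at hcos ⊢
  set E := Complex.exp (n * (2 * y * e - e ^ 2 / 2 - θ * Complex.I - 1 / 2 - y ^ 2))
  linear_combination E * Complex.I * n * e * hcos + E * Complex.I * n * h5

lemma integral_fold_cos_sin {g : ℝ → ℝ → ℝ}
    (hg : Continuous fun θ => g (Real.cos θ) |Real.sin θ|) :
    ∫ θ in (0 : ℝ)..2 * Real.pi, g (Real.cos θ) |Real.sin θ| =
      2 * ((∫ θ in (0 : ℝ)..Real.pi / 2, g (Real.cos θ) |Real.sin θ|) +
        ∫ θ in (0 : ℝ)..Real.pi / 2, g (-Real.cos θ) |Real.sin θ|) := by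
  set G := fun θ => g (Real.cos θ) |Real.sin θ|
  have h1 : ∫ θ in Real.pi..2 * Real.pi, G θ = ∫ θ in (0 : ℝ)..Real.pi, G θ := by
    have := intervalIntegral.integral_comp_sub_left G (2 * Real.pi) (a := 0) (b := Real.pi)
    rw [sub_zero, show 2 * Real.pi - Real.pi = Real.pi by ring] at this
    rw [← this]
    congr 1; ext θ
    simp [G, Real.cos_two_pi_sub, Real.sin_two_pi_sub]
  have h2 : ∫ θ in Real.pi / 2..Real.pi, G θ =
      ∫ θ in (0 : ℝ)..Real.pi / 2, g (-Real.cos θ) |Real.sin θ| := by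
    have := intervalIntegral.integral_comp_sub_left G Real.pi (a := 0) (b := Real.pi / 2)
    rw [sub_zero, show Real.pi - Real.pi / 2 = Real.pi / 2 by ring] at this
    rw [← this]
    congr 1; ext θ
    simp [G, Real.cos_pi_sub, Real.sin_pi_sub]
  rw [← intervalIntegral.integral_add_adjacent_intervals (b := Real.pi)
    (hg.intervalIntegrable _ _) (hg.intervalIntegrable _ _), h1,
    ← intervalIntegral.integral_add_adjacent_intervals (a := 0) (b := Real.pi / 2)
    (hg.intervalIntegrable _ _) (hg.intervalIntegrable _ _), h2]
  ring

lemma integral_sin_div_cos_sub_sq_add_sq_le (y : ℝ) {δ : ℝ} (hδ : 0 < δ) (a b : ℝ) :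
    ∫ θ in a..b, Real.sin θ / ((Real.cos θ - y) ^ 2 + δ ^ 2) ≤ Real.pi / δ := by
  have hd : ∀ θ : ℝ, HasDerivAt (fun θ => -(Real.arctan ((Real.cos θ - y) / δ) / δ))
      (Real.sin θ / ((Real.cos θ - y) ^ 2 + δ ^ 2)) θ := by
    intro θ
    have h := ((((Real.hasDerivAt_cos θ).sub_const y).div_const δ).arctan.div_const δ).neg
    convert! h using 1
    field_simp
    ring
  have hpos : ∀ θ : ℝ, (Real.cos θ - y) ^ 2 + δ ^ 2 ≠ 0 := fun θ => by positivity
  rw [intervalIntegral.integral_eq_sub_of_hasDerivAt (fun θ _ => hd θ)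
    (Continuous.intervalIntegrable (by fun_prop (disch := exact hpos _)) _ _)]
  have h1 := Real.arctan_lt_pi_div_two ((Real.cos a - y) / δ)
  have h2 := Real.neg_pi_div_two_lt_arctan ((Real.cos b - y) / δ)
  rw [neg_sub_neg, ← sub_div]
  gcongr
  linarith

lemma integral_sq_div_cos_sub_sq_add_sq_le (y : ℝ) {δ : ℝ} (hδ : 0 < δ) (hδ1 : δ ≤ 1) :
    ∫ θ in (0 : ℝ)..Real.pi / 2, δ ^ 2 / ((Real.cos θ - y) ^ 2 + δ ^ 2) ≤ 6 * √δ := by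
  have hpos : ∀ θ : ℝ, (Real.cos θ - y) ^ 2 + δ ^ 2 ≠ 0 := fun θ => by positivity
  have hc : Continuous fun θ => δ ^ 2 / ((Real.cos θ - y) ^ 2 + δ ^ 2) := by
    fun_prop (disch := exact hpos _)
  have hc' : Continuous fun θ => Real.sin θ / ((Real.cos θ - y) ^ 2 + δ ^ 2) := by
    fun_prop (disch := exact hpos _)
  have hs0 : 0 < √δ := Real.sqrt_pos.2 hδ
  have hs1 : √δ ≤ 1 := Real.sqrt_le_one.2 hδ1
  have hss : √δ * √δ = δ := Real.mul_self_sqrt hδ.le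
  have hpi := Real.pi_pos
  have hpi4 := Real.pi_lt_d2
  set t := Real.pi / 2 * √δ with ht
  have ht0 : 0 ≤ t := by positivity
  have ht1 : t ≤ Real.pi / 2 := by rw [ht]; nlinarith
  rw [← intervalIntegral.integral_add_adjacent_intervals (b := t)
    (hc.intervalIntegrable _ _) (hc.intervalIntegrable _ _)]
  have h1 : ∫ θ in (0 : ℝ)..t, δ ^ 2 / ((Real.cos θ - y) ^ 2 + δ ^ 2) ≤ ∫ θ in (0 : ℝ)..t, 1 := by
    refine intervalIntegral.integral_mono_on ht0 (hc.intervalIntegrable _ _)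
      (by simp) fun θ _ => ?_
    rw [div_le_one (by positivity)]
    nlinarith [sq_nonneg (Real.cos θ - y)]
  -- Away from `θ = 0` the factor `sin θ ≥ √δ` allows the substitution `c = cos θ`.
  have h2 : ∫ θ in t..Real.pi / 2, δ ^ 2 / ((Real.cos θ - y) ^ 2 + δ ^ 2) ≤
      ∫ θ in t..Real.pi / 2, (δ * √δ) * (Real.sin θ / ((Real.cos θ - y) ^ 2 + δ ^ 2)) := by
    refine intervalIntegral.integral_mono_on ht1 (hc.intervalIntegrable _ _)
      ((hc'.const_mul _).intervalIntegrable _ _) fun θ hθ => ?_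
    have h3 := Real.mul_le_sin (ht0.trans hθ.1) hθ.2
    have h4 : √δ ≤ Real.sin θ := by
      refine le_trans ?_ h3
      have : 2 / Real.pi * t ≤ 2 / Real.pi * θ := by gcongr; exact hθ.1
      refine le_trans (le_of_eq ?_) this
      rw [ht]; field_simp
    rw [← mul_div_assoc]
    gcongr
    calc δ ^ 2 = δ * √δ * √δ := by rw [mul_assoc, hss, sq]
      _ ≤ δ * √δ * Real.sin θ := by gcongr
  rw [intervalIntegral.integral_const_mul] at h2
  have h5 := integral_sin_div_cos_sub_sq_add_sq_le y hδ t (Real.pi / 2)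
  have h6 : (δ * √δ) * (∫ θ in t..Real.pi / 2, Real.sin θ / ((Real.cos θ - y) ^ 2 + δ ^ 2)) ≤
      (δ * √δ) * (Real.pi / δ) := by gcongr
  have h7 : (δ * √δ) * (Real.pi / δ) = Real.pi * √δ := by field_simp
  simp only [intervalIntegral.integral_const, smul_eq_mul, mul_one, sub_zero] at h1
  rw [ht] at h1
  nlinarith

/-- The contour integral is small because, with `w = cos θ - y`, the kernel has size
`exp (-n w ^ 2)` and derivative proportional to `w` times itself: where `w` is small the set of
angles is small, and elsewhere an integration by parts gains a factor `1 / n`. -/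
lemma norm_integral_hermiteKernel_le {n : ℕ} (hn : n ≠ 0) (y : ℝ) {δ : ℝ} (hδ : 0 < δ)
    (hδ1 : δ ≤ 1) :
    ‖∫ θ in (0 : ℝ)..2 * Real.pi, hermiteKernel n y θ‖ ≤ 24 * √δ + 8 / (n * δ) := by
  have hn' : (0 : ℝ) < n := by positivity
  have hpos : ∀ θ : ℝ, (Real.cos θ - y) ^ 2 + δ ^ 2 ≠ 0 := fun θ => by positivity
  set w : ℝ → ℝ := fun θ => Real.cos θ - y with hw
  set p : ℝ → ℝ := fun θ => w θ / (w θ ^ 2 + δ ^ 2) with hp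
  -- The factor is chosen so that `q` times the derivative of the kernel is `w² / (w² + δ²)` times
  -- the kernel.
  set q : ℝ → ℂ := fun θ => Complex.I / (2 * n) * (Complex.exp (-(θ * Complex.I)) * (p θ : ℂ))
    with hq
  set p' : ℝ → ℝ := fun θ =>
    (-Real.sin θ * (w θ ^ 2 + δ ^ 2) - w θ * (2 * w θ * -Real.sin θ)) / (w θ ^ 2 + δ ^ 2) ^ 2
    with hp'
  set q' : ℝ → ℂ := fun θ => Complex.I / (2 * n) *
    (Complex.exp (-(θ * Complex.I)) * (-Complex.I) * (p θ : ℂ) +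
      Complex.exp (-(θ * Complex.I)) * (p' θ : ℂ)) with hq'
  set K := hermiteKernel n y with hK
  set K' : ℝ → ℂ := fun θ => -2 * Complex.I * n * Complex.exp (θ * Complex.I) *
      ((w θ : ℝ) : ℂ) * K θ with hK'
  have hKd : ∀ θ, HasDerivAt K (K' θ) θ := hasDerivAt_hermiteKernel n y
  have hKc : Continuous K := continuous_iff_continuousAt.2 fun θ => (hKd θ).continuousAt
  have hwd : ∀ θ, HasDerivAt w (-Real.sin θ) θ := fun θ => (Real.hasDerivAt_cos θ).sub_const y
  have hpd : ∀ θ, HasDerivAt p (p' θ) θ := by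
    intro θ
    have := (hwd θ).div (((hwd θ).pow 2).add_const (δ ^ 2)) (hpos θ)
    refine this.congr_deriv ?_
    simp [hp']
  have hqd : ∀ θ, HasDerivAt q (q' θ) θ := by
    intro θ
    have h1 : HasDerivAt (fun θ : ℝ => -((θ : ℂ) * Complex.I)) (-Complex.I) θ := by
      exact ((Complex.ofRealCLM.hasDerivAt (x := θ)).mul_const Complex.I).neg.congr_deriv (by simp)
    exact ((h1.cexp.mul (hpd θ).ofReal_comp).const_mul _)
  have hwc : Continuous w := by fun_prop
  have hpc : Continuous p := by fun_prop (disch := exact hpos _)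
  have hpc' : Continuous p' := by
    fun_prop (disch := exact fun θ => pow_ne_zero 2 (hpos θ))
  have hqc' : Continuous q' := by fun_prop
  have hqc : Continuous q := by fun_prop
  have hKc' : Continuous K' := by fun_prop
  have hparts := intervalIntegral.integral_deriv_mul_eq_sub (u := K) (v := q) (u' := K') (v' := q')
    (a := 0) (b := 2 * Real.pi) (fun θ _ => hKd θ) (fun θ _ => hqd θ)
    (hKc'.intervalIntegrable _ _) (hqc'.intervalIntegrable _ _)
  have hper : K (2 * Real.pi) * q (2 * Real.pi) - K 0 * q 0 = 0 := by
    have h1 : K (2 * Real.pi) = K 0 := by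
      simp only [hK, hermiteKernel]
      push_cast
      rw [Complex.exp_two_pi_mul_I]
      refine Complex.exp_eq_exp_iff_exists_int.2 ⟨-n, ?_⟩
      simp
      ring
    have h2 : q (2 * Real.pi) = q 0 := by
      simp only [hq, hp, hw]
      push_cast
      rw [Complex.exp_neg, Complex.exp_two_pi_mul_I]
      simp
    rw [h1, h2, sub_self]
  rw [hper] at hparts
  -- The last summand is the derivative of the periodic function `K q`, which integrates to zero.
  have hsplit : ∀ θ, K θ = (δ ^ 2 / (w θ ^ 2 + δ ^ 2) : ℝ) * K θ - K θ * q' θ +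
      (K' θ * q θ + K θ * q' θ) := by
    intro θ
    have h1 : K' θ * q θ = (w θ ^ 2 / (w θ ^ 2 + δ ^ 2) : ℝ) * K θ := by
      simp only [hK', hq, hp]
      have h5 : Complex.exp (θ * Complex.I) * Complex.exp (-(θ * Complex.I)) = 1 := by
        rw [← Complex.exp_add]; simp
      have hnc : (n : ℂ) ≠ 0 := by exact_mod_cast hn
      have hdc : ((w θ : ℂ) ^ 2 + (δ : ℂ) ^ 2) ≠ 0 := by exact_mod_cast hpos θ
      push_cast
      generalize Complex.exp (θ * Complex.I) = e at h5 ⊢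
      generalize Complex.exp (-(θ * Complex.I)) = e' at h5 ⊢
      field_simp
      linear_combination (-(Complex.I ^ 2) * (w θ : ℂ) ^ 2 * K θ) * h5 -
        (w θ : ℂ) ^ 2 * K θ * Complex.I_sq
    have h2 : ((δ ^ 2 / (w θ ^ 2 + δ ^ 2) : ℝ) : ℂ) +
        ((w θ ^ 2 / (w θ ^ 2 + δ ^ 2) : ℝ) : ℂ) = 1 := by
      rw [← Complex.ofReal_add, ← add_div, add_comm (δ ^ 2), div_self (hpos θ), Complex.ofReal_one]
    rw [h1]
    linear_combination (-K θ) * h2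
  have hcA : Continuous fun θ => ((δ ^ 2 / (w θ ^ 2 + δ ^ 2) : ℝ) : ℂ) * K θ - K θ * q' θ := by
    have : Continuous fun θ => δ ^ 2 / (w θ ^ 2 + δ ^ 2) := by fun_prop (disch := exact hpos _)
    fun_prop
  have hI : ∫ θ in (0 : ℝ)..2 * Real.pi, K θ =
      ∫ θ in (0 : ℝ)..2 * Real.pi, (((δ ^ 2 / (w θ ^ 2 + δ ^ 2) : ℝ) : ℂ) * K θ - K θ * q' θ) := by
    rw [intervalIntegral.integral_congr fun θ _ => hsplit θ,
      intervalIntegral.integral_add (hcA.intervalIntegrable _ _)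
        (Continuous.intervalIntegrable (by fun_prop) _ _), hparts, add_zero]
  have hpb : ∀ θ, |p θ| ≤ 1 / (2 * δ) := by
    intro θ
    simp only [hp]
    have := hpos θ
    rw [abs_div, abs_of_pos (show 0 < w θ ^ 2 + δ ^ 2 by positivity),
      div_le_div_iff₀ (by positivity) (by positivity)]
    nlinarith [sq_nonneg (|w θ| - δ), sq_abs (w θ)]
  have hpb' : ∀ θ, |p' θ| ≤ |Real.sin θ| / (w θ ^ 2 + δ ^ 2) := by
    intro θ
    have h0 : 0 < w θ ^ 2 + δ ^ 2 := by positivity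
    have h1 : p' θ = Real.sin θ * ((w θ ^ 2 - δ ^ 2) / (w θ ^ 2 + δ ^ 2)) / (w θ ^ 2 + δ ^ 2) := by
      simp only [hp']; field_simp; ring
    have h2 : |(w θ ^ 2 - δ ^ 2) / (w θ ^ 2 + δ ^ 2)| ≤ 1 := by
      rw [abs_div, abs_of_pos h0, div_le_one h0, abs_le]
      constructor <;> nlinarith [sq_nonneg (w θ), sq_nonneg δ]
    rw [h1, abs_div, abs_of_pos h0, abs_mul]
    gcongr
    nlinarith [abs_nonneg (Real.sin θ)]
  have hqb : ∀ θ, ‖q' θ‖ ≤ 1 / (2 * n) * (1 / (2 * δ) + |Real.sin θ| / (w θ ^ 2 + δ ^ 2)) := by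
    intro θ
    have he : ‖Complex.exp (-(θ * Complex.I))‖ = 1 := by
      rw [← neg_mul, ← Complex.ofReal_neg, Complex.norm_exp_ofReal_mul_I]
    simp only [hq', norm_mul, norm_div, Complex.norm_I, Complex.norm_natCast, RCLike.norm_ofNat]
    gcongr
    refine (norm_add_le _ _).trans ?_
    simp only [norm_mul, he, norm_neg, Complex.norm_I, Complex.norm_real, Real.norm_eq_abs, one_mul]
    exact add_le_add (hpb θ) (hpb' θ)
  have hKb : ∀ θ, ‖K θ‖ ≤ 1 := by
    intro θ
    rw [hK, norm_hermiteKernel, Real.exp_le_one_iff]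
    have : 0 ≤ (n : ℝ) * (Real.cos θ - y) ^ 2 := by positivity
    linarith
  set g₁ : ℝ → ℝ → ℝ := fun c _ => δ ^ 2 / ((c - y) ^ 2 + δ ^ 2) with hg₁
  set g₂ : ℝ → ℝ → ℝ := fun c s => s / ((c - y) ^ 2 + δ ^ 2) with hg₂
  have hg₁c : Continuous fun θ => g₁ (Real.cos θ) |Real.sin θ| := by
    change Continuous fun θ => δ ^ 2 / ((Real.cos θ - y) ^ 2 + δ ^ 2)
    fun_prop (disch := exact hpos _)
  have hg₂c : Continuous fun θ => g₂ (Real.cos θ) |Real.sin θ| := by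
    change Continuous fun θ => |Real.sin θ| / ((Real.cos θ - y) ^ 2 + δ ^ 2)
    fun_prop (disch := exact hpos _)
  have hg₃c : Continuous fun θ => 1 / (2 * n) * (1 / (2 * δ) + g₂ (Real.cos θ) |Real.sin θ|) :=
    continuous_const.mul (continuous_const.add hg₂c)
  have hi₁ := hg₁c.intervalIntegrable (μ := volume) 0 (2 * Real.pi)
  have hi₂ := hg₂c.intervalIntegrable (μ := volume) 0 (2 * Real.pi)
  have hnorm : ‖∫ θ in (0 : ℝ)..2 * Real.pi, K θ‖ ≤ ∫ θ in (0 : ℝ)..2 * Real.pi,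
      (g₁ (Real.cos θ) |Real.sin θ| +
        1 / (2 * n) * (1 / (2 * δ) + g₂ (Real.cos θ) |Real.sin θ|)) := by
    rw [hI]
    refine intervalIntegral.norm_integral_le_of_norm_le (by positivity) (ae_of_all _ fun θ _ => ?_)
      ((hg₁c.add hg₃c).intervalIntegrable _ _)
    refine (norm_sub_le _ _).trans (add_le_add ?_ ?_)
    · rw [norm_mul, Complex.norm_real, Real.norm_of_nonneg (by positivity)]
      exact mul_le_of_le_one_right (by positivity) (hKb θ)
    · rw [norm_mul]
      exact (mul_le_of_le_one_left (norm_nonneg _) (hKb θ)).trans (hqb θ)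
  have hpi := Real.pi_pos
  have hpi4 := Real.pi_lt_d2
  have hb₁ : ∫ θ in (0 : ℝ)..2 * Real.pi, g₁ (Real.cos θ) |Real.sin θ| ≤ 24 * √δ := by
    rw [integral_fold_cos_sin hg₁c]
    have h1 := integral_sq_div_cos_sub_sq_add_sq_le y hδ hδ1
    have h2 := integral_sq_div_cos_sub_sq_add_sq_le (-y) hδ hδ1
    have h3 : ∀ θ : ℝ, g₁ (-Real.cos θ) |Real.sin θ| =
        δ ^ 2 / ((Real.cos θ - -y) ^ 2 + δ ^ 2) := by
      intro θ; simp only [hg₁]; congr 2; ring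
    simp_rw [h3]
    simp only [hg₁]
    linarith
  have hb₂ : ∫ θ in (0 : ℝ)..2 * Real.pi, g₂ (Real.cos θ) |Real.sin θ| ≤
      4 * (Real.pi / δ) := by
    rw [integral_fold_cos_sin hg₂c]
    have h1 := integral_sin_div_cos_sub_sq_add_sq_le y hδ 0 (Real.pi / 2)
    have h2 := integral_sin_div_cos_sub_sq_add_sq_le (-y) hδ 0 (Real.pi / 2)
    have hs : ∀ θ ∈ Set.uIcc 0 (Real.pi / 2), |Real.sin θ| = Real.sin θ := by
      intro θ hθ
      rw [Set.uIcc_of_le (by positivity)] at hθ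
      exact abs_of_nonneg (Real.sin_nonneg_of_nonneg_of_le_pi hθ.1 (by linarith [hθ.2]))
    have e1 : ∫ θ in (0 : ℝ)..Real.pi / 2, g₂ (Real.cos θ) |Real.sin θ| =
        ∫ θ in (0 : ℝ)..Real.pi / 2, Real.sin θ / ((Real.cos θ - y) ^ 2 + δ ^ 2) :=
      intervalIntegral.integral_congr fun θ hθ => by simp only [hg₂, hs θ hθ]
    have e2 : ∫ θ in (0 : ℝ)..Real.pi / 2, g₂ (-Real.cos θ) |Real.sin θ| =
        ∫ θ in (0 : ℝ)..Real.pi / 2, Real.sin θ / ((Real.cos θ - -y) ^ 2 + δ ^ 2) :=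
      intervalIntegral.integral_congr fun θ hθ => by
        simp only [hg₂, hs θ hθ]; congr 2; ring
    rw [e1, e2]
    linarith
  refine hnorm.trans ?_
  rw [intervalIntegral.integral_add hi₁ (hg₃c.intervalIntegrable _ _),
    intervalIntegral.integral_const_mul, intervalIntegral.integral_add (by simp) hi₂,
    intervalIntegral.integral_const, smul_eq_mul, sub_zero]
  have h9 : 1 / (2 * (n : ℝ)) * (2 * Real.pi * (1 / (2 * δ)) +
      ∫ θ in (0 : ℝ)..2 * Real.pi, g₂ (Real.cos θ) |Real.sin θ|) ≤
      1 / (2 * (n : ℝ)) * (2 * Real.pi * (1 / (2 * δ)) + 4 * (Real.pi / δ)) := by gcongr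
  have h10 : 1 / (2 * (n : ℝ)) * (2 * Real.pi * (1 / (2 * δ)) + 4 * (Real.pi / δ)) =
      (5 * Real.pi / 2) / (n * δ) := by field_simp; ring
  have h11 : (5 * Real.pi / 2) / (n * δ) ≤ 8 / (n * δ) := by gcongr; linarith
  linarith

lemma factorial_mul_exp_div_le {n : ℕ} (hn : n ≠ 0) :
    n.factorial * Real.exp (n / 2) / (2 * Real.pi * √(n / 2) ^ n) / √(hermiteGamma n) ≤
      (n : ℝ) ^ (1 / 4 : ℝ) := by
  have hn' : (0 : ℝ) < n := by positivity
  have hs : Stirling.stirlingSeq n ≤ Real.exp 1 / √2 := by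
    rw [← Stirling.stirlingSeq_one]
    obtain ⟨k, rfl⟩ := Nat.exists_eq_succ_of_ne_zero hn
    exact Stirling.stirlingSeq'_antitone (Nat.zero_le k)
  have hg := hermiteGamma_pos n
  refine abs_le_of_sq_le_sq' ?_ (by positivity) |>.2
  have e1 : ((n : ℝ) ^ (1 / 4 : ℝ)) ^ 2 = √n := by
    rw [← Real.rpow_natCast, ← Real.rpow_mul hn'.le, Real.sqrt_eq_rpow]; norm_num
  have e2 : (√((n : ℝ) / 2) ^ n) ^ 2 = n ^ n / 2 ^ n := by
    rw [← pow_mul, mul_comm n 2, pow_mul, Real.sq_sqrt (by positivity), div_pow]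
  have e3 : Real.exp ((n : ℝ) / 2) ^ 2 = Real.exp 1 ^ n := by
    rw [← Real.exp_nat_mul, ← Real.exp_nat_mul]; congr 1; push_cast; ring
  have e4 : (n.factorial * Real.exp (n / 2) / (2 * Real.pi * √(n / 2) ^ n) /
      √(hermiteGamma n)) ^ 2 =
      Stirling.stirlingSeq n * (√2 * √n) / (4 * Real.pi ^ 2 * √Real.pi) := by
    have hf : (0 : ℝ) < n.factorial := by positivity
    rw [div_pow, div_pow, mul_pow, mul_pow, e2, e3, Real.sq_sqrt hg.le, hermiteGamma,
      Stirling.stirlingSeq, Real.sqrt_mul (by norm_num), div_pow]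
    have : √(n : ℝ) ≠ 0 := (Real.sqrt_pos.2 hn').ne'
    field_simp
    ring
  rw [e1, e4, div_le_iff₀ (by positivity)]
  have h1 : Stirling.stirlingSeq n * (√2 * √n) ≤ Real.exp 1 / √2 * (√2 * √n) := by gcongr
  have h2 : Real.exp 1 / √2 * (√2 * √n) = Real.exp 1 * √n := by field_simp
  have h3 := Real.exp_one_lt_d9
  have h4 : 1 ≤ √Real.pi := Real.one_le_sqrt.2 (by linarith [Real.pi_gt_three])
  have h5 : (3 : ℝ) ≤ 4 * Real.pi ^ 2 * √Real.pi := by nlinarith [Real.pi_gt_three]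
  nlinarith [Real.sqrt_nonneg (n : ℝ)]

/-- Hermite functions tend to zero uniformly, at the rate which is attained near their turning
points. -/
theorem exists_abs_hermitePsi_le :
    ∃ C : ℝ, 0 < C ∧ ∀ (n : ℕ) (x : ℝ), |hermitePsi n x| ≤ C * ((n : ℝ) + 1) ^ (-(1 / 12) : ℝ) := by
  refine ⟨64, by norm_num, fun n x => ?_⟩
  rcases Nat.eq_zero_or_pos n with rfl | hn
  · have hg : 1 ≤ √(hermiteGamma 0) := by
      rw [Real.one_le_sqrt]
      simpa [hermiteGamma] using Real.one_le_sqrt.2 (by linarith [Real.pi_gt_three])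
    simp only [hermitePsi, hermiteH_zero, mul_one, Nat.cast_zero, zero_add, Real.one_rpow]
    rw [abs_of_nonneg (by positivity), div_le_iff₀ (by positivity)]
    have : Real.exp (-x ^ 2 / 2) ≤ 1 := Real.exp_le_one_iff.2 (by nlinarith [sq_nonneg x])
    linarith
  · have hn0 : n ≠ 0 := hn.ne'
    have hn' : (0 : ℝ) < n := by positivity
    have hn1 : (1 : ℝ) ≤ n := by exact_mod_cast hn
    have hr : 0 < √((n : ℝ) / 2) := Real.sqrt_pos.2 (by positivity)
    have hg := Real.sqrt_pos.2 (hermiteGamma_pos n)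
    set y := x / (2 * √(n / 2)) with hy
    have hx : 2 * √(n / 2) * y = x := by rw [hy]; field_simp
    have h := congrArg norm (hermiteH_eq_integral_hermiteKernel hn0 y)
    rw [hx, Complex.norm_real, Real.norm_eq_abs, norm_mul, Complex.norm_real,
      Real.norm_of_nonneg (by positivity)] at h
    -- `δ = n ^ (-2/3)` balances the terms `√δ` and `1 / (n δ)`.
    have hδ : 0 < (n : ℝ) ^ (-(2 / 3) : ℝ) := by positivity
    have hδ1 : (n : ℝ) ^ (-(2 / 3) : ℝ) ≤ 1 :=
      Real.rpow_le_one_of_one_le_of_nonpos hn1 (by norm_num)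
    have hb := norm_integral_hermiteKernel_le hn0 y hδ hδ1
    have e1 : √((n : ℝ) ^ (-(2 / 3) : ℝ)) = (n : ℝ) ^ (-(1 / 3) : ℝ) := by
      rw [Real.sqrt_eq_rpow, ← Real.rpow_mul hn'.le]; norm_num
    have e2 : 8 / ((n : ℝ) * (n : ℝ) ^ (-(2 / 3) : ℝ)) = 8 * (n : ℝ) ^ (-(1 / 3) : ℝ) := by
      rw [div_eq_mul_inv]
      nth_rw 1 [← Real.rpow_one (n : ℝ)]
      rw [← Real.rpow_add hn', ← Real.rpow_neg hn'.le]
      norm_num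
    rw [e1, e2] at hb
    have h1 : |hermitePsi n x| = n.factorial * Real.exp (n / 2) / (2 * Real.pi * √(n / 2) ^ n) /
        √(hermiteGamma n) * ‖∫ θ in (0 : ℝ)..2 * Real.pi, hermiteKernel n y θ‖ := by
      rw [hermitePsi, abs_div, h, abs_of_pos hg]; ring
    have h2 : |hermitePsi n x| ≤ (n : ℝ) ^ (1 / 4 : ℝ) * (32 * (n : ℝ) ^ (-(1 / 3) : ℝ)) := by
      rw [h1]
      gcongr
      · exact factorial_mul_exp_div_le hn0
      · linarith
    have h3 : (n : ℝ) ^ (1 / 4 : ℝ) * (32 * (n : ℝ) ^ (-(1 / 3) : ℝ)) =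
        32 * (n : ℝ) ^ (-(1 / 12) : ℝ) := by
      rw [mul_left_comm, ← Real.rpow_add hn']; norm_num
    have h4 : (n : ℝ) ^ (-(1 / 12) : ℝ) ≤ 2 * ((n : ℝ) + 1) ^ (-(1 / 12) : ℝ) := by
      have h5 : ((n : ℝ) + 1) ^ (1 / 12 : ℝ) ≤ 2 * (n : ℝ) ^ (1 / 12 : ℝ) := by
        calc ((n : ℝ) + 1) ^ (1 / 12 : ℝ) ≤ (2 * n : ℝ) ^ (1 / 12 : ℝ) := by
              gcongr; linarith
          _ = 2 ^ (1 / 12 : ℝ) * (n : ℝ) ^ (1 / 12 : ℝ) := Real.mul_rpow (by norm_num) hn'.le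
          _ ≤ 2 ^ (1 : ℝ) * (n : ℝ) ^ (1 / 12 : ℝ) := by gcongr <;> norm_num
          _ = _ := by norm_num
      rw [Real.rpow_neg hn'.le, Real.rpow_neg (by positivity), ← div_eq_mul_inv, ← one_div,
        div_le_div_iff₀ (by positivity) (by positivity)]
      linarith
    linarith

lemma contDiff_hermiteH (n : ℕ) {k : WithTop ℕ∞} : ContDiff ℝ k (hermiteH n) := by
  rw [show hermiteH n = fun x => (hermitePoly n).eval x from funext (hermiteH_eq_eval n)]
  simpa using (hermitePoly n).contDiff_aeval (𝕜 := ℝ) k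

lemma contDiff_hermitePsi (n : ℕ) {k : WithTop ℕ∞} : ContDiff ℝ k (hermitePsi n) := by
  have := contDiff_hermiteH n (k := k)
  unfold hermitePsi
  fun_prop

lemma iteratedDeriv_succ_hermitePsi (m n : ℕ) (x : ℝ) :
    iteratedDeriv (m + 1) (hermitePsi n) x = √(n / 2) * iteratedDeriv m (hermitePsi (n - 1)) x -
      √((n + 1) / 2) * iteratedDeriv m (hermitePsi (n + 1)) x := by
  rw [iteratedDeriv_succ', show deriv (hermitePsi n) = fun x => √(n / 2) * hermitePsi (n - 1) x -
      √((n + 1) / 2) * hermitePsi (n + 1) x from funext fun x => (hasDerivAt_hermitePsi n x).deriv,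
    iteratedDeriv_fun_sub, iteratedDeriv_const_mul_field, iteratedDeriv_const_mul_field]
  · exact (contDiff_const.mul (contDiff_hermitePsi _)).contDiffAt
  · exact (contDiff_const.mul (contDiff_hermitePsi _)).contDiffAt

/-- Each derivative costs a factor `√n`, by the ladder relation for Hermite functions. -/
theorem exists_abs_iteratedDeriv_hermitePsi_le (m : ℕ) :
    ∃ C : ℝ, 0 < C ∧ ∀ (n : ℕ) (x : ℝ), |iteratedDeriv m (hermitePsi n) x| ≤
      C * ((n : ℝ) + 1) ^ ((m : ℝ) / 2 - 1 / 12) := by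
  induction m with
  | zero =>
    obtain ⟨C, hC, h⟩ := exists_abs_hermitePsi_le
    exact ⟨C, hC, fun n x => by simpa using h n x⟩
  | succ m ih =>
    obtain ⟨C, hC, h⟩ := ih
    set p : ℝ := (m : ℝ) / 2 - 1 / 12 with hp
    refine ⟨4 * 2 ^ |p| * C, by positivity, fun n x => ?_⟩
    have hn : (0 : ℝ) < (n : ℝ) + 1 := by positivity
    have e : ((m + 1 : ℕ) : ℝ) / 2 - 1 / 12 = 1 / 2 + p := by rw [hp]; push_cast; ring
    have key : ∀ j : ℕ, (j : ℝ) + 1 ≤ 2 * ((n : ℝ) + 1) → ((n : ℝ) + 1) ≤ 2 * ((j : ℝ) + 1) →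
        |iteratedDeriv m (hermitePsi j) x| ≤ 2 ^ |p| * C * ((n : ℝ) + 1) ^ p := by
      intro j h1 h2
      refine (h j x).trans ?_
      have : ((j : ℝ) + 1) ^ p ≤ 2 ^ |p| * ((n : ℝ) + 1) ^ p := by
        rcases le_total 0 p with h0 | h0
        · rw [abs_of_nonneg h0, ← Real.mul_rpow (by norm_num) hn.le]
          gcongr
        · rw [abs_of_nonpos h0, Real.rpow_neg (by norm_num), ← Real.inv_rpow (by norm_num),
            ← Real.mul_rpow (by norm_num) hn.le]
          exact Real.rpow_le_rpow_of_nonpos (by positivity) (by linarith) h0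
      calc C * ((j : ℝ) + 1) ^ p ≤ C * (2 ^ |p| * ((n : ℝ) + 1) ^ p) := by gcongr
        _ = _ := by ring
    have hs1 : √((n : ℝ) / 2) ≤ ((n : ℝ) + 1) ^ (1 / 2 : ℝ) := by
      rw [← Real.sqrt_eq_rpow]; gcongr; linarith
    have hs2 : √(((n : ℝ) + 1) / 2) ≤ ((n : ℝ) + 1) ^ (1 / 2 : ℝ) := by
      rw [← Real.sqrt_eq_rpow]; gcongr; linarith
    have h2 := key (n + 1) (by push_cast; linarith) (by push_cast; linarith)
    have h1 : |√(n / 2) * iteratedDeriv m (hermitePsi (n - 1)) x| ≤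
        ((n : ℝ) + 1) ^ (1 / 2 : ℝ) * (2 ^ |p| * C * ((n : ℝ) + 1) ^ p) := by
      rcases Nat.eq_zero_or_pos n with rfl | hn0
      · simp only [Nat.cast_zero, zero_div, Real.sqrt_zero, zero_mul, abs_zero]
        positivity
      · rw [abs_mul, abs_of_nonneg (Real.sqrt_nonneg _)]
        have h3 : ((n - 1 : ℕ) : ℝ) + 1 = n := by
          rw [Nat.cast_sub hn0]; simp
        have h4 : (1 : ℝ) ≤ n := by exact_mod_cast hn0
        gcongr
        exact key _ (by rw [h3]; linarith) (by rw [h3]; linarith)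
    rw [iteratedDeriv_succ_hermitePsi, e, Real.rpow_add hn]
    refine (abs_sub _ _).trans ?_
    have h5 : |√((n + 1) / 2) * iteratedDeriv m (hermitePsi (n + 1)) x| ≤
        ((n : ℝ) + 1) ^ (1 / 2 : ℝ) * (2 ^ |p| * C * ((n : ℝ) + 1) ^ p) := by
      rw [abs_mul, abs_of_nonneg (Real.sqrt_nonneg _)]
      gcongr
    have h6 : 0 ≤ ((n : ℝ) + 1) ^ (1 / 2 : ℝ) * (2 ^ |p| * C * ((n : ℝ) + 1) ^ p) := by positivity
    linarith

/-! ### Contour integrals over horizontal lines -/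

/-- Cauchy's theorem on a horizontal strip, for functions which are small on far vertical
segments. -/
lemma tendsto_integral_horizontal_sub {G : ℂ → ℂ} {a b : ℝ}
    (hG : ∀ z : ℂ, z.im ∈ Set.uIcc a b → DifferentiableAt ℂ G z) {B : ℝ → ℝ}
    (hB : Tendsto B atTop (𝓝 0))
    (hGB : ∀ᶠ R in atTop, ∀ z : ℂ, z.im ∈ Set.uIcc a b → |z.re| = R → ‖G z‖ ≤ B R) :
    Tendsto (fun R : ℝ => (∫ x in (-R)..R, G (x + a * Complex.I)) -
      ∫ x in (-R)..R, G (x + b * Complex.I)) atTop (𝓝 0) := by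
  have hlim : Tendsto (fun R => 2 * (B R * |b - a|)) atTop (𝓝 0) := by
    simpa using ((hB.mul_const |b - a|).const_mul 2)
  refine squeeze_zero_norm' ?_ hlim
  filter_upwards [hGB, eventually_ge_atTop 0] with R hR hR0
  have h := Complex.integral_boundary_rect_eq_zero_of_differentiableOn G (-R + a * Complex.I)
    (R + b * Complex.I) (fun z hz => by
      have : z.im ∈ Set.uIcc a b := by simpa using hz.2
      exact (hG z this).differentiableWithinAt)
  simp at h
  have hv : ∀ s : ℝ, |s| = R → ‖Complex.I * ∫ y in a..b, G (s + y * Complex.I)‖ ≤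
      B R * |b - a| := by
    intro s hs
    rw [norm_mul, Complex.norm_I, one_mul]
    refine intervalIntegral.norm_integral_le_of_norm_le_const fun y hy => ?_
    refine hR _ ?_ ?_
    · simpa using Set.uIoc_subset_uIcc hy
    · simpa using hs
  have h1 := hv R (abs_of_nonneg hR0)
  have h2 := hv (-R) (by rw [abs_neg, abs_of_nonneg hR0])
  push_cast at h2
  have h3 : (∫ x in (-R)..R, G (x + a * Complex.I)) - ∫ x in (-R)..R, G (x + b * Complex.I) =
      Complex.I * (∫ y in a..b, G (-R + y * Complex.I)) -
        Complex.I * ∫ y in a..b, G (R + y * Complex.I) := by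
    linear_combination h
  rw [h3]
  refine (norm_sub_le _ _).trans ?_
  linarith

lemma integral_horizontal_eq {G : ℂ → ℂ} {a b : ℝ}
    (hG : ∀ z : ℂ, z.im ∈ Set.uIcc a b → DifferentiableAt ℂ G z) {B : ℝ → ℝ}
    (hB : Tendsto B atTop (𝓝 0))
    (hGB : ∀ᶠ R in atTop, ∀ z : ℂ, z.im ∈ Set.uIcc a b → |z.re| = R → ‖G z‖ ≤ B R)
    (ha : Integrable fun x : ℝ => G (x + a * Complex.I))
    (hb : Integrable fun x : ℝ => G (x + b * Complex.I)) :
    ∫ x : ℝ, G (x + a * Complex.I) = ∫ x : ℝ, G (x + b * Complex.I) := by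
  have h1 := intervalIntegral_tendsto_integral ha tendsto_neg_atTop_atBot tendsto_id
  have h2 := intervalIntegral_tendsto_integral hb tendsto_neg_atTop_atBot tendsto_id
  have h := tendsto_nhds_unique (h1.sub h2) (tendsto_integral_horizontal_sub hG hB hGB)
  exact sub_eq_zero.1 h

lemma norm_cexp_neg_sq (v s : ℝ) :
    ‖Complex.exp (-((v : ℂ) + s * Complex.I) ^ 2)‖ = Real.exp (-v ^ 2 + s ^ 2) := by
  rw [Complex.norm_exp]
  congr 1
  simp [pow_two]
  ring

lemma abs_le_norm_add_mul_I (w s : ℝ) : |s| ≤ ‖(w : ℂ) + s * Complex.I‖ := by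
  simpa using Complex.abs_im_le_norm ((w : ℂ) + s * Complex.I)

lemma sub_ofReal_eq (v s x : ℝ) :
    (v : ℂ) + s * Complex.I - x = ((v - x : ℝ) : ℂ) + s * Complex.I := by
  push_cast; ring

lemma ofReal_add_mul_I_ne_zero (w : ℝ) {s : ℝ} (hs : s ≠ 0) : (w : ℂ) + s * Complex.I ≠ 0 := by
  intro h
  have := abs_le_norm_add_mul_I w s
  rw [h, norm_zero] at this
  exact (abs_pos.2 hs).not_ge this

lemma line_sub_ne_zero (v x : ℝ) {s : ℝ} (hs : s ≠ 0) : (v : ℂ) + s * Complex.I - x ≠ 0 := by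
  rw [sub_ofReal_eq]; exact ofReal_add_mul_I_ne_zero _ hs

/-- The Cauchy-type integral of the Gaussian over the line `Im u = s` with kernel
`(u - x) ^ (-n-1)`. -/
def gaussianLineIntegral (s : ℝ) (n : ℕ) (x : ℝ) : ℂ :=
  ∫ v : ℝ, Complex.exp (-((v : ℂ) + s * Complex.I) ^ 2) / ((v : ℂ) + s * Complex.I - x) ^ (n + 1)

lemma norm_gaussian_div_line_le {s : ℝ} (hs : s ≠ 0) (n : ℕ) (v x : ℝ) :
    ‖Complex.exp (-((v : ℂ) + s * Complex.I) ^ 2) / ((v : ℂ) + s * Complex.I - x) ^ (n + 1)‖ ≤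
      Real.exp (s ^ 2) / |s| ^ (n + 1) * Real.exp (-1 * v ^ 2) := by
  rw [norm_div, norm_cexp_neg_sq, norm_pow, sub_ofReal_eq]
  have h := abs_le_norm_add_mul_I (v - x) s
  have hs' := abs_pos.2 hs
  calc Real.exp (-v ^ 2 + s ^ 2) / ‖((v - x : ℝ) : ℂ) + s * Complex.I‖ ^ (n + 1)
      ≤ Real.exp (-v ^ 2 + s ^ 2) / |s| ^ (n + 1) := by gcongr
    _ = _ := by rw [Real.exp_add]; ring_nf

lemma continuous_gaussian_div_line {s : ℝ} (hs : s ≠ 0) (n : ℕ) (x : ℝ) :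
    Continuous fun v : ℝ =>
      Complex.exp (-((v : ℂ) + s * Complex.I) ^ 2) / ((v : ℂ) + s * Complex.I - x) ^ (n + 1) := by
  fun_prop (disch := exact fun v => pow_ne_zero _ (line_sub_ne_zero v x hs))

lemma integrable_gaussian_div_line {s : ℝ} (hs : s ≠ 0) (n : ℕ) (x : ℝ) :
    Integrable fun v : ℝ =>
      Complex.exp (-((v : ℂ) + s * Complex.I) ^ 2) / ((v : ℂ) + s * Complex.I - x) ^ (n + 1) :=
  ((integrable_exp_neg_mul_sq one_pos).const_mul (Real.exp (s ^ 2) / |s| ^ (n + 1))).mono'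
    (continuous_gaussian_div_line hs n x).aestronglyMeasurable
    (ae_of_all _ fun v => norm_gaussian_div_line_le hs n v x)

lemma hasDerivAt_gaussianLineIntegral {s : ℝ} (hs : s ≠ 0) (n : ℕ) (x : ℝ) :
    HasDerivAt (gaussianLineIntegral s n) ((n + 1) * gaussianLineIntegral s (n + 1) x) x := by
  unfold gaussianLineIntegral
  rw [← integral_const_mul]
  refine (hasDerivAt_integral_of_dominated_loc_of_deriv_le (μ := volume)
    (F := fun (x : ℝ) (v : ℝ) =>
      Complex.exp (-((v : ℂ) + s * Complex.I) ^ 2) / ((v : ℂ) + s * Complex.I - x) ^ (n + 1))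
    (F' := fun (x : ℝ) (v : ℝ) => ((n : ℂ) + 1) *
      (Complex.exp (-((v : ℂ) + s * Complex.I) ^ 2) / ((v : ℂ) + s * Complex.I - x) ^ (n + 1 + 1)))
    (bound := fun v => ((n : ℝ) + 1) *
      (Real.exp (s ^ 2) / |s| ^ (n + 1 + 1) * Real.exp (-1 * v ^ 2)))
    univ_mem (Eventually.of_forall fun x =>
      (continuous_gaussian_div_line hs n x).aestronglyMeasurable)
    (integrable_gaussian_div_line hs n x)
    ((continuous_gaussian_div_line hs (n + 1) x).const_mul _).aestronglyMeasurable
    (ae_of_all _ fun v y _ => ?_)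
    (((integrable_exp_neg_mul_sq one_pos).const_mul _).const_mul _)
    (ae_of_all _ fun v y _ => ?_)).2
  · have h1 : ‖(n : ℂ) + 1‖ = (n : ℝ) + 1 := by
      rw [← Nat.cast_succ, Complex.norm_natCast]; simp
    rw [norm_mul, h1]
    gcongr
    exact norm_gaussian_div_line_le hs (n + 1) v y
  · have h0 := line_sub_ne_zero v y hs
    have h1 : HasDerivAt (fun y : ℝ => (v : ℂ) + s * Complex.I - y) (-1) y := by
      simpa using (Complex.ofRealCLM.hasDerivAt (x := y)).const_sub ((v : ℂ) + s * Complex.I)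
    have h2 := ((h1.pow (n + 1)).inv (pow_ne_zero _ h0)).const_mul
      (Complex.exp (-((v : ℂ) + s * Complex.I) ^ 2))
    refine h2.congr_deriv ?_
    simp only [Pi.pow_apply, Nat.add_sub_cancel]
    push_cast
    field_simp
    ring

/-- Cauchy's integral formula for the Gaussian, over the boundary of a strip. -/
lemma gaussianLineIntegral_zero_sub {τ : ℝ} (hτ : 0 < τ) (x : ℝ) :
    gaussianLineIntegral (-τ) 0 x - gaussianLineIntegral τ 0 x =
      2 * Real.pi * Complex.I * hermiteWeight x := by
  set E : ℂ → ℂ := fun z => Complex.exp (-z ^ 2) with hE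
  have hEd : Differentiable ℂ E := by fun_prop
  have hEx : E x = hermiteWeight x := by simp [hE, hermiteWeight]
  -- The difference quotient of `E` at `x` is entire, so that its integrals over the two lines agree
  -- in the limit; the pole contributes the integral of a Cauchy density.
  set G : ℂ → ℂ := dslope E x with hG
  have hGd : Differentiable ℂ G := by
    have := (Complex.differentiableOn_dslope (f := E) (c := (x : ℂ)) univ_mem).2
      hEd.differentiableOn
    exact differentiableOn_univ.1 this
  have hGe : ∀ z : ℂ, z ≠ x → G z = (E z - E x) / (z - x) := by
    intro z hz
    rw [hG, dslope_of_ne _ hz, slope_def_field]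
  have hB : Tendsto (fun R : ℝ => (Real.exp (τ ^ 2) + ‖E x‖) / (R - |x|)) atTop (𝓝 0) :=
    Tendsto.div_atTop tendsto_const_nhds (tendsto_atTop_add_const_right _ _ tendsto_id)
  have hGB : ∀ᶠ R in atTop, ∀ z : ℂ, z.im ∈ Set.uIcc (-τ) τ → |z.re| = R →
      ‖G z‖ ≤ (Real.exp (τ ^ 2) + ‖E x‖) / (R - |x|) := by
    filter_upwards [eventually_gt_atTop |x|] with R hR z hz hzR
    have h1 : R - |x| ≤ ‖z - x‖ := by
      refine le_trans ?_ (Complex.abs_re_le_norm _)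
      rw [← hzR]
      simpa using abs_sub_abs_le_abs_sub z.re x
    have h2 : 0 < R - |x| := sub_pos.2 hR
    have h3 : z ≠ x := by
      rintro rfl
      simp at h1
      linarith
    have h4 : ‖E z‖ ≤ Real.exp (τ ^ 2) := by
      have := norm_cexp_neg_sq z.re z.im
      rw [Complex.re_add_im] at this
      simp only [hE]
      rw [this]
      rw [Set.uIcc_of_le (by linarith)] at hz
      have : z.im ^ 2 ≤ τ ^ 2 := sq_le_sq' hz.1 hz.2
      gcongr
      nlinarith [sq_nonneg z.re]
    rw [hGe z h3, norm_div]
    gcongr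
    exact (norm_sub_le _ _).trans (by linarith)
  have hlim := tendsto_integral_horizontal_sub (fun z _ => hGd z) hB hGB
  have hτ0 : τ ≠ 0 := hτ.ne'
  have hpos : ∀ v : ℝ, (v - x) ^ 2 + τ ^ 2 ≠ 0 := fun v => by positivity
  set P : ℝ → ℂ := fun v => ((2 * τ / ((v - x) ^ 2 + τ ^ 2) : ℝ) : ℂ) * (Complex.I * E x) with hP
  set L : ℝ → ℝ → ℂ := fun s v =>
    Complex.exp (-((v : ℂ) + s * Complex.I) ^ 2) / ((v : ℂ) + s * Complex.I - x) ^ (0 + 1) with hL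
  have hline : ∀ s : ℝ, s ≠ 0 → ∀ v : ℝ,
      G (v + s * Complex.I) = L s v - E x / ((v : ℂ) + s * Complex.I - x) := by
    intro s hs v
    rw [hGe _ (sub_ne_zero.1 (line_sub_ne_zero v x hs)), sub_div]
    simp [hL, hE]
  have hpole : ∀ v : ℝ, E x / ((v : ℂ) + (-τ : ℝ) * Complex.I - x) -
      E x / ((v : ℂ) + τ * Complex.I - x) = P v := by
    intro v
    have h1 := line_sub_ne_zero v x (neg_ne_zero.2 hτ0)
    have h2 := line_sub_ne_zero v x hτ0
    have h3 : ((v : ℂ) - x) ^ 2 + (τ : ℂ) ^ 2 ≠ 0 := by exact_mod_cast hpos v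
    simp only [hP]
    push_cast at h1 ⊢
    rw [div_sub_div _ _ h1 h2, eq_comm, eq_div_iff (mul_ne_zero h1 h2)]
    field_simp
    linear_combination (-2 * τ ^ 3 * E x * Complex.I) * Complex.I_sq
  have hPi : Integrable P := by
    have h1 : Integrable fun v : ℝ => 2 * τ / ((v - x) ^ 2 + τ ^ 2) := by
      have h2 := ((integrable_inv_one_add_sq.comp_div hτ0).comp_sub_right x).const_mul (2 / τ)
      refine h2.congr (ae_of_all _ fun v => ?_)
      simp only
      field_simp
      ring
    exact h1.ofReal.mul_const _
  have hPint : ∫ v, P v = 2 * Real.pi * Complex.I * E x := by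
    simp only [hP]
    rw [integral_mul_const, integral_complex_ofReal]
    have h1 : ∀ v : ℝ, 2 * τ / ((v - x) ^ 2 + τ ^ 2) =
        (fun t => 2 / τ * (1 + (t / τ) ^ 2)⁻¹) (v - x) := by
      intro v; simp only; field_simp; ring
    simp_rw [h1]
    rw [integral_sub_right_eq_self (fun t => 2 / τ * (1 + (t / τ) ^ 2)⁻¹), integral_const_mul,
      Measure.integral_comp_div (fun t : ℝ => (1 + t ^ 2)⁻¹) τ, integral_univ_inv_one_add_sq,
      abs_of_pos hτ, smul_eq_mul]
    push_cast
    have : (τ : ℂ) ≠ 0 := by exact_mod_cast hτ0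
    field_simp
  have hLi : ∀ s : ℝ, s ≠ 0 → Integrable (L s) := fun s hs => integrable_gaussian_div_line hs 0 x
  have hτn : -τ ≠ 0 := neg_ne_zero.2 hτ0
  have hk : Integrable fun v => L (-τ) v - L τ v - P v := ((hLi _ hτn).sub (hLi _ hτ0)).sub hPi
  have hlim2 := intervalIntegral_tendsto_integral hk tendsto_neg_atTop_atBot tendsto_id
  have hGc : ∀ s : ℝ, Continuous fun v : ℝ => G (v + s * Complex.I) := fun s =>
    hGd.continuous.comp (by fun_prop)
  have heq : ∀ R : ℝ, (∫ v in (-R)..R, G (v + (-τ : ℝ) * Complex.I)) -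
      (∫ v in (-R)..R, G (v + τ * Complex.I)) = ∫ v in (-R)..(id R), (L (-τ) v - L τ v - P v) := by
    intro R
    rw [← intervalIntegral.integral_sub ((hGc _).intervalIntegrable _ _)
      ((hGc _).intervalIntegrable _ _)]
    refine intervalIntegral.integral_congr fun v _ => ?_
    rw [hline _ hτn, hline _ hτ0, ← hpole]
    ring
  simp_rw [heq] at hlim
  have h0 := tendsto_nhds_unique hlim2 hlim
  rw [integral_sub (f := fun v => L (-τ) v - L τ v) ((hLi _ hτn).sub (hLi _ hτ0)) hPi,
    integral_sub (hLi _ hτn) (hLi _ hτ0), hPint, hEx] at h0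
  exact sub_eq_zero.1 h0

/-- `(d/dx)^n e^{-x²}` as a Cauchy integral over the two boundary lines of a strip. -/
lemma gaussianLineIntegral_sub {τ : ℝ} (hτ : 0 < τ) (n : ℕ) (x : ℝ) :
    n.factorial * (gaussianLineIntegral (-τ) n x - gaussianLineIntegral τ n x) =
      2 * Real.pi * Complex.I * (-1) ^ n * ((hermiteH n x * hermiteWeight x : ℝ) : ℂ) := by
  induction n generalizing x with
  | zero =>
    simpa [hermiteH_zero] using gaussianLineIntegral_zero_sub hτ x
  | succ n ih =>
    have h1 := ((hasDerivAt_gaussianLineIntegral (neg_ne_zero.2 hτ.ne') n x).sub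
      (hasDerivAt_gaussianLineIntegral hτ.ne' n x)).const_mul (n.factorial : ℂ)
    have h2 := ((hasDerivAt_hermiteH_mul_weight n x).ofReal_comp).const_mul
      (2 * Real.pi * Complex.I * (-1) ^ n)
    have h3 : (fun x : ℝ => (n.factorial : ℂ) * (gaussianLineIntegral (-τ) n x -
        gaussianLineIntegral τ n x)) = fun x : ℝ => 2 * Real.pi * Complex.I * (-1) ^ n *
          ((hermiteH n x * hermiteWeight x : ℝ) : ℂ) := funext ih
    have h4 := (h3 ▸ h1 : HasDerivAt _ _ x).unique h2
    rw [Nat.factorial_succ]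
    push_cast at h4 ⊢
    linear_combination h4

/-! ### Functions of algebraic growth in a strip -/

lemma isClosed_strip (ρ : ℝ) : IsClosed (strip ρ) :=
  isClosed_Icc.preimage Complex.continuous_im

lemma AlgebraicGrowthInStrip.exists_norm_le {ρ : ℝ} {F : ℂ → ℂ}
    (hF : AnalyticOnNhd ℂ F (strip ρ)) (hg : AlgebraicGrowthInStrip ρ F) :
    ∃ (C : ℝ) (k : ℕ), 0 ≤ C ∧ ∀ z ∈ strip ρ, ‖F z‖ ≤ C * (1 + z.re ^ 2) ^ k := by
  obtain ⟨σ, hσ⟩ := hg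
  obtain ⟨c, hc⟩ := hσ.bound
  rw [eventually_inf_principal, Metric.cobounded_eq_cocompact,
    Filter.eventually_iff, Filter.mem_cocompact] at hc
  obtain ⟨t, ht, hts⟩ := hc
  obtain ⟨k, hk⟩ := exists_nat_ge (σ / 2)
  have hK : IsCompact ((t ∪ Metric.closedBall 0 1) ∩ strip ρ) :=
    (ht.union (isCompact_closedBall 0 1)).inter_right (isClosed_strip ρ)
  obtain ⟨B, hB⟩ := hK.exists_bound_of_continuousOn
    (f := F) (fun z hz => (hF z hz.2).continuousAt.continuousWithinAt)
  refine ⟨max 0 B + |c| * (1 + ρ ^ 2) ^ k, k, by positivity, fun z hz => ?_⟩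
  have h1 : 1 ≤ (1 + z.re ^ 2) ^ k := one_le_pow₀ (by nlinarith [sq_nonneg z.re])
  by_cases hzt : z ∈ t ∪ Metric.closedBall 0 1
  · have := hB z ⟨hzt, hz⟩
    calc ‖F z‖ ≤ max 0 B := this.trans (le_max_right _ _)
      _ ≤ max 0 B + |c| * (1 + ρ ^ 2) ^ k := le_add_of_nonneg_right (by positivity)
      _ ≤ _ := le_mul_of_one_le_right (by positivity) h1
  · have hz1 : z ∉ t := fun h => hzt (Or.inl h)
    have hz2 : 1 < ‖z‖ := by
      by_contra h
      exact hzt (Or.inr (by simpa using not_lt.1 h))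
    have h2 := hts hz1 hz
    have h3 : ‖z‖ ^ σ ≤ ((1 + ρ ^ 2) * (1 + z.re ^ 2)) ^ k := by
      calc ‖z‖ ^ σ ≤ ‖z‖ ^ ((2 * k : ℕ) : ℝ) := by
            refine Real.rpow_le_rpow_of_exponent_le hz2.le ?_
            push_cast; linarith
        _ = (‖z‖ ^ 2) ^ k := by rw [Real.rpow_natCast, pow_mul]
        _ ≤ _ := by
            gcongr
            rw [Complex.sq_norm, Complex.normSq_apply]
            have : z.im ^ 2 ≤ ρ ^ 2 := sq_le_sq' hz.1 hz.2
            nlinarith [mul_nonneg (sq_nonneg ρ) (sq_nonneg z.re)]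
    calc ‖F z‖ ≤ c * ‖‖z‖ ^ σ‖ := h2
      _ ≤ |c| * ‖z‖ ^ σ := by
          rw [Real.norm_of_nonneg (by positivity)]
          gcongr
          exact le_abs_self c
      _ ≤ |c| * ((1 + ρ ^ 2) * (1 + z.re ^ 2)) ^ k := by gcongr
      _ = |c| * (1 + ρ ^ 2) ^ k * (1 + z.re ^ 2) ^ k := by rw [mul_pow]; ring
      _ ≤ _ := by gcongr; exact le_add_of_nonneg_left (le_max_left _ _)

lemma continuous_on_line {ρ : ℝ} {F : ℂ → ℂ} (hF : AnalyticOnNhd ℂ F (strip ρ)) {h : ℝ}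
    (hh : h ∈ Set.Icc (-ρ) ρ) : Continuous fun x : ℝ => F (x + h * Complex.I) := by
  refine continuous_iff_continuousAt.2 fun x => ?_
  have h1 : ContinuousAt F ((x : ℂ) + h * Complex.I) :=
    (hF _ (by simpa [strip] using hh)).continuousAt
  exact h1.comp (f := fun x : ℝ => (x : ℂ) + h * Complex.I) (by fun_prop)

lemma one_add_sq_le_two_mul (x v : ℝ) : 1 + x ^ 2 ≤ 2 * ((1 + v ^ 2) * (1 + (v - x) ^ 2)) := by
  nlinarith [sq_nonneg (v + (v - x)), mul_nonneg (sq_nonneg v) (sq_nonneg (v - x)),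
    sq_nonneg (x - 2 * v), sq_nonneg v, sq_nonneg (v - x)]

/-! ### The contour integral for Hermite coefficients -/

lemma norm_ofReal_add_mul_I (w t : ℝ) : ‖(w : ℂ) + t * Complex.I‖ = √(w ^ 2 + t ^ 2) :=
  Complex.norm_add_mul_I w t

lemma pow_le_norm_pow {τ t w : ℝ} (hτ : 0 < τ) (ht : τ ≤ |t|) {n k : ℕ} (hn : 2 * k + 1 ≤ n) :
    (min 1 (τ ^ 2)) ^ (k + 1) * τ ^ (n - (2 * k + 1)) * (1 + w ^ 2) ^ (k + 1) ≤
      ‖(w : ℂ) + t * Complex.I‖ ^ (n + 1) := by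
  have h1 : τ ≤ ‖(w : ℂ) + t * Complex.I‖ := ht.trans (abs_le_norm_add_mul_I w t)
  have h2 : min 1 (τ ^ 2) * (1 + w ^ 2) ≤ ‖(w : ℂ) + t * Complex.I‖ ^ 2 := by
    rw [norm_ofReal_add_mul_I, Real.sq_sqrt (by positivity)]
    have h3 : τ ^ 2 ≤ t ^ 2 := by rw [← sq_abs t]; gcongr
    have h4 := min_le_left 1 (τ ^ 2)
    have h5 := min_le_right 1 (τ ^ 2)
    nlinarith [sq_nonneg w]
  have hm : 0 ≤ min 1 (τ ^ 2) := by positivity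
  calc (min 1 (τ ^ 2)) ^ (k + 1) * τ ^ (n - (2 * k + 1)) * (1 + w ^ 2) ^ (k + 1)
      = (min 1 (τ ^ 2) * (1 + w ^ 2)) ^ (k + 1) * τ ^ (n - (2 * k + 1)) := by
        rw [mul_pow]; ring
    _ ≤ (‖(w : ℂ) + t * Complex.I‖ ^ 2) ^ (k + 1) *
        ‖(w : ℂ) + t * Complex.I‖ ^ (n - (2 * k + 1)) := by gcongr
    _ = _ := by
      rw [← pow_mul, ← pow_add]
      congr 1
      omega

/-- The integrand of the double integral over the lines `Im x = h` and `Im u = s` which represents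
a Hermite coefficient. -/
def doubleLineIntegrand (F : ℂ → ℂ) (h s : ℝ) (n : ℕ) (x v : ℝ) : ℂ :=
  Complex.exp (-((v : ℂ) + s * Complex.I) ^ 2) *
    (F (x + h * Complex.I) / ((v : ℂ) + s * Complex.I - (x + h * Complex.I)) ^ (n + 1))

lemma line_sub_line (v s x h : ℝ) : (v : ℂ) + s * Complex.I - (x + h * Complex.I) =
    ((v - x : ℝ) : ℂ) + (s - h : ℝ) * Complex.I := by
  push_cast; ring

lemma exists_norm_div_line_le {ρ C τ : ℝ} {F : ℂ → ℂ} {n k : ℕ}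
    (hC : ∀ z ∈ strip ρ, ‖F z‖ ≤ C * (1 + z.re ^ 2) ^ k) (hC0 : 0 ≤ C) (hτ : 0 < τ)
    (hn : 2 * k + 1 ≤ n) :
    ∃ M : ℝ, 0 ≤ M ∧ ∀ h s x v : ℝ, h ∈ Set.Icc (-ρ) ρ → τ ≤ |s - h| →
      ‖F (x + h * Complex.I) / ((v : ℂ) + s * Complex.I - (x + h * Complex.I)) ^ (n + 1)‖ ≤
        M * ((1 + v ^ 2) ^ k * (1 + (x - v) ^ 2)⁻¹) := by
  set κ := (min 1 (τ ^ 2)) ^ (k + 1) * τ ^ (n - (2 * k + 1)) with hκ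
  have hκ0 : 0 < κ := by
    have : 0 < min 1 (τ ^ 2) := lt_min one_pos (by positivity)
    positivity
  refine ⟨C * 2 ^ k / κ, by positivity, fun h s x v hh hs => ?_⟩
  have h1 := pow_le_norm_pow hτ hs (w := v - x) hn
  rw [norm_div, norm_pow, line_sub_line]
  have h2 : ‖F (x + h * Complex.I)‖ ≤ C * (2 * ((1 + v ^ 2) * (1 + (v - x) ^ 2))) ^ k := by
    refine (hC _ (by simpa [strip] using hh)).trans ?_
    have h3 := one_add_sq_le_two_mul x v
    have h4 : ((x : ℂ) + h * Complex.I).re = x := by simp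
    rw [h4]
    gcongr
  have h5 : 0 < κ * (1 + (v - x) ^ 2) ^ (k + 1) := by positivity
  calc _ ≤ C * (2 * ((1 + v ^ 2) * (1 + (v - x) ^ 2))) ^ k / (κ * (1 + (v - x) ^ 2) ^ (k + 1)) := by
        gcongr
    _ = _ := by
        rw [show (x - v) ^ 2 = (v - x) ^ 2 by ring, mul_pow, mul_pow, pow_succ]
        have : 0 < 1 + (v - x) ^ 2 := by positivity
        field_simp
        ring

lemma integrable_one_add_sq_pow_mul_gaussian (k : ℕ) :
    Integrable fun v : ℝ => (1 + v ^ 2) ^ k * Real.exp (-v ^ 2) := by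
  refine (integrable_polynomial_mul_gaussian ((1 + Polynomial.X ^ 2) ^ k) one_pos).congr
    (ae_of_all _ fun v => ?_)
  simp

/-- The dominating function for all double integrals below. -/
lemma integrable_dominating (k : ℕ) :
    Integrable (fun p : ℝ × ℝ => (1 + p.2 ^ 2) ^ k * Real.exp (-p.2 ^ 2) *
      (1 + (p.1 - p.2) ^ 2)⁻¹) (volume.prod volume) := by
  have := (integrable_one_add_sq_pow_mul_gaussian k).convolution_integrand
    (ContinuousLinearMap.mul ℝ ℝ) integrable_inv_one_add_sq
  exact this

lemma integrable_doubleLineIntegrand {ρ C τ h s : ℝ} {F : ℂ → ℂ} {n k : ℕ}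
    (hF : AnalyticOnNhd ℂ F (strip ρ))
    (hC : ∀ z ∈ strip ρ, ‖F z‖ ≤ C * (1 + z.re ^ 2) ^ k) (hC0 : 0 ≤ C) (hτ : 0 < τ)
    (hn : 2 * k + 1 ≤ n) (hh : h ∈ Set.Icc (-ρ) ρ) (hs : τ ≤ |s - h|) :
    Integrable (fun p : ℝ × ℝ => doubleLineIntegrand F h s n p.1 p.2) (volume.prod volume) := by
  obtain ⟨M, hM0, hM⟩ := exists_norm_div_line_le hC hC0 hτ hn
  have hsh : s - h ≠ 0 := abs_pos.1 (hτ.trans_le hs)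
  have hcF := continuous_on_line hF hh
  have hcF2 : Continuous fun p : ℝ × ℝ => F (p.1 + h * Complex.I) := hcF.comp continuous_fst
  have hne : ∀ p : ℝ × ℝ, (p.2 : ℂ) + s * Complex.I - (p.1 + h * Complex.I) ≠ 0 := by
    intro p
    rw [line_sub_line]
    exact ofReal_add_mul_I_ne_zero _ hsh
  have hc : Continuous fun p : ℝ × ℝ => doubleLineIntegrand F h s n p.1 p.2 := by
    unfold doubleLineIntegrand
    refine Continuous.mul (by fun_prop) (hcF2.div (by fun_prop) fun p => pow_ne_zero _ (hne p))
  refine ((integrable_dominating k).const_mul (Real.exp (s ^ 2) * M)).mono'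
    hc.aestronglyMeasurable (ae_of_all _ fun p => ?_)
  rw [doubleLineIntegrand, norm_mul, norm_cexp_neg_sq]
  have := hM h s p.1 p.2 hh hs
  calc _ ≤ Real.exp (-p.2 ^ 2 + s ^ 2) * (M * ((1 + p.2 ^ 2) ^ k * (1 + (p.1 - p.2) ^ 2)⁻¹)) := by
        gcongr
    _ = _ := by rw [Real.exp_add]; ring

/-- Moving the line of integration of `F (x) / (u - x) ^ (n + 1)` away from `u`. -/
lemma integral_div_line_shift {ρ C τ h s : ℝ} {F : ℂ → ℂ} {n k : ℕ}
    (hF : AnalyticOnNhd ℂ F (strip ρ))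
    (hC : ∀ z ∈ strip ρ, ‖F z‖ ≤ C * (1 + z.re ^ 2) ^ k) (hC0 : 0 ≤ C) (hτ : 0 < τ)
    (hn : 2 * k + 1 ≤ n) (hh : Set.uIcc 0 h ⊆ Set.Icc (-ρ) ρ)
    (hs : ∀ y ∈ Set.uIcc 0 h, τ ≤ |s - y|) (v : ℝ) :
    ∫ x : ℝ, F (x + (0 : ℝ) * Complex.I) /
        ((v : ℂ) + s * Complex.I - (x + (0 : ℝ) * Complex.I)) ^ (n + 1) =
      ∫ x : ℝ, F (x + h * Complex.I) /
        ((v : ℂ) + s * Complex.I - (x + h * Complex.I)) ^ (n + 1) := by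
  obtain ⟨M, hM0, hM⟩ := exists_norm_div_line_le hC hC0 hτ hn
  have hne : ∀ z : ℂ, z.im ∈ Set.uIcc 0 h → (v : ℂ) + s * Complex.I - z ≠ 0 := by
    intro z hz
    rw [← Complex.re_add_im z, line_sub_line]
    exact ofReal_add_mul_I_ne_zero _ (abs_pos.1 (hτ.trans_le (hs _ hz)))
  have hint : ∀ y ∈ Set.uIcc 0 h, Integrable fun x : ℝ => F (x + y * Complex.I) /
      ((v : ℂ) + s * Complex.I - (x + y * Complex.I)) ^ (n + 1) := by
    intro y hy
    have h1 : Integrable fun x : ℝ => M * ((1 + v ^ 2) ^ k * (1 + (x - v) ^ 2)⁻¹) :=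
      ((integrable_inv_one_add_sq.comp_sub_right v).const_mul _).const_mul _
    refine h1.mono' (Continuous.aestronglyMeasurable ?_)
      (ae_of_all _ fun x => hM y s x v (hh hy) (hs y hy))
    refine (continuous_on_line hF (hh hy)).div (by fun_prop) fun x => pow_ne_zero _ (hne _ ?_)
    simpa using hy
  refine integral_horizontal_eq
    (G := fun z => F z / ((v : ℂ) + s * Complex.I - z) ^ (n + 1))
    (B := fun R => M * ((1 + v ^ 2) ^ k * (1 + (R - |v|) ^ 2)⁻¹)) ?_ ?_ ?_
    (hint 0 Set.left_mem_uIcc) (hint h Set.right_mem_uIcc)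
  · intro z hz
    have h1 : DifferentiableAt ℂ F z := (hF z (hh hz)).differentiableAt
    exact h1.div (by fun_prop) (pow_ne_zero _ (hne z hz))
  · have h1 : Tendsto (fun R : ℝ => (1 + (R - |v|) ^ 2)) atTop atTop := by
      refine tendsto_atTop_add_const_left _ _ ?_
      exact (tendsto_pow_atTop two_ne_zero).comp (tendsto_atTop_add_const_right _ _ tendsto_id)
    simpa using (h1.inv_tendsto_atTop.const_mul ((1 + v ^ 2) ^ k)).const_mul M
  · refine Eventually.of_forall fun R z hz hzR => ?_
    have h1 := hM z.im s z.re v (hh hz) (hs _ hz)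
    rw [Complex.re_add_im] at h1
    refine h1.trans ?_
    have h2 : (R - |v|) ^ 2 ≤ (z.re - v) ^ 2 := by
      rw [← hzR]
      exact sq_le_sq.2 (abs_abs_sub_abs_le z.re v)
    gcongr

/-- The absolute double integral bounding one half of a Hermite coefficient. -/
def lineMajorant (F : ℂ → ℂ) (h T : ℝ) (n : ℕ) : ℝ :=
  ∫ p : ℝ × ℝ, Real.exp (-p.2 ^ 2) * ‖F (p.1 + h * Complex.I)‖ /
    √((p.1 - p.2) ^ 2 + T ^ 2) ^ (n + 1)

lemma norm_integral_mul_gaussianLineIntegral_le {ρ C τ h s : ℝ} {F : ℂ → ℂ} {n k : ℕ}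
    (hF : AnalyticOnNhd ℂ F (strip ρ))
    (hC : ∀ z ∈ strip ρ, ‖F z‖ ≤ C * (1 + z.re ^ 2) ^ k) (hC0 : 0 ≤ C) (hτ : 0 < τ)
    (hn : 2 * k + 1 ≤ n) (hh : Set.uIcc 0 h ⊆ Set.Icc (-ρ) ρ)
    (hs : ∀ y ∈ Set.uIcc 0 h, τ ≤ |s - y|) :
    Integrable (fun x : ℝ => F x * gaussianLineIntegral s n x) ∧
    ‖∫ x : ℝ, F x * gaussianLineIntegral s n x‖ ≤
      Real.exp (s ^ 2) * lineMajorant F h (s - h) n := by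
  have h0 : (0 : ℝ) ∈ Set.uIcc 0 h := Set.left_mem_uIcc
  have h1 : h ∈ Set.uIcc 0 h := Set.right_mem_uIcc
  have hi0 := integrable_doubleLineIntegrand hF hC hC0 hτ hn (hh h0) (hs 0 h0)
  have hi1 := integrable_doubleLineIntegrand hF hC hC0 hτ hn (hh h1) (hs h h1)
  have e0 : ∀ x : ℝ, ∫ v : ℝ, doubleLineIntegrand F 0 s n x v =
      F x * gaussianLineIntegral s n x := by
    intro x
    rw [gaussianLineIntegral, ← integral_const_mul]
    congr 1; ext v
    simp only [doubleLineIntegrand, Complex.ofReal_zero, zero_mul, add_zero]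
    ring
  have hint : Integrable (fun x : ℝ => F x * gaussianLineIntegral s n x) := by
    have := hi0.integral_prod_left
    simpa only [e0] using this
  refine ⟨hint, ?_⟩
  have e1 : ∫ x : ℝ, F x * gaussianLineIntegral s n x =
      ∫ p : ℝ × ℝ, doubleLineIntegrand F h s n p.1 p.2 := by
    simp_rw [← e0]
    rw [integral_integral_swap hi0]
    have e2 : ∀ v : ℝ, ∫ x : ℝ, doubleLineIntegrand F 0 s n x v =
        ∫ x : ℝ, doubleLineIntegrand F h s n x v := by
      intro v
      simp only [doubleLineIntegrand]
      rw [integral_const_mul, integral_const_mul,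
        integral_div_line_shift hF hC hC0 hτ hn hh hs v]
    simp_rw [e2]
    rw [← integral_integral_swap hi1, integral_integral hi1]
    rfl
  rw [e1]
  refine (norm_integral_le_integral_norm _).trans (le_of_eq ?_)
  rw [lineMajorant, ← integral_const_mul]
  congr 1; ext p
  rw [doubleLineIntegrand, norm_mul, norm_cexp_neg_sq, norm_div, norm_pow, line_sub_line,
    norm_ofReal_add_mul_I, Real.exp_add, show (p.1 - p.2) ^ 2 = (p.2 - p.1) ^ 2 by ring]
  ring

/-- The bound for Hermite coefficients: the Gaussian is represented by integrals over the lines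
`Im u = ∓ τ`, and in each of them the argument of `F` is moved to the opposite boundary line
`± ρ` of the strip, at distance `τ + ρ`. -/
theorem norm_integral_mul_hermiteH_le {ρ C τ : ℝ} {F : ℂ → ℂ} {n k : ℕ} (hρ : 0 < ρ)
    (hF : AnalyticOnNhd ℂ F (strip ρ))
    (hC : ∀ z ∈ strip ρ, ‖F z‖ ≤ C * (1 + z.re ^ 2) ^ k) (hC0 : 0 ≤ C) (hτ : 0 < τ)
    (hn : 2 * k + 1 ≤ n) :
    ‖∫ x : ℝ, F x * ((hermiteH n x * hermiteWeight x : ℝ) : ℂ)‖ ≤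
      n.factorial / (2 * Real.pi) * Real.exp (τ ^ 2) *
        (lineMajorant F ρ (τ + ρ) n + lineMajorant F (-ρ) (τ + ρ) n) := by
  have hlow := norm_integral_mul_gaussianLineIntegral_le (h := ρ) (s := -τ) hF hC hC0 hτ hn
    (by rw [Set.uIcc_of_le hρ.le]; exact Set.Icc_subset_Icc_left (by linarith))
    (fun y hy => by
      rw [Set.uIcc_of_le hρ.le] at hy
      rw [abs_of_nonpos (by linarith [hy.1])]
      linarith [hy.1])
  have hup := norm_integral_mul_gaussianLineIntegral_le (h := -ρ) (s := τ) hF hC hC0 hτ hn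
    (by rw [Set.uIcc_of_ge (by linarith)]; exact Set.Icc_subset_Icc_right hρ.le)
    (fun y hy => by
      rw [Set.uIcc_of_ge (by linarith)] at hy
      rw [abs_of_nonneg (by linarith [hy.2])]
      linarith [hy.2])
  have eT : lineMajorant F ρ (-τ - ρ) n = lineMajorant F ρ (τ + ρ) n := by
    simp only [lineMajorant]
    rw [show (-τ - ρ) ^ 2 = (τ + ρ) ^ 2 by ring]
  rw [eT, neg_sq] at hlow
  rw [sub_neg_eq_add] at hup
  have e : (2 * Real.pi * Complex.I * (-1) ^ n) *
      ∫ x : ℝ, F x * ((hermiteH n x * hermiteWeight x : ℝ) : ℂ) =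
      n.factorial * ((∫ x : ℝ, F x * gaussianLineIntegral (-τ) n x) -
        ∫ x : ℝ, F x * gaussianLineIntegral τ n x) := by
    rw [← integral_sub hlow.1 hup.1, ← integral_const_mul, ← integral_const_mul]
    congr 1; ext x
    linear_combination (-F x) * gaussianLineIntegral_sub hτ n x
  have e2 := congrArg norm e
  simp only [norm_mul, norm_pow, norm_neg, norm_one, one_pow, mul_one, Complex.norm_I,
    Complex.norm_natCast, Complex.norm_real, Real.norm_of_nonneg Real.pi_pos.le,
    RCLike.norm_ofNat] at e2
  have h3 := (norm_sub_le (∫ x : ℝ, F x * gaussianLineIntegral (-τ) n x)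
    (∫ x : ℝ, F x * gaussianLineIntegral τ n x)).trans (add_le_add hlow.2 hup.2)
  have h4 : 0 < 2 * Real.pi := by positivity
  calc _ = (n.factorial / (2 * Real.pi)) * ‖(∫ x : ℝ, F x * gaussianLineIntegral (-τ) n x) -
        ∫ x : ℝ, F x * gaussianLineIntegral τ n x‖ := by
        rw [div_mul_eq_mul_div, ← e2]; field_simp
    _ ≤ (n.factorial / (2 * Real.pi)) * (Real.exp (τ ^ 2) * lineMajorant F ρ (τ + ρ) n +
        Real.exp (τ ^ 2) * lineMajorant F (-ρ) (τ + ρ) n) := by gcongr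
    _ = _ := by ring

/-! ### Asymptotics of the coefficient bound -/

lemma tendsto_sqrt_two_mul_atTop : Tendsto (fun n : ℕ => √(2 * (n : ℝ))) atTop atTop :=
  Real.tendsto_sqrt_atTop.comp
    (Tendsto.const_mul_atTop two_pos tendsto_natCast_atTop_atTop)

lemma tendsto_mul_sub_sq_mul_log (ρ : ℝ) :
    Tendsto (fun y : ℝ => ρ * y - y ^ 2 * Real.log (1 + ρ / y)) atTop (𝓝 (ρ ^ 2 / 2)) := by
  have ht : Tendsto (fun y : ℝ => |ρ / y|) atTop (𝓝 0) := by
    simpa using (tendsto_const_nhds.div_atTop tendsto_id : Tendsto (fun y : ℝ => ρ / y) _ _).abs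
  have hlim : Tendsto (fun y : ℝ => ρ ^ 2 * |ρ / y| / (1 - |ρ / y|)) atTop (𝓝 0) := by
    have := (ht.const_mul (ρ ^ 2)).div (ht.const_sub 1) (by norm_num)
    rw [mul_zero, zero_div] at this
    exact this
  rw [← tendsto_sub_nhds_zero_iff]
  refine squeeze_zero_norm' ?_ hlim
  filter_upwards [ht.eventually (gt_mem_nhds one_pos), eventually_gt_atTop 0] with y hy hy0
  have h := Real.abs_log_sub_add_sum_range_le (x := -(ρ / y)) (by rwa [abs_neg]) 2
  rw [abs_neg] at h
  simp only [Finset.sum_range_succ, Finset.sum_range_zero] at h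
  have e : ρ * y - y ^ 2 * Real.log (1 + ρ / y) - ρ ^ 2 / 2 = -(y ^ 2 * (0 +
      (-(ρ / y)) ^ (0 + 1) / ((0 : ℕ) + 1) + (-(ρ / y)) ^ (1 + 1) / ((1 : ℕ) + 1) +
      Real.log (1 - -(ρ / y)))) := by
    push_cast
    rw [sub_neg_eq_add]
    field_simp
    ring
  rw [e, norm_neg, Real.norm_eq_abs, abs_mul, abs_of_pos (by positivity : 0 < y ^ 2)]
  calc _ ≤ y ^ 2 * (|ρ / y| ^ (2 + 1) / (1 - |ρ / y|)) := by gcongr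
    _ = y ^ 2 * ((ρ / y) ^ 2 * |ρ / y| / (1 - |ρ / y|)) := by rw [pow_succ |ρ / y|, sq_abs]
    _ = y ^ 2 * (ρ / y) ^ 2 * |ρ / y| / (1 - |ρ / y|) := by ring
    _ = _ := by rw [← mul_pow, mul_div_cancel₀ _ hy0.ne']

/-- The factor in front of the double integrals, normalised by the expected size of a
coefficient. -/
def coeffPrefactor (ρ : ℝ) (n : ℕ) : ℝ :=
  (n : ℝ) ^ (1 / 4 : ℝ) * Real.exp (ρ * √(2 * n)) *
    (n.factorial / (2 * Real.pi) * Real.exp (((√(2 * n) - ρ) / 2) ^ 2) /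
      ((√(2 * n) + ρ) / 2) ^ (n + 1)) / √(hermiteGamma n)

lemma coeffPrefactor_sq {ρ : ℝ} (hρ : 0 < ρ) {n : ℕ} (hn : n ≠ 0) :
    (2 * Real.pi * coeffPrefactor ρ n) ^ 2 =
      2 * √2 * (Stirling.stirlingSeq n / √Real.pi) * Real.exp (ρ ^ 2 / 2) *
        (Real.exp (ρ * √(2 * n) - √(2 * n) ^ 2 * Real.log (1 + ρ / √(2 * n))) /
          (1 + ρ / √(2 * n)) ^ 2) := by
  have hn' : (0 : ℝ) < n := by positivity
  have hy : 0 < √(2 * (n : ℝ)) := Real.sqrt_pos.2 (by positivity)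
  have hy2 : √(2 * (n : ℝ)) ^ 2 = 2 * n := Real.sq_sqrt (by positivity)
  have hg := hermiteGamma_pos n
  have hn2 : √(2 * (n : ℝ)) = √2 * √n := Real.sqrt_mul (by norm_num) _
  have hsn : √(n : ℝ) ≠ 0 := (Real.sqrt_pos.2 hn').ne'
  have hsn2 : √(n : ℝ) ^ 2 = n := Real.sq_sqrt hn'.le
  have e1 : ((n : ℝ) ^ (1 / 4 : ℝ)) ^ 2 = √n := by
    rw [← Real.rpow_natCast, ← Real.rpow_mul hn'.le, Real.sqrt_eq_rpow]; norm_num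
  have hfac : (n.factorial : ℝ) = Stirling.stirlingSeq n * (√(2 * n) * (n / Real.exp 1) ^ n) := by
    rw [Stirling.stirlingSeq]
    have : (√(2 * (n : ℝ)) * (n / Real.exp 1) ^ n) ≠ 0 := by positivity
    field_simp
  set y := √(2 * (n : ℝ)) with hyd
  have h1 : 0 < 1 + ρ / y := by positivity
  have hT : (y + ρ) / 2 = y / 2 * (1 + ρ / y) := by field_simp
  have hlog : Real.exp (y ^ 2 * Real.log (1 + ρ / y)) = (1 + ρ / y) ^ (2 * n) := by
    rw [hy2, ← Real.rpow_natCast, Real.rpow_def_of_pos h1]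
    push_cast
    ring_nf
  have hTp : (((y + ρ) / 2) ^ (n + 1)) ^ 2 =
      (n / 2) ^ (n + 1) * ((1 + ρ / y) ^ (2 * n) * (1 + ρ / y) ^ 2) := by
    rw [hT, mul_pow, mul_pow, ← pow_mul, ← pow_mul, mul_comm (n + 1) 2, pow_mul, div_pow, hy2,
      ← pow_add]
    congr 2
    ring
  have hex : Real.exp (ρ * y) ^ 2 * Real.exp (((y - ρ) / 2) ^ 2) ^ 2 =
      Real.exp 1 ^ n * Real.exp (ρ * y) * Real.exp (ρ ^ 2 / 2) := by
    rw [← Real.exp_nat_mul, ← Real.exp_nat_mul, ← Real.exp_nat_mul, ← Real.exp_add,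
      ← Real.exp_add, ← Real.exp_add]
    congr 1
    push_cast
    linear_combination (1 / 2 : ℝ) * hy2
  have hne : Real.exp 1 ^ n ≠ 0 := by positivity
  rw [Real.exp_sub, hlog, coeffPrefactor, ← hyd]
  calc _ = √n * (Real.exp (ρ * y) ^ 2 *
        Real.exp (((y - ρ) / 2) ^ 2) ^ 2) * (n.factorial) ^ 2 /
        ((((y + ρ) / 2) ^ (n + 1)) ^ 2 * hermiteGamma n) := by
        have hD : ((y + ρ) / 2) ^ (n + 1) ≠ 0 := by positivity
        have hs := Real.sq_sqrt hg.le
        have hs0 := (Real.sqrt_pos.2 hg).ne'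
        rw [← e1]
        generalize √(hermiteGamma n) = s at hs hs0 ⊢
        generalize ((y + ρ) / 2) ^ (n + 1) = D at hD ⊢
        generalize Real.exp (((y - ρ) / 2) ^ 2) = E
        rw [← hs]
        field_simp
    _ = √n * (Real.exp 1 ^ n * Real.exp (ρ * y) * Real.exp (ρ ^ 2 / 2)) * n.factorial /
        ((n / 2) ^ (n + 1) * ((1 + ρ / y) ^ (2 * n) * (1 + ρ / y) ^ 2) * (2 ^ n * √Real.pi)) := by
        rw [hex, hTp, hermiteGamma]
        have : (n.factorial : ℝ) ≠ 0 := by positivity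
        field_simp
    _ = _ := by
        rw [hfac, hn2, div_pow, div_pow, pow_succ, pow_succ]
        field_simp
        rw [hsn2]
        ring

/-- Stirling's formula for the prefactor. -/
lemma tendsto_coeffPrefactor {ρ : ℝ} (hρ : 0 < ρ) :
    Tendsto (coeffPrefactor ρ) atTop
      (𝓝 (√(2 * √2) * Real.exp (ρ ^ 2 / 2) / (2 * Real.pi))) := by
  have hy := tendsto_sqrt_two_mul_atTop
  have h1 := (tendsto_mul_sub_sq_mul_log ρ).comp hy
  have h2 : Tendsto (fun n : ℕ => (1 + ρ / √(2 * (n : ℝ))) ^ 2) atTop (𝓝 1) := by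
    have := ((tendsto_const_nhds (x := ρ)).div_atTop hy).const_add 1
    simpa using this.pow 2
  have h3 := Stirling.tendsto_stirlingSeq_sqrt_pi.div_const √Real.pi
  have hpi : √Real.pi ≠ 0 := (Real.sqrt_pos.2 Real.pi_pos).ne'
  rw [div_self hpi] at h3
  have h4 := (((h3.const_mul (2 * √2)).mul_const (Real.exp (ρ ^ 2 / 2))).mul
    (((Real.continuous_exp.tendsto _).comp h1).div h2 one_ne_zero)).sqrt
  have h5 : √(2 * √2 * 1 * Real.exp (ρ ^ 2 / 2) * (Real.exp (ρ ^ 2 / 2) / 1)) =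
      √(2 * √2) * Real.exp (ρ ^ 2 / 2) := by
    rw [div_one, mul_one, mul_assoc, Real.sqrt_mul (by positivity),
      Real.sqrt_mul_self (Real.exp_pos _).le]
  rw [h5] at h4
  refine (h4.div_const (2 * Real.pi)).congr' ?_
  filter_upwards [eventually_ne_atTop 0] with n hn
  have h6 : 0 ≤ coeffPrefactor ρ n := by unfold coeffPrefactor; positivity
  rw [Pi.div_apply, Function.comp_apply, Function.comp_apply, ← coeffPrefactor_sq hρ hn,
    Real.sqrt_sq (by positivity)]
  field_simp

lemma sqrt_pow_eq {a : ℝ} (ha : 0 ≤ a) (n : ℕ) : √(a ^ n) = √a ^ n := by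
  rw [← Real.sqrt_sq (pow_nonneg (Real.sqrt_nonneg a) n), ← pow_mul, mul_comm, pow_mul,
    Real.sq_sqrt ha]

/-- The kernel of `lineMajorant` after factoring out `T ^ (n + 1)`, where `T = (√(2n) + ρ) / 2` is
the distance between the two lines of integration. -/
def rationalKernel (ρ : ℝ) (n : ℕ) (w : ℝ) : ℝ :=
  √(1 + (w / ((√(2 * n) + ρ) / 2)) ^ 2) ^ (n + 1)

lemma tendsto_rationalKernel (ρ w : ℝ) :
    Tendsto (fun n => rationalKernel ρ n w) atTop (𝓝 (Real.exp (w ^ 2))) := by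
  have hy := tendsto_sqrt_two_mul_atTop
  set g : ℕ → ℝ := fun n => (w / ((√(2 * (n : ℝ)) + ρ) / 2)) ^ 2 with hg
  have hr : Tendsto (fun n : ℕ => ρ / √(2 * (n : ℝ))) atTop (𝓝 0) :=
    tendsto_const_nhds.div_atTop hy
  have h1 : Tendsto (fun n : ℕ => (n : ℝ) * g n) atTop (𝓝 (2 * w ^ 2)) := by
    have h2 : Tendsto (fun n : ℕ => 2 * w ^ 2 / (1 + ρ / √(2 * (n : ℝ))) ^ 2) atTop
        (𝓝 (2 * w ^ 2 / (1 + 0) ^ 2)) :=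
      tendsto_const_nhds.div ((hr.const_add 1).pow 2) (by norm_num)
    simp only [add_zero, one_pow, div_one] at h2
    refine h2.congr' ?_
    filter_upwards [hy.eventually_gt_atTop 0, hy.eventually_gt_atTop (-ρ)] with n hn hn2
    have h3 : √(2 * (n : ℝ)) ^ 2 = 2 * n := Real.sq_sqrt (by positivity)
    have h4 : √(2 * (n : ℝ)) + ρ ≠ 0 := by linarith
    have h5 : (n : ℝ) = √(2 * (n : ℝ)) ^ 2 / 2 := by rw [h3]; ring
    simp only [hg]
    rw [show (1 : ℝ) + ρ / √(2 * (n : ℝ)) = (√(2 * (n : ℝ)) + ρ) / √(2 * (n : ℝ)) by field_simp]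
    set y := √(2 * (n : ℝ))
    rw [h5]
    field_simp
  have h6 := Real.tendsto_one_add_pow_exp_of_tendsto h1
  have h7 : Tendsto g atTop (𝓝 0) := by
    have := h1.mul (tendsto_inv_atTop_zero.comp (tendsto_natCast_atTop_atTop (R := ℝ)))
    rw [mul_zero] at this
    refine this.congr' ?_
    filter_upwards [eventually_ne_atTop 0] with n hn
    have : (n : ℝ) ≠ 0 := by exact_mod_cast hn
    simp only [Function.comp]
    field_simp
  have h8 := (h6.mul (h7.const_add 1)).sqrt
  have h9 : √(Real.exp (2 * w ^ 2) * (1 + 0)) = Real.exp (w ^ 2) := by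
    rw [add_zero, mul_one, two_mul, Real.exp_add, Real.sqrt_mul_self (Real.exp_pos _).le]
  rw [h9] at h8
  refine h8.congr fun n => ?_
  have h10 : 0 ≤ 1 + g n := by simp only [hg]; positivity
  rw [rationalKernel, ← pow_succ, sqrt_pow_eq h10]

/-- Bernoulli's inequality makes the kernels dominate a fixed power of `1 + w ^ 2`. -/
lemma pow_le_rationalKernel {ρ : ℝ} (hρ : 0 < ρ) (k : ℕ) :
    ∃ c : ℝ, 0 < c ∧ ∀ᶠ n : ℕ in atTop, ∀ w : ℝ,
      c * (1 + w ^ 2) ^ (k + 1) ≤ rationalKernel ρ n w := by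
  set K := 2 * (k + 1) with hK
  have hK0 : (0 : ℝ) < K := by rw [hK]; positivity
  refine ⟨(1 / (2 * K : ℝ)) ^ (k + 1), by positivity, ?_⟩
  filter_upwards [tendsto_sqrt_two_mul_atTop.eventually_ge_atTop (3 * ρ),
    eventually_ge_atTop K] with n hn hnK w
  have hn0 : 0 < n := by omega
  have hn' : (0 : ℝ) < n := by exact_mod_cast hn0
  have hy2 : √(2 * (n : ℝ)) ^ 2 = 2 * n := Real.sq_sqrt (by positivity)
  set y := √(2 * (n : ℝ)) with hy
  have hT : ((y + ρ) / 2) ^ 2 ≤ n := by nlinarith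
  have hT0 : 0 < ((y + ρ) / 2) ^ 2 := by positivity
  set q := n / K with hq
  have hqK : q * K ≤ n := Nat.div_mul_le_self n K
  have hqn : n ≤ 2 * (q * K) := by
    have h1 := Nat.lt_div_mul_add (a := n) (b := K) (by omega)
    rw [← hq] at h1
    have h2 : 1 ≤ q := (Nat.one_le_div_iff (by omega)).2 hnK
    have h3 : K ≤ q * K := Nat.le_mul_of_pos_left K h2
    omega
  have hqn' : (n : ℝ) ≤ 2 * (q * K) := by exact_mod_cast hqn
  set a := (w / ((y + ρ) / 2)) ^ 2 with ha
  have ha0 : 0 ≤ a := by positivity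
  have ha1 : w ^ 2 / n ≤ a := by
    rw [ha, div_pow]
    gcongr
  have h1 : 1 / (2 * K : ℝ) * (1 + w ^ 2) ≤ (1 + a) ^ q := by
    have h2 := one_add_mul_le_pow (a := a) (by linarith) q
    have h3 : 1 / (2 * K : ℝ) * w ^ 2 ≤ q * a := by
      calc 1 / (2 * K : ℝ) * w ^ 2 ≤ (q / n) * w ^ 2 := by
            refine mul_le_mul_of_nonneg_right ?_ (sq_nonneg w)
            rw [div_le_div_iff₀ (by positivity) hn']
            linarith
        _ = q * (w ^ 2 / n) := by ring
        _ ≤ _ := by gcongr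
    have h4 : 1 / (2 * K : ℝ) ≤ 1 := by
      rw [div_le_one (by positivity)]
      have : (1 : ℝ) ≤ K := by exact_mod_cast (by omega : 1 ≤ K)
      linarith
    linarith
  rw [rationalKernel, ← hy, ← sqrt_pow_eq (by positivity)]
  refine Real.le_sqrt_of_sq_le ?_
  calc ((1 / (2 * K : ℝ)) ^ (k + 1) * (1 + w ^ 2) ^ (k + 1)) ^ 2
      = (1 / (2 * K : ℝ) * (1 + w ^ 2)) ^ K := by
        rw [← mul_pow, ← pow_mul, mul_comm (k + 1) 2]
    _ ≤ ((1 + a) ^ q) ^ K := by gcongr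
    _ = (1 + a) ^ (q * K) := (pow_mul _ _ _).symm
    _ ≤ (1 + a) ^ (n + 1) := pow_le_pow_right₀ (by linarith) (by omega)

lemma lineMajorant_eq (F : ℂ → ℂ) (h : ℝ) {ρ : ℝ} (hρ : 0 < ρ) (n : ℕ) :
    lineMajorant F h ((√(2 * n) + ρ) / 2) n = (∫ p : ℝ × ℝ, Real.exp (-p.2 ^ 2) *
      ‖F (p.1 + h * Complex.I)‖ / rationalKernel ρ n (p.1 - p.2)) /
        ((√(2 * n) + ρ) / 2) ^ (n + 1) := by
  rw [lineMajorant, ← integral_div]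
  congr 1; ext p
  have hT : 0 < (√(2 * (n : ℝ)) + ρ) / 2 := by positivity
  set T := (√(2 * (n : ℝ)) + ρ) / 2 with hTd
  have e : √((p.1 - p.2) ^ 2 + T ^ 2) = √(1 + ((p.1 - p.2) / T) ^ 2) * T := by
    nth_rw 3 [← Real.sqrt_sq hT.le]
    rw [← Real.sqrt_mul (by positivity)]
    congr 1
    field_simp
    ring
  rw [e, mul_pow, rationalKernel, div_div]

/-- In the limit the kernel is `e^{-(x - v)²}`, and the integral over `v` is Gaussian. -/
lemma tendsto_integral_rationalKernel {ρ C h : ℝ} {F : ℂ → ℂ} {k : ℕ} (hρ : 0 < ρ)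
    (hF : AnalyticOnNhd ℂ F (strip ρ))
    (hC : ∀ z ∈ strip ρ, ‖F z‖ ≤ C * (1 + z.re ^ 2) ^ k) (hC0 : 0 ≤ C)
    (hh : h ∈ Set.Icc (-ρ) ρ) :
    Tendsto (fun n => ∫ p : ℝ × ℝ, Real.exp (-p.2 ^ 2) * ‖F (p.1 + h * Complex.I)‖ /
      rationalKernel ρ n (p.1 - p.2)) atTop
      (𝓝 (√(Real.pi / 2) * ∫ x : ℝ, Real.exp (-x ^ 2 / 2) * ‖F (x + h * Complex.I)‖)) := by
  obtain ⟨c, hc0, hc⟩ := pow_le_rationalKernel hρ k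
  have hcF := continuous_on_line hF hh
  have hcF2 : Continuous fun p : ℝ × ℝ => F (p.1 + h * Complex.I) := hcF.comp continuous_fst
  set bd : ℝ × ℝ → ℝ := fun p => C * 2 ^ k / c * ((1 + p.2 ^ 2) ^ k * Real.exp (-p.2 ^ 2) *
    (1 + (p.1 - p.2) ^ 2)⁻¹) with hbd
  have hbi : Integrable bd (volume.prod volume) := (integrable_dominating k).const_mul _
  have hpos : ∀ n w, 0 < rationalKernel ρ n w := by
    intro n w; unfold rationalKernel; positivity
  have hle : ∀ᶠ n : ℕ in atTop, ∀ p : ℝ × ℝ, ‖Real.exp (-p.2 ^ 2) * ‖F (p.1 + h * Complex.I)‖ /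
      rationalKernel ρ n (p.1 - p.2)‖ ≤ bd p := by
    filter_upwards [hc] with n hn p
    rw [Real.norm_of_nonneg (by have := hpos n (p.1 - p.2); positivity)]
    have h2 : ‖F (p.1 + h * Complex.I)‖ ≤
        C * (2 * ((1 + p.2 ^ 2) * (1 + (p.2 - p.1) ^ 2))) ^ k := by
      refine (hC _ (by simpa [strip] using hh)).trans ?_
      have h3 := one_add_sq_le_two_mul p.1 p.2
      have h4 : ((p.1 : ℂ) + h * Complex.I).re = p.1 := by simp
      rw [h4]
      gcongr
    have h5 := hn (p.1 - p.2)
    have h6 : 0 < c * (1 + (p.1 - p.2) ^ 2) ^ (k + 1) := by positivity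
    calc _ ≤ Real.exp (-p.2 ^ 2) * (C * (2 * ((1 + p.2 ^ 2) * (1 + (p.2 - p.1) ^ 2))) ^ k) /
          (c * (1 + (p.1 - p.2) ^ 2) ^ (k + 1)) := by gcongr
      _ = _ := by
        simp only [hbd]
        rw [show (p.2 - p.1) ^ 2 = (p.1 - p.2) ^ 2 by ring, mul_pow, mul_pow, pow_succ]
        have : 0 < 1 + (p.1 - p.2) ^ 2 := by positivity
        field_simp
        ring
  set lim : ℝ × ℝ → ℝ := fun p => Real.exp (-p.2 ^ 2) * ‖F (p.1 + h * Complex.I)‖ /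
    Real.exp ((p.1 - p.2) ^ 2) with hlim
  have hpt : ∀ p : ℝ × ℝ, Tendsto (fun n => Real.exp (-p.2 ^ 2) * ‖F (p.1 + h * Complex.I)‖ /
      rationalKernel ρ n (p.1 - p.2)) atTop (𝓝 (lim p)) := fun p =>
    tendsto_const_nhds.div (tendsto_rationalKernel ρ _) (Real.exp_pos _).ne'
  have hdct := tendsto_integral_filter_of_dominated_convergence (μ := volume.prod volume)
    (l := atTop) bd
    (F := fun n (p : ℝ × ℝ) => Real.exp (-p.2 ^ 2) * ‖F (p.1 + h * Complex.I)‖ /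
      rationalKernel ρ n (p.1 - p.2)) (f := lim)
    (Eventually.of_forall fun n => by
      refine Continuous.aestronglyMeasurable ?_
      refine Continuous.div (.mul (by fun_prop) hcF2.norm) ?_ fun p => (hpos n _).ne'
      unfold rationalKernel
      fun_prop)
    (hle.mono fun n hn => ae_of_all _ hn) hbi (ae_of_all _ hpt)
  have hlimc : Continuous lim :=
    Continuous.div (.mul (by fun_prop) hcF2.norm) (by fun_prop) fun p => (Real.exp_pos _).ne'
  have hlimi : Integrable lim (volume.prod volume) :=
    hbi.mono' hlimc.aestronglyMeasurable (ae_of_all _ fun p =>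
      le_of_tendsto (hpt p).norm (hle.mono fun n hn => hn p))
  rw [integral_prod _ hlimi] at hdct
  convert! hdct using 2
  rw [← integral_const_mul]
  congr 1; ext x
  have e : ∀ v : ℝ, lim (x, v) = Real.exp (-x ^ 2 / 2) * ‖F (x + h * Complex.I)‖ *
      (fun t => Real.exp (-2 * t ^ 2)) (v - x / 2) := by
    intro v
    simp only [hlim]
    rw [div_eq_mul_inv, ← Real.exp_neg, mul_right_comm, ← Real.exp_add, mul_right_comm _ ‖_‖,
      ← Real.exp_add]
    congr 2
    ring
  simp_rw [e]
  rw [integral_const_mul, integral_sub_right_eq_self (fun t => Real.exp (-2 * t ^ 2)),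
    integral_gaussian]
  ring

/-- The normalised coefficients `|c_n| n^{1/4} e^{ρ√(2n)}` are bounded by a sequence with an
explicit limit. The choice `τ = (√(2n) - ρ) / 2` minimises `e^{τ²} / (τ + ρ)^{n+1}` up to lower
order terms, and turns the kernel of the double integral into one which converges to a Gaussian. -/
theorem exists_tendsto_coeff_bound {ρ : ℝ} (hρ : 0 < ρ) {F : ℂ → ℂ}
    (hF : AnalyticOnNhd ℂ F (strip ρ)) (hg : AlgebraicGrowthInStrip ρ F) :
    ∃ A : ℕ → ℝ, Tendsto A atTop (𝓝 (√(√2 / (4 * Real.pi)) * hermiteV ρ F)) ∧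
      ∀ᶠ n : ℕ in atTop, ‖∫ x : ℝ, F x * ((hermiteH n x * hermiteWeight x : ℝ) : ℂ)‖ /
        √(hermiteGamma n) ≤ A n * (n : ℝ) ^ (-(1 / 4) : ℝ) * Real.exp (-ρ * √(2 * n)) := by
  obtain ⟨C, k, hC0, hC⟩ := hg.exists_norm_le hF
  have h1 := tendsto_integral_rationalKernel hρ hF hC hC0 (h := ρ) ⟨by linarith, le_rfl⟩
  have h2 := tendsto_integral_rationalKernel hρ hF hC hC0 (h := -ρ) ⟨le_rfl, by linarith⟩
  refine ⟨fun n => coeffPrefactor ρ n * ((∫ p : ℝ × ℝ, Real.exp (-p.2 ^ 2) *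
      ‖F (p.1 + ρ * Complex.I)‖ / rationalKernel ρ n (p.1 - p.2)) + ∫ p : ℝ × ℝ,
      Real.exp (-p.2 ^ 2) * ‖F (p.1 + (-ρ : ℝ) * Complex.I)‖ / rationalKernel ρ n (p.1 - p.2)),
    ?_, ?_⟩
  rotate_left
  · filter_upwards [tendsto_sqrt_two_mul_atTop.eventually_gt_atTop ρ,
      eventually_ge_atTop (2 * k + 1)] with n hn hnk
    have hn0 : (0 : ℝ) < n := by exact_mod_cast (by omega : 0 < n)
    have hτ : 0 < (√(2 * (n : ℝ)) - ρ) / 2 := by linarith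
    have h3 := norm_integral_mul_hermiteH_le hρ hF hC hC0 hτ hnk
    rw [show (√(2 * (n : ℝ)) - ρ) / 2 + ρ = (√(2 * n) + ρ) / 2 by ring, lineMajorant_eq _ _ hρ,
      lineMajorant_eq _ _ hρ, ← add_div] at h3
    have hg0 := Real.sqrt_pos.2 (hermiteGamma_pos n)
    refine (div_le_div_of_nonneg_right h3 hg0.le).trans (le_of_eq ?_)
    have e1 : (n : ℝ) ^ (1 / 4 : ℝ) * (n : ℝ) ^ (-(1 / 4) : ℝ) = 1 := by
      rw [← Real.rpow_add hn0]; norm_num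
    have e2 : Real.exp (ρ * √(2 * n)) * Real.exp (-ρ * √(2 * n)) = 1 := by
      rw [← Real.exp_add]; simp
    simp only [coeffPrefactor]
    generalize (n : ℝ) ^ (1 / 4 : ℝ) = a at *
    generalize (n : ℝ) ^ (-(1 / 4) : ℝ) = b at *
    generalize Real.exp (ρ * √(2 * n)) = c at *
    generalize Real.exp (-ρ * √(2 * n)) = d at *
    calc _ = (a * b) * (c * d) * _ := by rw [e1, e2, one_mul, one_mul]
      _ = _ := by ring
  · have h3 := (tendsto_coeffPrefactor hρ).mul (h1.add h2)
    convert! h3 using 2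
    have hV : ∀ s : ℝ, s ^ 2 = ρ ^ 2 → ∀ x : ℝ,
        ‖Complex.exp (-(x + s * Complex.I) ^ 2 / 2) * F (x + s * Complex.I)‖ =
        Real.exp (ρ ^ 2 / 2) * (Real.exp (-x ^ 2 / 2) * ‖F (x + s * Complex.I)‖) := by
      intro s hs x
      rw [norm_mul, Complex.norm_exp, ← mul_assoc, ← Real.exp_add]
      congr 2
      simp [pow_two]
      linarith [hs]
    have hV2 : hermiteV ρ F = Real.exp (ρ ^ 2 / 2) *
        ((∫ x : ℝ, Real.exp (-x ^ 2 / 2) * ‖F (x + ρ * Complex.I)‖) +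
        ∫ x : ℝ, Real.exp (-x ^ 2 / 2) * ‖F (x + (-ρ : ℝ) * Complex.I)‖) := by
      simp only [hermiteV, stripBoundaryIntegral]
      rw [mul_add, ← integral_const_mul, ← integral_const_mul]
      congr 2
      · ext x; exact hV ρ rfl x
      · ext x
        rw [← hV (-ρ) (by ring) x]
        push_cast
        simp only [neg_mul, sub_eq_add_neg]
    have hc : √(√2 / (4 * Real.pi)) = √(2 * √2) / (2 * Real.pi) * √(Real.pi / 2) := by
      rw [div_mul_eq_mul_div, ← Real.sqrt_mul (by positivity), eq_div_iff (by positivity)]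
      nth_rw 1 [← Real.sqrt_sq (by positivity : 0 ≤ 2 * Real.pi)]
      rw [← Real.sqrt_mul (by positivity)]
      congr 1
      have := Real.pi_pos
      field_simp
      ring
    rw [hV2, hc]
    ring

/-! ### Tails of subexponential series -/

/-- The increments of `k ^ p e^{-c√(2k)}` have the size of `k ^ (p - 1/2) e^{-c√(2k)}`. -/
lemma exists_le_sub_subexponential (p c : ℝ) :
    ∃ d : ℕ → ℝ, Tendsto d atTop (𝓝 (c / √2)) ∧ ∀ᶠ k : ℕ in atTop,
      d k * (((k + 1 : ℕ) : ℝ) ^ (p - 1 / 2) * Real.exp (-c * √(2 * ((k + 1 : ℕ) : ℝ)))) ≤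
        (k : ℝ) ^ p * Real.exp (-c * √(2 * k)) -
          ((k + 1 : ℕ) : ℝ) ^ p * Real.exp (-c * √(2 * ((k + 1 : ℕ) : ℝ))) := by
  have hx : Tendsto (fun k : ℕ => √((k : ℝ) + 1)) atTop atTop :=
    Real.tendsto_sqrt_atTop.comp (tendsto_atTop_add_const_right _ _ tendsto_natCast_atTop_atTop)
  have hxi : Tendsto (fun k : ℕ => (√((k : ℝ) + 1))⁻¹) atTop (𝓝 0) :=
    tendsto_inv_atTop_zero.comp hx
  set t : ℕ → ℝ := fun k => (√((k : ℝ) + 1))⁻¹ with ht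
  have ht2 : ∀ k, t k ^ 2 = ((k : ℝ) + 1)⁻¹ := fun k => by
    simp only [ht]
    rw [inv_pow, Real.sq_sqrt (by positivity)]
  have hlog : Tendsto (fun k : ℕ => √((k : ℝ) + 1) * Real.log (1 - t k ^ 2)) atTop (𝓝 0) := by
    have hd : HasDerivAt (fun s : ℝ => Real.log (1 - s ^ 2)) 0 0 := by
      have h1 : HasDerivAt (fun s : ℝ => 1 - s ^ 2) 0 0 := by
        simpa using (hasDerivAt_pow 2 (0 : ℝ)).const_sub 1
      simpa using h1.log (by norm_num)
    have h2 := hd.tendsto_slope_zero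
    have h3 : Tendsto t atTop (𝓝[≠] 0) :=
      tendsto_nhdsWithin_iff.2 ⟨hxi, Eventually.of_forall fun k =>
        (inv_pos.2 (Real.sqrt_pos.2 (by positivity))).ne'⟩
    have h4 := h2.comp h3
    refine h4.congr fun k => ?_
    simp [ht]
  have hsq : Tendsto (fun k : ℕ => √((k : ℝ) + 1) * (√(2 * ((k : ℝ) + 1)) - √(2 * k))) atTop
      (𝓝 (1 / √2)) := by
    have h1 : Tendsto (fun k : ℕ => √2 / (1 + √(1 - t k ^ 2))) atTop
        (𝓝 (√2 / (1 + √(1 - 0 ^ 2)))) :=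
      tendsto_const_nhds.div (((hxi.pow 2).const_sub 1).sqrt.const_add 1) (by norm_num)
    have h2 : √2 / (1 + √(1 - 0 ^ 2)) = 1 / √2 := by
      norm_num
      rw [div_eq_iff (by norm_num), inv_mul_eq_div, eq_div_iff (by positivity)]
      exact Real.mul_self_sqrt (by norm_num)
    rw [h2] at h1
    refine h1.congr fun k => ?_
    have hk : (0 : ℝ) < (k : ℝ) + 1 := by positivity
    have hs : 0 < √((k : ℝ) + 1) := Real.sqrt_pos.2 hk
    have h3 : √(k : ℝ) = √((k : ℝ) + 1) * √(1 - t k ^ 2) := by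
      rw [← Real.sqrt_mul hk.le, ht2]
      congr 1
      field_simp
      ring
    have h4 : √(1 - t k ^ 2) ^ 2 = 1 - t k ^ 2 := by
      refine Real.sq_sqrt ?_
      rw [ht2, sub_nonneg]
      exact inv_le_one_of_one_le₀ (by have := k.cast_nonneg (α := ℝ); linarith)
    have h5 : √((k : ℝ) + 1) ^ 2 = (k : ℝ) + 1 := Real.sq_sqrt hk.le
    rw [Real.sqrt_mul (by norm_num), Real.sqrt_mul (by norm_num), h3]
    rw [div_eq_iff (by positivity)]
    have h6 : ((k : ℝ) + 1) * t k ^ 2 = 1 := by rw [ht2]; field_simp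
    calc √2 = √2 * (((k : ℝ) + 1) * t k ^ 2) := by rw [h6, mul_one]
      _ = √2 * (√((k : ℝ) + 1) ^ 2 * (1 - √(1 - t k ^ 2) ^ 2)) := by rw [h4, h5]; ring
      _ = _ := by ring
  refine ⟨fun k => √((k : ℝ) + 1) * (p * Real.log (1 - t k ^ 2) +
    c * (√(2 * ((k : ℝ) + 1)) - √(2 * k))), ?_, ?_⟩
  · have := (hlog.const_mul p).add (hsq.const_mul c)
    rw [mul_zero, zero_add, mul_one_div] at this
    refine this.congr fun k => ?_
    ring
  · filter_upwards [eventually_gt_atTop 0] with k hk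
    have hk0 : (0 : ℝ) < k := by exact_mod_cast hk
    have hk1 : (0 : ℝ) < (k : ℝ) + 1 := by positivity
    push_cast
    set u := p * Real.log (1 - t k ^ 2) + c * (√(2 * ((k : ℝ) + 1)) - √(2 * k)) with hu
    have h1 : (k : ℝ) ^ p * Real.exp (-c * √(2 * k)) =
        ((k : ℝ) + 1) ^ p * Real.exp (-c * √(2 * ((k : ℝ) + 1))) * Real.exp u := by
      have h2 : (1 : ℝ) - t k ^ 2 = k / (k + 1) := by rw [ht2]; field_simp; ring
      rw [hu, h2, Real.log_div hk0.ne' hk1.ne', Real.rpow_def_of_pos hk0, Real.rpow_def_of_pos hk1,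
        ← Real.exp_add, ← Real.exp_add, ← Real.exp_add]
      congr 1
      ring
    have h3 : ((k : ℝ) + 1) ^ p = √((k : ℝ) + 1) * ((k : ℝ) + 1) ^ (p - 1 / 2) := by
      rw [Real.sqrt_eq_rpow, ← Real.rpow_add hk1]
      congr 1
      ring
    rw [h1]
    have h4 := Real.add_one_le_exp u
    have h5 : 0 ≤ ((k : ℝ) + 1) ^ p * Real.exp (-c * √(2 * ((k : ℝ) + 1))) := by positivity
    calc √((k : ℝ) + 1) * u * (((k : ℝ) + 1) ^ (p - 1 / 2) * Real.exp (-c * √(2 * ((k : ℝ) + 1))))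
        = (((k : ℝ) + 1) ^ p * Real.exp (-c * √(2 * ((k : ℝ) + 1)))) * u := by rw [h3]; ring
      _ ≤ (((k : ℝ) + 1) ^ p * Real.exp (-c * √(2 * ((k : ℝ) + 1)))) * (Real.exp u - 1) := by
          gcongr; linarith
      _ = _ := by ring

/-- Sharp bound for the tails of a series with subexponentially decaying terms, by comparison with
a telescoping series. -/
theorem eventually_tsum_tail_le {p c r ε : ℝ} (hc : 0 < c) (hr0 : 0 ≤ r) (hε : 0 < ε)
    {b R : ℕ → ℝ} (hb : ∀ k, 0 ≤ b k) (hR : Tendsto R atTop (𝓝 r))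
    (hbR : ∀ᶠ k : ℕ in atTop, b k ≤ R k * ((k : ℝ) ^ (p - 1 / 2) * Real.exp (-c * √(2 * k)))) :
    ∀ᶠ n : ℕ in atTop, Summable (fun k => b (k + (n + 1))) ∧
      ∑' k, b (k + (n + 1)) ≤ (r * √2 / c + ε) * ((n : ℝ) ^ p * Real.exp (-c * √(2 * n))) := by
  obtain ⟨d, hd, hdle⟩ := exists_le_sub_subexponential p c
  set M := r * √2 / c + ε with hM
  have hM0 : 0 < M := by positivity
  have h2 : (0 : ℝ) < √2 := by positivity
  have hlt : ∀ᶠ k : ℕ in atTop, R (k + 1) < M * d k := by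
    refine (hR.comp (tendsto_add_atTop_nat 1)).eventually_lt (hd.const_mul M) ?_
    rw [hM, add_mul]
    have : r * √2 / c * (c / √2) = r := by field_simp
    rw [this]
    have : 0 < ε * (c / √2) := by positivity
    linarith
  set F : ℕ → ℝ := fun n => (n : ℝ) ^ p * Real.exp (-c * √(2 * n)) with hF
  have hstep : ∀ᶠ k : ℕ in atTop, b (k + 1) ≤ M * (F k - F (k + 1)) := by
    filter_upwards [hlt, hdle, (tendsto_add_atTop_nat 1).eventually hbR] with k h3 h4 h5
    refine h5.trans ?_
    calc _ ≤ (M * d k) * (((k + 1 : ℕ) : ℝ) ^ (p - 1 / 2) *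
          Real.exp (-c * √(2 * ((k + 1 : ℕ) : ℝ)))) := by gcongr
      _ ≤ _ := by
        rw [mul_assoc]
        gcongr
  obtain ⟨N, hN⟩ := eventually_atTop.1 hstep
  filter_upwards [eventually_ge_atTop N] with n hn
  have hsum : ∀ j, ∑ k ∈ Finset.range j, b (k + (n + 1)) ≤ M * F n := by
    intro j
    have h6 : ∑ k ∈ Finset.range j, b (k + (n + 1)) ≤ M * (F n - F (n + j)) := by
      induction j with
      | zero => simp
      | succ j ih =>
        rw [Finset.sum_range_succ]
        have h7 := hN (n + j) (by omega)
        rw [show j + (n + 1) = n + j + 1 by ring, show n + (j + 1) = n + j + 1 by ring]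
        linarith
    have h8 : 0 ≤ F (n + j) := by simp only [hF]; positivity
    nlinarith
  exact ⟨summable_of_sum_range_le (fun k => hb _) hsum,
    Real.tsum_le_of_sum_range_le (fun k => hb _) hsum⟩

/-- A family of asymptotic bounds with constants `L + ε` gives one with constants tending to `L`. -/
lemma exists_tendsto_of_forall_eventually_le {u g : ℕ → ℝ} {L : ℝ} (hg : ∀ᶠ n in atTop, 0 < g n)
    (h : ∀ ε > 0, ∀ᶠ n in atTop, u n ≤ (L + ε) * g n) :
    ∃ K : ℕ → ℝ, Tendsto K atTop (𝓝 L) ∧ ∀ᶠ n in atTop, u n ≤ K n * g n := by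
  refine ⟨fun n => max L (u n / g n), ?_, ?_⟩
  · rw [Metric.tendsto_atTop']
    intro ε hε
    obtain ⟨N, hN⟩ := eventually_atTop.1 ((h (ε / 2) (by positivity)).and hg)
    refine ⟨N, fun n hn => ?_⟩
    obtain ⟨h1, h2⟩ := hN n hn.le
    rw [Real.dist_eq, abs_of_nonneg (sub_nonneg.2 (le_max_left _ _)), sub_lt_iff_lt_add]
    refine max_lt (by linarith) ?_
    have : u n / g n ≤ L + ε / 2 := (div_le_iff₀ h2).2 h1
    linarith
  · filter_upwards [hg] with n hn
    rw [← div_le_iff₀ hn]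
    exact le_max_right _ _

/-! ### The Hermite expansion -/

/-- Termwise differentiation of a series which converges locally uniformly with all its
derivatives. -/
lemma iteratedDeriv_tsum_of_locally_bounded {u : ℕ → ℝ → ℂ} (hu : ∀ k, ContDiff ℝ ⊤ (u k))
    (hs : ∀ (j : ℕ) (r : ℝ), ∃ s : ℕ → ℝ, Summable s ∧
      ∀ k x, |x| ≤ r → ‖iteratedDeriv j (u k) x‖ ≤ s k) (j : ℕ) :
    iteratedDeriv j (fun x => ∑' k, u k x) = fun x => ∑' k, iteratedDeriv j (u k) x := by
  induction j with
  | zero => simp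
  | succ j ih =>
    rw [iteratedDeriv_succ, ih]
    ext x
    obtain ⟨s, hs1, hs2⟩ := hs (j + 1) (|x| + 1)
    obtain ⟨s0, hs3, hs4⟩ := hs j (|x| + 1)
    have hball : ∀ y ∈ Metric.ball (0 : ℝ) (|x| + 1), |y| ≤ |x| + 1 := fun y hy => by
      simpa using (mem_ball_zero_iff.1 hy).le
    have hxb : x ∈ Metric.ball (0 : ℝ) (|x| + 1) := by simp
    refine (hasDerivAt_tsum_of_isPreconnected (g := fun k => iteratedDeriv j (u k))
      (g' := fun k => iteratedDeriv (j + 1) (u k)) hs1 Metric.isOpen_ball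
      (convex_ball (0 : ℝ) (|x| + 1)).isPreconnected (fun k y _ => ?_)
      (fun k y hy => hs2 k y (hball y hy)) hxb ?_ hxb).deriv
    · rw [iteratedDeriv_succ]
      exact (((hu k).differentiable_iteratedDeriv j (by simp)) y).hasDerivAt
    · exact Summable.of_norm_bounded hs3 fun k => hs4 k x (by linarith)

lemma hermiteCoeffF_eq {F : ℂ → ℂ} {φ : ℝ → ℂ}
    (hφ : ∀ x : ℝ, φ x = Real.exp (-x ^ 2 / 2) * F x) (k : ℕ) : hermiteCoeffF φ k =
      (∫ x : ℝ, F x * ((hermiteH k x * hermiteWeight x : ℝ) : ℂ)) / (√(hermiteGamma k) : ℝ) := by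
  rw [hermiteCoeffF, ← integral_div]
  congr 1; ext x
  rw [hφ, hermitePsi, hermiteWeight, show -x ^ 2 = -x ^ 2 / 2 + -x ^ 2 / 2 by ring, Real.exp_add]
  push_cast
  ring_nf

lemma integrable_hermitePsi (k : ℕ) : Integrable (hermitePsi k) := by
  have h := (integrable_polynomial_mul_gaussian (hermitePoly k) one_half_pos).div_const
    √(hermiteGamma k)
  refine h.congr (ae_of_all _ fun x => ?_)
  simp only [hermitePsi, hermiteH_eq_eval]
  rw [show -(1 / 2 : ℝ) * x ^ 2 = -x ^ 2 / 2 by ring]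
  ring

lemma exists_abs_hermitePsi_le_const :
    ∃ C : ℝ, 0 < C ∧ ∀ (n : ℕ) (x : ℝ), |hermitePsi n x| ≤ C := by
  obtain ⟨C, hC, h⟩ := exists_abs_hermitePsi_le
  refine ⟨C, hC, fun n x => (h n x).trans (mul_le_of_le_one_right hC.le ?_)⟩
  exact Real.rpow_le_one_of_one_le_of_nonpos (by have := n.cast_nonneg (α := ℝ); linarith)
    (by norm_num)

lemma integrable_exp_mul_one_add_sq_pow_mul_gaussian (c : ℝ) (k : ℕ) {b : ℝ} (hb : 0 < b) :
    Integrable fun x : ℝ => Real.exp (c * |x|) * ((1 + x ^ 2) ^ k * Real.exp (-b * x ^ 2)) := by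
  have h := (integrable_polynomial_mul_gaussian ((1 + Polynomial.X ^ 2) ^ k)
    (half_pos hb)).const_mul (Real.exp (c ^ 2 / (2 * b)))
  refine h.mono' (by fun_prop) (ae_of_all _ fun x => ?_)
  rw [Real.norm_of_nonneg (by positivity)]
  simp only [Polynomial.eval_pow, Polynomial.eval_add, Polynomial.eval_one, Polynomial.eval_X]
  have h1 : c * |x| ≤ c ^ 2 / (2 * b) + b / 2 * x ^ 2 := by
    have h2 : 0 ≤ (c - b * |x|) ^ 2 / (2 * b) := by positivity
    have h3 : (c - b * |x|) ^ 2 / (2 * b) = c ^ 2 / (2 * b) + b / 2 * |x| ^ 2 - c * |x| := by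
      field_simp
      ring
    rw [sq_abs] at h3
    linarith
  calc Real.exp (c * |x|) * ((1 + x ^ 2) ^ k * Real.exp (-b * x ^ 2))
      ≤ Real.exp (c ^ 2 / (2 * b) + b / 2 * x ^ 2) * ((1 + x ^ 2) ^ k * Real.exp (-b * x ^ 2)) := by
        gcongr
    _ = Real.exp (c ^ 2 / (2 * b)) * ((1 + x ^ 2) ^ k *
        (Real.exp (b / 2 * x ^ 2) * Real.exp (-b * x ^ 2))) := by
        rw [Real.exp_add]; ring
    _ = _ := by
      rw [← Real.exp_add]
      ring_nf

/-- A continuous function with absolutely summable Hermite coefficients is the sum of its Hermite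
series. -/
theorem eq_tsum_hermiteCoeffF_mul {φ : ℝ → ℂ} {C : ℝ} {k : ℕ} (hφc : Continuous φ)
    (hφ : ∀ x : ℝ, ‖φ x‖ ≤ C * (1 + x ^ 2) ^ k * Real.exp (-x ^ 2 / 2))
    (hsum : Summable fun n => ‖hermiteCoeffF φ n‖) (x : ℝ) :
    φ x = ∑' n, hermiteCoeffF φ n * hermitePsi n x := by
  obtain ⟨B, hB0, hB⟩ := exists_abs_hermitePsi_le_const
  set c := hermiteCoeffF φ with hc
  set S : ℝ → ℂ := fun x => ∑' n, c n * hermitePsi n x with hS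
  have hterm : ∀ n x, ‖c n * (hermitePsi n x : ℂ)‖ ≤ ‖c n‖ * B := fun n x => by
    rw [norm_mul, Complex.norm_real]
    exact mul_le_mul_of_nonneg_left (hB n x) (norm_nonneg _)
  have hsumB := hsum.mul_right B
  have hpc : ∀ n, Continuous fun x : ℝ => (hermitePsi n x : ℂ) := fun n =>
    Complex.continuous_ofReal.comp (continuous_hermitePsi n)
  have hSc : Continuous S := continuous_tsum (fun n => continuous_const.mul (hpc n)) hsumB hterm
  have hSb : ∀ x, ‖S x‖ ≤ ∑' n, ‖c n‖ * B := fun x =>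
    tsum_of_norm_bounded hsumB.hasSum fun n => hterm n x
  have hpi : ∀ n, Integrable fun x : ℝ => (hermitePsi n x : ℂ) := fun n =>
    (integrable_hermitePsi n).ofReal
  have hSψ : ∀ n, ∫ x : ℝ, S x * (hermitePsi n x : ℂ) = c n := by
    intro n
    have h1 := hasSum_integral_of_summable_integral_norm (μ := volume)
      (F := fun j (x : ℝ) => c j * (hermitePsi j x : ℂ) * (hermitePsi n x : ℂ))
      (fun j => ?_) ?_
    · have h2 : ∀ j, ∫ x : ℝ, c j * (hermitePsi j x : ℂ) * (hermitePsi n x : ℂ) =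
          if j = n then c j else 0 := by
        intro j
        have h3 : ∀ x : ℝ, c j * (hermitePsi j x : ℂ) * (hermitePsi n x : ℂ) =
            c j * ((hermitePsi j x * hermitePsi n x : ℝ) : ℂ) := fun x => by push_cast; ring
        simp_rw [h3]
        rw [integral_const_mul, integral_complex_ofReal, integral_hermitePsi_mul]
        split_ifs <;> simp
      simp_rw [h2] at h1
      have h5 : ∀ j, (if j = n then c j else 0) = if j = n then c n else 0 := fun j => by
        split_ifs with h <;> simp [h]
      simp_rw [h5, tsum_mul_right] at h1
      exact (h1.unique (hasSum_ite_eq n (c n)))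
    · have h3 : Integrable fun x : ℝ => c j * ((hermitePsi j x * hermitePsi n x : ℝ) : ℂ) :=
        (integrable_hermitePsi_mul j n).ofReal.const_mul _
      refine h3.congr (ae_of_all _ fun x => ?_)
      push_cast
      ring
    · refine Summable.of_nonneg_of_le (fun j => integral_nonneg fun x => norm_nonneg _)
        (fun j => ?_) (hsumB.mul_right (∫ x : ℝ, ‖(hermitePsi n x : ℂ)‖))
      rw [← integral_const_mul]
      refine integral_mono_of_nonneg (ae_of_all _ fun x => norm_nonneg _)
        ((hpi n).norm.const_mul _) (ae_of_all _ fun x => ?_)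
      simp only [norm_mul]
      rw [← norm_mul]
      exact mul_le_mul_of_nonneg_right (hterm j x) (norm_nonneg _)
  have hφi : Integrable fun x => ‖φ x‖ := by
    refine ((integrable_exp_mul_one_add_sq_pow_mul_gaussian 0 k one_half_pos).const_mul C).mono'
      hφc.norm.aestronglyMeasurable (ae_of_all _ fun x => ?_)
    rw [norm_norm]
    refine (hφ x).trans (le_of_eq ?_)
    rw [show -(1 / 2 : ℝ) * x ^ 2 = -x ^ 2 / 2 by ring]
    simp
    ring
  have hφψ : ∀ n, Integrable fun x : ℝ => φ x * (hermitePsi n x : ℂ) := by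
    intro n
    refine (hφi.mul_const B).mono' (hφc.mul (hpc n)).aestronglyMeasurable (ae_of_all _ fun x => ?_)
    rw [norm_mul, Complex.norm_real]
    exact mul_le_mul_of_nonneg_left (hB n x) (norm_nonneg _)
  have hSψi : ∀ n, Integrable fun x : ℝ => S x * (hermitePsi n x : ℂ) := by
    intro n
    refine ((hpi n).norm.const_mul (∑' n, ‖c n‖ * B)).mono' (hSc.mul (hpc n)).aestronglyMeasurable
      (ae_of_all _ fun x => ?_)
    rw [norm_mul]
    exact mul_le_mul_of_nonneg_right (hSb x) (norm_nonneg _)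
  set h : ℝ → ℂ := fun x => (φ x - S x) * (Real.exp (-x ^ 2 / 2) : ℂ) with hh
  have hec : Continuous fun x : ℝ => ((Real.exp (-x ^ 2 / 2) : ℝ) : ℂ) := by fun_prop
  have hhc : Continuous h := (hφc.sub hSc).mul hec
  have hzero : h = 0 := by
    refine eq_zero_of_forall_integral_hermiteH_eq_zero hhc (fun a => ?_) fun n => ?_
    · have h1 := (integrable_exp_mul_one_add_sq_pow_mul_gaussian a k one_pos).const_mul C
      have h2 := (integrable_exp_mul_one_add_sq_pow_mul_gaussian a 0 one_half_pos).const_mul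
        (∑' n, ‖c n‖ * B)
      refine (h1.add h2).mono' (by fun_prop) (ae_of_all _ fun x => ?_)
      have h3 : ‖h x‖ ≤ (C * (1 + x ^ 2) ^ k * Real.exp (-x ^ 2 / 2) + ∑' n, ‖c n‖ * B) *
          Real.exp (-x ^ 2 / 2) := by
        rw [hh, norm_mul, Complex.norm_real, Real.norm_of_nonneg (Real.exp_pos _).le]
        gcongr
        exact (norm_sub_le _ _).trans (add_le_add (hφ x) (hSb x))
      rw [Real.norm_of_nonneg (by positivity)]
      calc Real.exp (a * |x|) * ‖h x‖ ≤ Real.exp (a * |x|) *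
            ((C * (1 + x ^ 2) ^ k * Real.exp (-x ^ 2 / 2) + ∑' n, ‖c n‖ * B) *
              Real.exp (-x ^ 2 / 2)) := by gcongr
        _ = _ := by
          simp only [Pi.add_apply, pow_zero, one_mul]
          rw [show -1 * x ^ 2 = -x ^ 2 / 2 + -x ^ 2 / 2 by ring, Real.exp_add,
            show -(1 / 2 : ℝ) * x ^ 2 = -x ^ 2 / 2 by ring]
          ring
    · have h1 : ∀ x : ℝ, (hermiteH n x : ℂ) * h x = (√(hermiteGamma n) : ℝ) *
          (φ x * (hermitePsi n x : ℂ) - S x * (hermitePsi n x : ℂ)) := by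
        intro x
        have h2 : ((√(hermiteGamma n) : ℝ) : ℂ) ≠ 0 := by
          exact_mod_cast (Real.sqrt_pos.2 (hermiteGamma_pos n)).ne'
        simp only [hh, hermitePsi]
        push_cast
        field_simp
      simp_rw [h1]
      rw [integral_const_mul, integral_sub (hφψ n) (hSψi n), hSψ, hc, hermiteCoeffF, sub_self,
        mul_zero]
  have h1 := congrFun hzero x
  have h2 : ((Real.exp (-x ^ 2 / 2) : ℝ) : ℂ) ≠ 0 := by exact_mod_cast (Real.exp_pos _).ne'
  simpa [hh, sub_eq_zero, h2] using h1

/-! ### Coefficients of analytic functions -/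

lemma tendsto_succ_div_rpow (q : ℝ) :
    Tendsto (fun k : ℕ => (((k : ℝ) + 1) / k) ^ q) atTop (𝓝 1) := by
  have h1 : Tendsto (fun k : ℕ => ((k : ℝ) + 1) / k) atTop (𝓝 1) := by
    have := (tendsto_inv_atTop_zero.comp (tendsto_natCast_atTop_atTop (R := ℝ))).const_add 1
    rw [add_zero] at this
    refine this.congr' ?_
    filter_upwards [eventually_ne_atTop 0] with k hk
    have : (k : ℝ) ≠ 0 := by exact_mod_cast hk
    simp only [Function.comp]
    field_simp
  have := h1.rpow_const (p := q) (Or.inl one_ne_zero)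
  rwa [Real.one_rpow] at this

lemma summable_norm_mul_rpow {ρ L : ℝ} (hρ : 0 < ρ) {c : ℕ → ℂ} {A : ℕ → ℝ}
    (hA : Tendsto A atTop (𝓝 L))
    (hcA : ∀ᶠ n : ℕ in atTop, ‖c n‖ ≤ A n * (n : ℝ) ^ (-(1 / 4) : ℝ) * Real.exp (-ρ * √(2 * n)))
    (q : ℝ) : Summable fun k => ‖c k‖ * ((k : ℝ) + 1) ^ q := by
  have h := eventually_tsum_tail_le (p := q + 1 / 4) (c := ρ) (r := |L|) (ε := 1) hρ (abs_nonneg _)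
    one_pos (b := fun k => ‖c k‖ * ((k : ℝ) + 1) ^ q)
    (R := fun k => |A k| * (((k : ℝ) + 1) / k) ^ q) (fun k => by positivity)
    (by simpa using hA.abs.mul (tendsto_succ_div_rpow q)) ?_
  · obtain ⟨n, hn⟩ := h.exists
    exact (summable_nat_add_iff (n + 1)).1 hn.1
  · filter_upwards [hcA, eventually_gt_atTop 0] with k hk hk0
    have hk' : (0 : ℝ) < k := by exact_mod_cast hk0
    have e1 : ((k : ℝ) + 1) ^ q = (((k : ℝ) + 1) / k) ^ q * (k : ℝ) ^ q := by
      rw [← Real.mul_rpow (by positivity) hk'.le]; congr 1; field_simp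
    have e2 : (k : ℝ) ^ (q + 1 / 4 - 1 / 2) = (k : ℝ) ^ q * (k : ℝ) ^ (-(1 / 4) : ℝ) := by
      rw [← Real.rpow_add hk']; congr 1; ring
    rw [e2]
    calc ‖c k‖ * ((k : ℝ) + 1) ^ q ≤ (|A k| * (k : ℝ) ^ (-(1 / 4) : ℝ) *
          Real.exp (-ρ * √(2 * k))) * ((k : ℝ) + 1) ^ q := by
          gcongr
          refine hk.trans ?_
          gcongr
          exact le_abs_self _
      _ = _ := by rw [e1]; ring

/-- The coefficient asymptotics and the Hermite expansion of `e^{-x²/2} F`. -/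
lemma exists_coeff_bound_and_expansion {ρ : ℝ} (hρ : 0 < ρ) {F : ℂ → ℂ}
    (hF : AnalyticOnNhd ℂ F (strip ρ)) (hg : AlgebraicGrowthInStrip ρ F) {φ : ℝ → ℂ}
    (hφ : ∀ x : ℝ, φ x = Real.exp (-x ^ 2 / 2) * F x) :
    (∃ A : ℕ → ℝ, Tendsto A atTop (𝓝 (√(√2 / (4 * Real.pi)) * hermiteV ρ F)) ∧
      ∀ᶠ n : ℕ in atTop, ‖hermiteCoeffF φ n‖ ≤
        A n * (n : ℝ) ^ (-(1 / 4) : ℝ) * Real.exp (-ρ * √(2 * n))) ∧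
    (∀ q : ℝ, Summable fun k => ‖hermiteCoeffF φ k‖ * ((k : ℝ) + 1) ^ q) ∧
    ∀ x, φ x = ∑' n, hermiteCoeffF φ n * hermitePsi n x := by
  obtain ⟨A, hA, hcA⟩ := exists_tendsto_coeff_bound hρ hF hg
  have hcA' : ∀ᶠ n : ℕ in atTop, ‖hermiteCoeffF φ n‖ ≤
      A n * (n : ℝ) ^ (-(1 / 4) : ℝ) * Real.exp (-ρ * √(2 * n)) := by
    filter_upwards [hcA] with n hn
    rwa [hermiteCoeffF_eq hφ, norm_div, Complex.norm_real,
      Real.norm_of_nonneg (Real.sqrt_nonneg _)]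
  have hsum := summable_norm_mul_rpow hρ hA hcA'
  refine ⟨⟨A, hA, hcA'⟩, hsum, ?_⟩
  obtain ⟨C, k, hC0, hC⟩ := hg.exists_norm_le hF
  have h0 : (0 : ℝ) ∈ Set.Icc (-ρ) ρ := ⟨by linarith, hρ.le⟩
  have hFc : Continuous fun x : ℝ => F x := by simpa using continuous_on_line hF h0
  have hec : Continuous fun x : ℝ => ((Real.exp (-x ^ 2 / 2) : ℝ) : ℂ) := by fun_prop
  refine eq_tsum_hermiteCoeffF_mul (C := C) (k := k) ?_ (fun x => ?_) (by simpa using hsum 0)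
  · rw [show φ = fun x : ℝ => (Real.exp (-x ^ 2 / 2) : ℂ) * F x from funext hφ]
    exact hec.mul hFc
  · rw [hφ, norm_mul, Complex.norm_real, Real.norm_of_nonneg (Real.exp_pos _).le, mul_comm]
    gcongr
    simpa using hC x (by simpa [strip] using h0)

lemma iteratedDeriv_ofReal_comp {g : ℝ → ℝ} (hg : ContDiff ℝ ⊤ g) (j : ℕ) :
    iteratedDeriv j (fun x => (g x : ℂ)) = fun x => ((iteratedDeriv j g x : ℝ) : ℂ) := by
  induction j with
  | zero => simp
  | succ j ih =>
    rw [iteratedDeriv_succ, ih]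
    ext x
    rw [iteratedDeriv_succ]
    exact ((hg.differentiable_iteratedDeriv j (by simp) x).hasDerivAt.ofReal_comp).deriv

lemma contDiff_ofReal_comp {g : ℝ → ℝ} (hg : ContDiff ℝ ⊤ g) :
    ContDiff ℝ ⊤ fun x => (g x : ℂ) :=
  Complex.ofRealCLM.contDiff.comp hg

/-! ### The remainder in the maximum norm -/

lemma iteratedDeriv_sub_hermiteProjF {φ : ℝ → ℂ}
    (hsum : ∀ q : ℝ, Summable fun k => ‖hermiteCoeffF φ k‖ * ((k : ℝ) + 1) ^ q)
    (hφ : ∀ x, φ x = ∑' n, hermiteCoeffF φ n * hermitePsi n x) (m n : ℕ) (x : ℝ) :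
    iteratedDeriv m (fun x => φ x - hermiteProjF n φ x) x =
      ∑' k, hermiteCoeffF φ (k + (n + 1)) *
        ((iteratedDeriv m (hermitePsi (k + (n + 1))) x : ℝ) : ℂ) := by
  set c := hermiteCoeffF φ with hc
  have hd : ∀ (j k : ℕ) (x : ℝ), iteratedDeriv j (fun x => c k * (hermitePsi k x : ℂ)) x =
      c k * ((iteratedDeriv j (hermitePsi k) x : ℝ) : ℂ) := by
    intro j k x
    rw [iteratedDeriv_const_mul_field, iteratedDeriv_ofReal_comp (contDiff_hermitePsi k)]
  have hb : ∀ j : ℕ, ∃ s : ℕ → ℝ, Summable s ∧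
      ∀ k x, ‖iteratedDeriv j (fun x => c k * (hermitePsi k x : ℂ)) x‖ ≤ s k := by
    intro j
    obtain ⟨C, hC0, hC⟩ := exists_abs_iteratedDeriv_hermitePsi_le j
    refine ⟨_, (hsum ((j : ℝ) / 2 - 1 / 12)).mul_left C, fun k x => ?_⟩
    rw [hd, norm_mul, Complex.norm_real]
    calc ‖c k‖ * ‖iteratedDeriv j (hermitePsi k) x‖
        ≤ ‖c k‖ * (C * ((k : ℝ) + 1) ^ ((j : ℝ) / 2 - 1 / 12)) := by
          gcongr; exact hC k x
      _ = _ := by ring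
  have hrem : (fun x => φ x - hermiteProjF n φ x) =
      fun x => ∑' k, c (k + (n + 1)) * (hermitePsi (k + (n + 1)) x : ℂ) := by
    ext x
    obtain ⟨s, hs, hs2⟩ := hb 0
    have h1 : Summable fun k => c k * (hermitePsi k x : ℂ) :=
      Summable.of_norm_bounded hs fun k => by simpa using hs2 k x
    rw [hφ x, hermiteProjF, ← h1.sum_add_tsum_nat_add (n + 1), add_sub_cancel_left]
  rw [hrem, iteratedDeriv_tsum_of_locally_bounded
    (u := fun k x => c (k + (n + 1)) * (hermitePsi (k + (n + 1)) x : ℂ))]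
  · simp only [hd]
  · exact fun k => contDiff_const.mul (contDiff_ofReal_comp (contDiff_hermitePsi _))
  · intro j r
    obtain ⟨s, hs, hs2⟩ := hb j
    exact ⟨_, (summable_nat_add_iff (n + 1)).2 hs, fun k x _ => hs2 _ x⟩

/-- Because Hermite functions tend to zero uniformly, the remainder is of smaller order than
`n^{m/2+1/4} e^{-ρ√(2n)}`. -/
theorem exists_maxNorm_bound {ρ : ℝ} (hρ : 0 < ρ) {f : ℂ → ℂ}
    (hf : AnalyticOnNhd ℂ f (strip ρ))
    (hg : AlgebraicGrowthInStrip ρ fun z : ℂ => Complex.exp (z ^ 2 / 2) * f z) (m : ℕ) {L : ℝ}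
    (hL : 0 ≤ L) :
    ∃ K : ℕ → ℝ, Tendsto K atTop (𝓝 L) ∧ ∀ᶠ n : ℕ in atTop,
      maxNorm (iteratedDeriv m fun x : ℝ => f x - hermiteProjF n (fun t : ℝ => f t) x) ≤
        ENNReal.ofReal (K n * (n : ℝ) ^ ((m : ℝ) / 2 + 1 / 4) * Real.exp (-ρ * √(2 * n))) := by
  set φ : ℝ → ℂ := fun t => f t with hφd
  have hF : AnalyticOnNhd ℂ (fun z : ℂ => Complex.exp (z ^ 2 / 2) * f z) (strip ρ) := by
    refine AnalyticOnNhd.mul ?_ hf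
    exact fun z _ =>
      (by fun_prop : Differentiable ℂ fun z : ℂ => Complex.exp (z ^ 2 / 2)).analyticAt z
  have hφF : ∀ x : ℝ, φ x = Real.exp (-x ^ 2 / 2) * (Complex.exp ((x : ℂ) ^ 2 / 2) * f x) := by
    intro x
    rw [← mul_assoc, Complex.ofReal_exp, ← Complex.exp_add]
    push_cast
    rw [show -(x : ℂ) ^ 2 / 2 + (x : ℂ) ^ 2 / 2 = 0 by ring, Complex.exp_zero, one_mul]
  obtain ⟨⟨A, hA, hcA⟩, hsum, hexp⟩ := exists_coeff_bound_and_expansion hρ hF hg hφF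
  set c := hermiteCoeffF φ with hc
  obtain ⟨C, hC0, hC⟩ := exists_abs_iteratedDeriv_hermitePsi_le m
  set q : ℝ := (m : ℝ) / 2 - 1 / 12 with hq
  set b : ℕ → ℝ := fun k => ‖c k‖ * (C * ((k : ℝ) + 1) ^ q) with hb
  have hbs : Summable b := by
    refine ((hsum q).mul_left C).congr fun k => ?_
    simp only [hb]; ring
  have htail : ∀ n x, ‖iteratedDeriv m (fun x => φ x - hermiteProjF n φ x) x‖ ≤
      ∑' k, b (k + (n + 1)) := by
    intro n x
    rw [iteratedDeriv_sub_hermiteProjF hsum hexp]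
    refine tsum_of_norm_bounded ((summable_nat_add_iff (n + 1)).2 hbs).hasSum fun k => ?_
    rw [norm_mul, Complex.norm_real]
    exact mul_le_mul_of_nonneg_left (hC _ x) (norm_nonneg _)
  have hR : Tendsto (fun k : ℕ => |A k| * C * (((k : ℝ) + 1) / k) ^ q * (k : ℝ) ^ (-(1 / 12) : ℝ))
      atTop (𝓝 0) := by
    have h1 := (tendsto_rpow_neg_atTop (y := 1 / 12) (by norm_num)).comp
      (tendsto_natCast_atTop_atTop (R := ℝ))
    simpa using ((hA.abs.mul_const C).mul (tendsto_succ_div_rpow q)).mul h1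
  have hbR : ∀ᶠ k : ℕ in atTop, b k ≤
      (|A k| * C * (((k : ℝ) + 1) / k) ^ q * (k : ℝ) ^ (-(1 / 12) : ℝ)) *
        ((k : ℝ) ^ (((m : ℝ) / 2 + 1 / 4) - 1 / 2) * Real.exp (-ρ * √(2 * k))) := by
    filter_upwards [hcA, eventually_gt_atTop 0] with k hk hk0
    have hk' : (0 : ℝ) < k := by exact_mod_cast hk0
    have e1 : ((k : ℝ) + 1) ^ q = (((k : ℝ) + 1) / k) ^ q * (k : ℝ) ^ q := by
      rw [← Real.mul_rpow (by positivity) hk'.le]; congr 1; field_simp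
    have e2 : (k : ℝ) ^ (-(1 / 4) : ℝ) * (k : ℝ) ^ q =
        (k : ℝ) ^ (-(1 / 12) : ℝ) * (k : ℝ) ^ (((m : ℝ) / 2 + 1 / 4) - 1 / 2) := by
      rw [← Real.rpow_add hk', ← Real.rpow_add hk', hq]; congr 1; ring
    calc b k ≤ (|A k| * (k : ℝ) ^ (-(1 / 4) : ℝ) * Real.exp (-ρ * √(2 * k))) *
          (C * ((k : ℝ) + 1) ^ q) := by
          simp only [hb]
          gcongr
          refine hk.trans ?_
          gcongr
          exact le_abs_self _
      _ = |A k| * C * (((k : ℝ) + 1) / k) ^ q * Real.exp (-ρ * √(2 * k)) *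
          ((k : ℝ) ^ (-(1 / 4) : ℝ) * (k : ℝ) ^ q) := by rw [e1]; ring
      _ = _ := by rw [e2]; ring
  obtain ⟨K, hK, hKn⟩ := exists_tendsto_of_forall_eventually_le (L := L)
    (u := fun n => ∑' k, b (k + (n + 1)))
    (g := fun n : ℕ => (n : ℝ) ^ ((m : ℝ) / 2 + 1 / 4) * Real.exp (-ρ * √(2 * n)))
    (by
      filter_upwards [eventually_gt_atTop 0] with n hn
      have : (0 : ℝ) < n := by exact_mod_cast hn
      positivity)
    (fun ε hε => by
      filter_upwards [eventually_tsum_tail_le hρ le_rfl hε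
        (fun k => by simp only [hb]; positivity) hR hbR] with n hn
      refine hn.2.trans ?_
      rw [zero_mul, zero_div]
      gcongr)
  refine ⟨K, hK, ?_⟩
  filter_upwards [hKn] with n hn
  refine iSup_le fun x => ?_
  rw [← ofReal_norm]
  refine ENNReal.ofReal_le_ofReal ((htail n x).trans (hn.trans (le_of_eq ?_)))
  ring

/-! ### The remainder in the weighted `L²` norm -/

lemma iteratedDeriv_hermiteH (m n : ℕ) :
    iteratedDeriv m (hermiteH n) =
      fun x => 2 ^ m * (n.descFactorial m : ℝ) * hermiteH (n - m) x := by
  induction m with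
  | zero => simp
  | succ m ih =>
    rw [iteratedDeriv_succ, ih]
    ext x
    refine ((hasDerivAt_hermiteH (n - m) x).const_mul _).deriv.trans ?_
    rw [Nat.descFactorial_succ, Nat.sub_sub]
    push_cast
    ring

lemma hermiteGamma_eq_mul {m n : ℕ} (h : m ≤ n) :
    hermiteGamma n = 2 ^ m * (n.descFactorial m : ℝ) * hermiteGamma (n - m) := by
  have h1 : ((n - m).factorial : ℝ) * n.descFactorial m = n.factorial := by
    exact_mod_cast Nat.factorial_mul_descFactorial h
  have h2 : (2 : ℝ) ^ n = 2 ^ m * 2 ^ (n - m) := by rw [← pow_add]; congr 1; omega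
  unfold hermiteGamma
  rw [← h1, h2]
  ring

lemma integral_iteratedDeriv_hermiteH_mul (m i j : ℕ) :
    ∫ x : ℝ, iteratedDeriv m (hermiteH i) x * iteratedDeriv m (hermiteH j) x * hermiteWeight x =
      if i = j then 2 ^ m * (j.descFactorial m : ℝ) * hermiteGamma j else 0 := by
  simp only [iteratedDeriv_hermiteH]
  have e : ∀ x : ℝ, 2 ^ m * (i.descFactorial m : ℝ) * hermiteH (i - m) x *
      (2 ^ m * (j.descFactorial m : ℝ) * hermiteH (j - m) x) * hermiteWeight x =
      (2 ^ m * (i.descFactorial m : ℝ) * (2 ^ m * (j.descFactorial m : ℝ))) *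
        (hermiteH (i - m) x * (hermiteH (j - m) x * hermiteWeight x)) := fun x => by ring
  simp_rw [e]
  rw [integral_const_mul, integral_hermiteH_mul_hermiteH]
  rcases lt_or_ge i m with hi | hi
  · rw [Nat.descFactorial_eq_zero_iff_lt.2 hi]
    split_ifs with h1 h2 <;> simp_all
  rcases lt_or_ge j m with hj | hj
  · rw [Nat.descFactorial_eq_zero_iff_lt.2 hj]
    simp
  by_cases hij : i = j
  · subst hij
    simp only [if_true]
    rw [hermiteGamma_eq_mul hi]
    ring
  · rw [if_neg hij, if_neg (by omega), mul_zero]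

lemma integrable_iteratedDeriv_hermiteH_mul (m i j : ℕ) :
    Integrable fun x : ℝ =>
      iteratedDeriv m (hermiteH i) x * iteratedDeriv m (hermiteH j) x * hermiteWeight x := by
  simp only [iteratedDeriv_hermiteH]
  refine ((integrable_hermiteH_mul_weight (i - m) (j - m)).const_mul
    (2 ^ m * (i.descFactorial m : ℝ) * (2 ^ m * (j.descFactorial m : ℝ)))).congr
    (ae_of_all _ fun x => ?_)
  ring

/-- Pythagoras for the weighted `L²` norm. -/
lemma weightedL2Norm_sum {e : ℕ → ℝ → ℝ} {N : ℕ → ℝ} (he : ∀ i, Continuous (e i))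
    (hi : ∀ i j, Integrable fun x : ℝ => e i x * e j x * hermiteWeight x)
    (ho : ∀ i j, ∫ x : ℝ, e i x * e j x * hermiteWeight x = if i = j then N j else 0)
    (a : ℕ → ℂ) (s : Finset ℕ) :
    weightedL2Norm (fun x => ∑ i ∈ s, a i * (e i x : ℂ)) =
      ENNReal.ofReal √(∑ i ∈ s, ‖a i‖ ^ 2 * N i) := by
  set g : ℝ → ℂ := fun x => ∑ i ∈ s, a i * (e i x : ℂ) with hg
  have hgc : Continuous g := by
    refine continuous_finsetSum _ fun i _ => continuous_const.mul ?_
    exact Complex.continuous_ofReal.comp (he i)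
  have hwc : Continuous hermiteWeight := by unfold hermiteWeight; fun_prop
  have hsq : ∀ x, ((‖g x‖ ^ 2 * hermiteWeight x : ℝ) : ℂ) = ∑ i ∈ s, ∑ j ∈ s,
      a i * (starRingEnd ℂ) (a j) * ((e i x * e j x * hermiteWeight x : ℝ) : ℂ) := by
    intro x
    push_cast
    rw [← Complex.mul_conj', hg]
    simp only [map_sum, map_mul, Complex.conj_ofReal]
    rw [Finset.sum_mul_sum, Finset.sum_mul]
    refine Finset.sum_congr rfl fun i _ => ?_
    rw [Finset.sum_mul]
    refine Finset.sum_congr rfl fun j _ => ?_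
    ring
  have hint : Integrable fun x => ‖g x‖ ^ 2 * hermiteWeight x := by
    have h1 : Integrable fun x => ((‖g x‖ ^ 2 * hermiteWeight x : ℝ) : ℂ) := by
      simp_rw [hsq]
      exact integrable_finsetSum _ fun i _ => integrable_finsetSum _ fun j _ =>
        ((hi i j).ofReal).const_mul _
    refine h1.re.congr (ae_of_all _ fun x => ?_)
    exact Complex.ofReal_re _
  have hval : ∫ x, ‖g x‖ ^ 2 * hermiteWeight x = ∑ i ∈ s, ‖a i‖ ^ 2 * N i := by
    have h1 : ((∫ x, ‖g x‖ ^ 2 * hermiteWeight x : ℝ) : ℂ) =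
        ((∑ i ∈ s, ‖a i‖ ^ 2 * N i : ℝ) : ℂ) := by
      rw [← integral_complex_ofReal]
      simp_rw [hsq]
      rw [integral_finsetSum _ fun i _ => integrable_finsetSum _ fun j _ =>
        ((hi i j).ofReal).const_mul _]
      rw [Complex.ofReal_sum]
      refine Finset.sum_congr rfl fun i his => ?_
      rw [integral_finsetSum _ fun j _ => ((hi i j).ofReal).const_mul _]
      simp_rw [integral_const_mul, integral_complex_ofReal, ho]
      rw [Finset.sum_eq_single i]
      · rw [if_pos rfl, Complex.mul_conj', Complex.ofReal_mul, Complex.ofReal_pow]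
      · intro j _ hj
        rw [if_neg hj.symm]; simp
      · exact fun h => absurd his h
    exact_mod_cast h1
  rw [weightedL2Norm, eLpNorm_eq_lintegral_rpow_enorm_toReal two_ne_zero ENNReal.ofNat_ne_top,
    lintegral_withDensity_eq_lintegral_mul _ (by fun_prop) (by fun_prop)]
  have h2 : ∀ x, ((fun x : ℝ => ENNReal.ofReal (hermiteWeight x)) *
      fun x => ‖g x‖ₑ ^ (2 : ENNReal).toReal) x = ENNReal.ofReal (‖g x‖ ^ 2 * hermiteWeight x) := by
    intro x
    have h3 : (0 : ℝ) ≤ ‖g x‖ ^ 2 := by positivity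
    rw [Pi.mul_apply, ENNReal.ofReal_mul h3, mul_comm, ← ofReal_norm,
      ENNReal.toReal_ofNat, ENNReal.ofReal_rpow_of_nonneg (norm_nonneg _) (by norm_num)]
    norm_num
  simp_rw [h2]
  rw [← ofReal_integral_eq_lintegral_ofReal hint (ae_of_all _ fun x => by
    have := hermiteWeight_pos x
    positivity), hval, ENNReal.toReal_ofNat, Real.sqrt_eq_rpow,
    ENNReal.ofReal_rpow_of_nonneg _ (by norm_num)]
  rw [← hval]
  exact integral_nonneg fun x => by
    have := hermiteWeight_pos x
    positivity

lemma exists_abs_iteratedDeriv_hermiteH_le : ∃ B : ℝ, 0 < B ∧ ∀ (j k : ℕ) (x : ℝ),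
    |iteratedDeriv j (hermiteH k) x| ≤
      B * 2 ^ j * ((k : ℝ) + 1) ^ j * √(hermiteGamma k) * Real.exp (x ^ 2 / 2) := by
  obtain ⟨B, hB0, hB⟩ := exists_abs_hermitePsi_le_const
  refine ⟨B, hB0, fun j k x => ?_⟩
  rw [iteratedDeriv_hermiteH]
  rcases lt_or_ge k j with hk | hk
  · rw [Nat.descFactorial_eq_zero_iff_lt.2 hk]
    simp only [Nat.cast_zero, mul_zero, zero_mul, abs_zero]
    positivity
  have hγ : hermiteGamma (k - j) ≤ hermiteGamma k := by
    rw [hermiteGamma_eq_mul hk]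
    refine le_mul_of_one_le_left (hermiteGamma_pos _).le (one_le_mul_of_one_le_of_one_le
      (one_le_pow₀ one_le_two) ?_)
    exact_mod_cast Nat.pos_of_ne_zero fun h => (Nat.descFactorial_eq_zero_iff_lt.1 h).not_ge hk
  have hd : (k.descFactorial j : ℝ) ≤ ((k : ℝ) + 1) ^ j :=
    calc (k.descFactorial j : ℝ) ≤ (k : ℝ) ^ j := by exact_mod_cast Nat.descFactorial_le_pow k j
      _ ≤ ((k : ℝ) + 1) ^ j := by gcongr; linarith
  have hs : 0 < √(hermiteGamma (k - j)) := Real.sqrt_pos.2 (hermiteGamma_pos _)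
  have hH : |hermiteH (k - j) x| ≤ B * √(hermiteGamma (k - j)) * Real.exp (x ^ 2 / 2) := by
    have h1 : hermiteH (k - j) x =
        hermitePsi (k - j) x * √(hermiteGamma (k - j)) * Real.exp (x ^ 2 / 2) := by
      have h2 : Real.exp (-x ^ 2 / 2) * Real.exp (x ^ 2 / 2) = 1 := by
        rw [← Real.exp_add]; simp [neg_div]
      rw [hermitePsi, div_mul_cancel₀ _ hs.ne', mul_right_comm, h2, one_mul]
    rw [h1, abs_mul, abs_mul, abs_of_pos hs, abs_of_pos (Real.exp_pos _)]
    gcongr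
    exact hB _ _
  rw [abs_mul, abs_of_nonneg (by positivity : (0 : ℝ) ≤ 2 ^ j * (k.descFactorial j : ℝ))]
  calc 2 ^ j * (k.descFactorial j : ℝ) * |hermiteH (k - j) x|
      ≤ 2 ^ j * ((k : ℝ) + 1) ^ j * (B * √(hermiteGamma k) * Real.exp (x ^ 2 / 2)) := by
        gcongr
        refine hH.trans ?_
        gcongr
    _ = _ := by ring

lemma hermiteCoeffP_eq {g φ : ℝ → ℂ} (hφ : ∀ x : ℝ, φ x = Real.exp (-x ^ 2 / 2) * g x) (k : ℕ) :
    hermiteCoeffP g k = hermiteCoeffF φ k / (√(hermiteGamma k) : ℝ) := by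
  have hγ : (hermiteGamma k : ℂ) = (√(hermiteGamma k) : ℝ) * (√(hermiteGamma k) : ℝ) := by
    rw [← Complex.ofReal_mul, Real.mul_self_sqrt (hermiteGamma_pos k).le]
  rw [hermiteCoeffP, hγ, ← div_div, hermiteCoeffF, ← integral_div]
  congr 2; ext x
  rw [hφ, hermitePsi, hermiteWeight, show -x ^ 2 = -x ^ 2 / 2 + -x ^ 2 / 2 by ring, Real.exp_add]
  push_cast
  ring_nf

lemma hasSum_iteratedDeriv_sub_hermiteProjP {g φ : ℝ → ℂ}
    (hφ : ∀ x : ℝ, φ x = Real.exp (-x ^ 2 / 2) * g x)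
    (hsum : ∀ q : ℝ, Summable fun k => ‖hermiteCoeffF φ k‖ * ((k : ℝ) + 1) ^ q)
    (hexp : ∀ x, φ x = ∑' n, hermiteCoeffF φ n * hermitePsi n x) (m n : ℕ) (x : ℝ) :
    HasSum (fun k => hermiteCoeffP g (k + (n + 1)) *
        ((iteratedDeriv m (hermiteH (k + (n + 1))) x : ℝ) : ℂ))
      (iteratedDeriv m (fun x => g x - hermiteProjP n g x) x) := by
  set a := hermiteCoeffP g with ha
  set c := hermiteCoeffF φ with hc
  have hac : ∀ k, a k = c k / (√(hermiteGamma k) : ℝ) := hermiteCoeffP_eq hφ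
  have hs : ∀ k, 0 < √(hermiteGamma k) := fun k => Real.sqrt_pos.2 (hermiteGamma_pos k)
  have hd : ∀ (j k : ℕ) (x : ℝ), iteratedDeriv j (fun x => a k * (hermiteH k x : ℂ)) x =
      a k * ((iteratedDeriv j (hermiteH k) x : ℝ) : ℂ) := by
    intro j k x
    rw [iteratedDeriv_const_mul_field, iteratedDeriv_ofReal_comp (contDiff_hermiteH k)]
  obtain ⟨B, hB0, hB⟩ := exists_abs_iteratedDeriv_hermiteH_le
  have hb : ∀ (j : ℕ) (r : ℝ), ∃ s : ℕ → ℝ, Summable s ∧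
      ∀ k x, |x| ≤ r → ‖iteratedDeriv j (fun x => a k * (hermiteH k x : ℂ)) x‖ ≤ s k := by
    intro j r
    refine ⟨_, (hsum j).mul_left (B * 2 ^ j * Real.exp (r ^ 2 / 2)), fun k x hx => ?_⟩
    have hx2 : x ^ 2 ≤ r ^ 2 := by rw [← sq_abs x]; gcongr
    rw [hd, norm_mul, Complex.norm_real, hac, norm_div, Complex.norm_real,
      Real.norm_of_nonneg (hs k).le, Real.rpow_natCast]
    calc ‖c k‖ / √(hermiteGamma k) * ‖iteratedDeriv j (hermiteH k) x‖
        ≤ ‖c k‖ / √(hermiteGamma k) *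
          (B * 2 ^ j * ((k : ℝ) + 1) ^ j * √(hermiteGamma k) * Real.exp (r ^ 2 / 2)) := by
          gcongr
          refine (hB j k x).trans ?_
          gcongr
      _ = _ := by
          have := (hs k).ne'
          field_simp
  have hsm : ∀ (j : ℕ) (x : ℝ),
      Summable fun k => a k * ((iteratedDeriv j (hermiteH k) x : ℝ) : ℂ) := by
    intro j x
    obtain ⟨s, hs, hs2⟩ := hb j |x|
    exact Summable.of_norm_bounded hs fun k => by simpa only [hd] using hs2 k x le_rfl
  have hrem : (fun x => g x - hermiteProjP n g x) =
      fun x => ∑' k, a (k + (n + 1)) * (hermiteH (k + (n + 1)) x : ℂ) := by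
    ext x
    have h1 : Summable fun k => a k * (hermiteH k x : ℂ) := by simpa using hsm 0 x
    have h2 : g x = ∑' k, a k * (hermiteH k x : ℂ) := by
      have he : ((Real.exp (-x ^ 2 / 2) : ℝ) : ℂ) ≠ 0 := by exact_mod_cast (Real.exp_pos _).ne'
      refine mul_left_cancel₀ he ?_
      rw [← hφ, hexp, ← tsum_mul_left]
      refine tsum_congr fun k => ?_
      rw [hac, hermitePsi]
      push_cast
      ring
    rw [h2, hermiteProjP, ← h1.sum_add_tsum_nat_add (n + 1), add_sub_cancel_left]
  rw [hrem, iteratedDeriv_tsum_of_locally_bounded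
    (u := fun k x => a (k + (n + 1)) * (hermiteH (k + (n + 1)) x : ℂ))]
  · simp only [hd]
    exact ((summable_nat_add_iff (n + 1)).2 (hsm m x)).hasSum
  · exact fun k => contDiff_const.mul (contDiff_ofReal_comp (contDiff_hermiteH _))
  · intro j r
    obtain ⟨s, hs, hs2⟩ := hb j r
    exact ⟨_, (summable_nat_add_iff (n + 1)).2 hs, fun k x => hs2 _ x⟩

/-- Bessel's inequality for a pointwise convergent orthogonal series, by Fatou's lemma. -/
lemma weightedL2Norm_le_of_hasSum {e : ℕ → ℝ → ℝ} {N : ℕ → ℝ} (he : ∀ i, Continuous (e i))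
    (hi : ∀ i j, Integrable fun x : ℝ => e i x * e j x * hermiteWeight x)
    (ho : ∀ i j, ∫ x : ℝ, e i x * e j x * hermiteWeight x = if i = j then N j else 0)
    {a : ℕ → ℂ} {g : ℝ → ℂ} (hg : ∀ x, HasSum (fun i => a i * (e i x : ℂ)) (g x)) {b : ℕ → ℝ}
    (hb : Summable b) (hab : ∀ i, ‖a i‖ ^ 2 * N i ≤ b i) (hb0 : ∀ i, 0 ≤ b i) :
    weightedL2Norm g ≤ ENNReal.ofReal √(∑' i, b i) := by
  refine (Lp.eLpNorm_lim_le_liminf_eLpNorm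
    (f := fun M x => ∑ i ∈ Finset.range M, a i * (e i x : ℂ)) (fun M => ?_) g
    (ae_of_all _ fun x => (hg x).tendsto_sum_nat)).trans ?_
  · exact (continuous_finsetSum _ fun i _ => continuous_const.mul
      (Complex.continuous_ofReal.comp (he i))).aestronglyMeasurable
  · refine liminf_le_of_le (by isBoundedDefault) fun B hB => ?_
    obtain ⟨M, hM⟩ := hB.exists
    refine hM.trans ((weightedL2Norm_sum he hi ho a _).le.trans ?_)
    refine ENNReal.ofReal_le_ofReal (Real.sqrt_le_sqrt ?_)
    exact (Finset.sum_le_sum fun i _ => hab i).trans (hb.sum_le_tsum _ fun i _ => hb0 i)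

/-- The squared remainder is the tail of an orthogonal series. The square root of the sharp constant
for such tails is the constant of the bound. -/
theorem exists_weightedL2Norm_bound {ρ : ℝ} (hρ : 0 < ρ) {f : ℂ → ℂ}
    (hf : AnalyticOnNhd ℂ f (strip ρ)) (hg : AlgebraicGrowthInStrip ρ f) (m : ℕ) :
    ∃ K : ℕ → ℝ, Tendsto K atTop
        (𝓝 ((2 : ℝ) ^ ((m : ℝ) / 2 - 1) * hermiteV ρ f / √(Real.pi * ρ))) ∧
      ∀ᶠ n : ℕ in atTop,
        weightedL2Norm (iteratedDeriv m fun x : ℝ => f x - hermiteProjP n (fun t : ℝ => f t) x) ≤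
          ENNReal.ofReal (K n * (n : ℝ) ^ ((m : ℝ) / 2) * Real.exp (-ρ * √(2 * n))) := by
  have hV : 0 ≤ hermiteV ρ f :=
    add_nonneg (integral_nonneg fun _ => norm_nonneg _) (integral_nonneg fun _ => norm_nonneg _)
  set φ : ℝ → ℂ := fun x => Real.exp (-x ^ 2 / 2) * f x with hφd
  have hφ : ∀ x : ℝ, φ x = Real.exp (-x ^ 2 / 2) * f x := fun x => rfl
  obtain ⟨⟨A, hA, hcA⟩, hsum, hexp⟩ := exists_coeff_bound_and_expansion hρ hf hg hφ
  set g : ℝ → ℂ := fun t => f t with hgd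
  have hac := hermiteCoeffP_eq (g := g) hφ
  set c := hermiteCoeffF φ with hc
  set L := (2 : ℝ) ^ ((m : ℝ) / 2 - 1) * hermiteV ρ f / √(Real.pi * ρ) with hL
  have hL0 : 0 ≤ L := by positivity
  set b : ℕ → ℝ := fun k => ‖c k‖ ^ 2 * (2 ^ m * (k : ℝ) ^ m) with hb
  have hb0 : ∀ k, 0 ≤ b k := fun k => by simp only [hb]; positivity
  set r := (√(√2 / (4 * Real.pi)) * hermiteV ρ f) ^ 2 * 2 ^ m with hr
  have hR : Tendsto (fun k => A k ^ 2 * 2 ^ m) atTop (𝓝 r) := (hA.pow 2).mul_const _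
  have hbR : ∀ᶠ k : ℕ in atTop, b k ≤ (A k ^ 2 * 2 ^ m) *
      ((k : ℝ) ^ ((m : ℝ) - 1 / 2) * Real.exp (-(2 * ρ) * √(2 * k))) := by
    filter_upwards [hcA, eventually_gt_atTop 0] with k hk hk0
    have hk' : (0 : ℝ) < k := by exact_mod_cast hk0
    have e1 : ((k : ℝ) ^ (-(1 / 4) : ℝ)) ^ 2 * (k : ℝ) ^ m = (k : ℝ) ^ ((m : ℝ) - 1 / 2) := by
      rw [← Real.rpow_natCast _ m, ← Real.rpow_natCast _ 2, ← Real.rpow_mul hk'.le,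
        ← Real.rpow_add hk']
      congr 1; push_cast; ring
    have e2 : Real.exp (-ρ * √(2 * k)) ^ 2 = Real.exp (-(2 * ρ) * √(2 * k)) := by
      rw [← Real.exp_nat_mul]; congr 1; push_cast; ring
    calc b k ≤ (A k * (k : ℝ) ^ (-(1 / 4) : ℝ) * Real.exp (-ρ * √(2 * k))) ^ 2 *
          (2 ^ m * (k : ℝ) ^ m) := by simp only [hb]; gcongr
      _ = A k ^ 2 * 2 ^ m * (((k : ℝ) ^ (-(1 / 4) : ℝ)) ^ 2 * (k : ℝ) ^ m *
          Real.exp (-ρ * √(2 * k)) ^ 2) := by ring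
      _ = _ := by rw [e1, e2]
  -- `L²` is the constant that the tail estimate produces.
  have hLr : r * √2 / (2 * ρ) = L ^ 2 := by
    have h2 : √2 * √2 = 2 := Real.mul_self_sqrt zero_le_two
    have h3 : ((2 : ℝ) ^ ((m : ℝ) / 2 - 1)) ^ 2 = 2 ^ m / 4 := by
      rw [← Real.rpow_natCast _ 2, ← Real.rpow_mul zero_le_two,
        show ((m : ℝ) / 2 - 1) * (2 : ℕ) = (m : ℝ) - (2 : ℕ) by push_cast; ring,
        Real.rpow_sub zero_lt_two, Real.rpow_natCast, Real.rpow_natCast]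
      norm_num
    rw [hr, hL, mul_pow, Real.sq_sqrt (by positivity), div_pow, mul_pow, h3,
      Real.sq_sqrt (by positivity)]
    have := Real.pi_pos
    field_simp
    linear_combination hermiteV ρ f ^ 2 * h2
  obtain ⟨K, hK, hKn⟩ := exists_tendsto_of_forall_eventually_le (L := L)
    (u := fun n => √(∑' k, b (k + (n + 1))))
    (g := fun n : ℕ => (n : ℝ) ^ ((m : ℝ) / 2) * Real.exp (-ρ * √(2 * n)))
    (by
      filter_upwards [eventually_gt_atTop 0] with n hn
      have : (0 : ℝ) < n := by exact_mod_cast hn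
      positivity)
    (fun ε hε => by
      filter_upwards [eventually_tsum_tail_le (by positivity : 0 < 2 * ρ)
        (by positivity : 0 ≤ r) (pow_pos hε 2) hb0 hR hbR] with n hn
      refine Real.sqrt_le_iff.2 ⟨by positivity, hn.2.trans ?_⟩
      have e1 : ((n : ℝ) ^ ((m : ℝ) / 2)) ^ 2 = (n : ℝ) ^ (m : ℝ) := by
        rw [← Real.rpow_natCast _ 2, ← Real.rpow_mul n.cast_nonneg]
        congr 1; push_cast; ring
      have e2 : Real.exp (-ρ * √(2 * n)) ^ 2 = Real.exp (-(2 * ρ) * √(2 * n)) := by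
        rw [← Real.exp_nat_mul]; congr 1; push_cast; ring
      rw [hLr, mul_pow, mul_pow, e1, e2]
      gcongr
      nlinarith)
  refine ⟨K, hK, ?_⟩
  obtain ⟨n₀, hn₀⟩ := (eventually_tsum_tail_le (by positivity : 0 < 2 * ρ)
    (by positivity : 0 ≤ r) one_pos hb0 hR hbR).exists
  have hbs : Summable b := (summable_nat_add_iff (n₀ + 1)).1 hn₀.1
  filter_upwards [hKn] with n hn
  rw [mul_assoc]
  refine le_trans ?_ (ENNReal.ofReal_le_ofReal hn)
  refine weightedL2Norm_le_of_hasSum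
    (e := fun k => iteratedDeriv m (hermiteH (k + (n + 1))))
    (N := fun k => 2 ^ m * ((k + (n + 1)).descFactorial m : ℝ) * hermiteGamma (k + (n + 1)))
    (fun k => ?_) (fun i j => integrable_iteratedDeriv_hermiteH_mul m _ _) (fun i j => ?_)
    (fun x => hasSum_iteratedDeriv_sub_hermiteProjP (g := g) hφ hsum hexp m n x)
    ((summable_nat_add_iff (n + 1)).2 hbs) (fun k => ?_) (fun k => hb0 _)
  · exact (contDiff_hermiteH (k + (n + 1)) (k := ⊤)).continuous_iteratedDeriv m le_top
  · simp only [integral_iteratedDeriv_hermiteH_mul, add_left_inj]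
  · generalize k + (n + 1) = k
    have hγ := hermiteGamma_pos k
    rw [hac, norm_div, Complex.norm_real, Real.norm_of_nonneg (Real.sqrt_nonneg _), div_pow,
      Real.sq_sqrt hγ.le]
    calc ‖c k‖ ^ 2 / hermiteGamma k * (2 ^ m * (k.descFactorial m : ℝ) * hermiteGamma k)
        = ‖c k‖ ^ 2 * (2 ^ m * (k.descFactorial m : ℝ)) := by field_simp
      _ ≤ b k := by
        simp only [hb]
        gcongr
        exact_mod_cast Nat.descFactorial_le_pow k m

end

/-! ### Both approximation theorems -/

theorem mainTheorem8 (m : ℕ) (ρ : ℝ) (hρ : 0 < ρ) (f : ℂ → ℂ)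
    (hf : AnalyticOnNhd ℂ f (strip ρ)) :
    (AlgebraicGrowthInStrip ρ f →
      ∃ K : ℕ → ℝ,
        Tendsto K atTop
          (𝓝 ((2 : ℝ) ^ ((m : ℝ) / 2 - 1) * hermiteV ρ f / Real.sqrt (Real.pi * ρ))) ∧
        ∀ᶠ n : ℕ in atTop,
          weightedL2Norm (iteratedDeriv m fun x : ℝ =>
              f (x : ℂ) - hermiteProjP n (fun t : ℝ => f (t : ℂ)) x) ≤
            ENNReal.ofReal
              (K n * (n : ℝ) ^ ((m : ℝ) / 2) * Real.exp (-ρ * Real.sqrt (2 * (n : ℝ))))) ∧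
    (AlgebraicGrowthInStrip ρ (fun z : ℂ => Complex.exp (z ^ 2 / 2) * f z) →
      (∃ K : ℕ → ℝ,
        Tendsto K atTop
          (𝓝 ((2 : ℝ) ^ ((m : ℝ) / 2 - 1 / 4) * hermiteVHat ρ f /
            Real.pi ^ ((3 : ℝ) / 4))) ∧
        ∀ᶠ n : ℕ in atTop,
          maxNorm (iteratedDeriv m fun x : ℝ =>
              f (x : ℂ) - hermiteProjF n (fun t : ℝ => f (t : ℂ)) x) ≤
            ENNReal.ofReal
              (K n * (n : ℝ) ^ ((m : ℝ) / 2 + 1 / 4) *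
                Real.exp (-ρ * Real.sqrt (2 * (n : ℝ))))) ∧
      (∃ K : ℕ → ℝ,
        Tendsto K atTop
          (𝓝 ((2 : ℝ) ^ ((m : ℝ) / 2 - 1 / 4) * hermiteVHat ρ f /
            (Real.pi ^ ((3 : ℝ) / 4) * ρ))) ∧
        ∀ᶠ n : ℕ in atTop,
          maxNorm (iteratedDeriv m fun x : ℝ =>
              f (x : ℂ) - hermiteProjF n (fun t : ℝ => f (t : ℂ)) x) ≤
            ENNReal.ofReal
              (K n * (n : ℝ) ^ ((m : ℝ) / 2 + 1 / 4) *
                Real.exp (-ρ * Real.sqrt (2 * (n : ℝ)))))) := by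
  refine ⟨fun hg => exists_weightedL2Norm_bound hρ hf hg m, fun hg => ?_⟩
  have hV : 0 ≤ hermiteVHat ρ f :=
    add_nonneg (integral_nonneg fun _ => norm_nonneg _) (integral_nonneg fun _ => norm_nonneg _)
  exact ⟨exists_maxNorm_bound hρ hf hg m (by positivity),
    exists_maxNorm_bound hρ hf hg m (by positivity)⟩
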